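/- Call a finite graph $G$ a rooted directed path graph if there is a rooted tree $T$, with edges directed away from the root, whose nodes are the maximal cliques of $G$, such that for every vertex $v$ of $G$ the maximal cliques containing $v$ form a directed path in $T$ (so that $G$ is the intersection graph of these paths). A dominating set of $G$ is a set $S$ of vertices such that every vertex not in $S$ is adjacent to a vertex in $S$. Theorem. The number of dominating sets of a rooted directed path graph with $n\ge 1$ vertices can be computed in $O(n^3)$ time. That is, there are a fixed program and a constant $C$ such that, given the number $n\ge 1$ of vertices and the adjacency matrix of any rooted directed path graph $G$ on $n$ vertices (no tree is given), the program halts after at most $C n^3$ steps and outputs the number of dominating sets of $G$. A step is an elementary operation of a random access machine, whose words hold indices of $O(\log n)$ bits and are incremented, decremented, compared, and used as addresses, or an addition, a multiplication or a copy of nonnegative integers held in separate number cells that do not influence control or addresses; every integer stored in a number cell has at most $Cn$ bits. -/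

import Mathlib

/-! ### Dominating sets and rooted directed path graphs -/

/-- `S` is a dominating set of `G`: every vertex not in `S` is adjacent to a vertex in `S`. -/
def IsDominatingSet {V : Type*} (G : SimpleGraph V) (S : Finset V) : Prop :=
  ∀ v, v ∉ S → ∃ u ∈ S, G.Adj v u

/-- The number of dominating sets of `G`. -/
noncomputable def numDominatingSets {V : Type*} (G : SimpleGraph V) : ℕ :=
  Nat.card {S : Finset V // IsDominatingSet G S}

/-- The maximal cliques of `G` (maximal with respect to inclusion). -/
abbrev MaxClique {V : Type*} (G : SimpleGraph V) : Type _ :=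
  {Q : Set V // Maximal G.IsClique Q}

/-- The edges of the tree `T`, oriented away from the root `r`: `x` is the parent of `y`. -/
def RootedEdge {N : Type*} (T : SimpleGraph N) (r : N) (x y : N) : Prop :=
  T.Adj x y ∧ T.dist r y = T.dist r x + 1

/-- The set of nodes `P` is the node set of a (non-empty) directed path of the tree `T` whose edges
are oriented away from the root `r`. -/
def IsRootedPath {N : Type*} (T : SimpleGraph N) (r : N) (P : Set N) : Prop :=
  ∃ l : List N, l ≠ [] ∧ l.IsChain (RootedEdge T r) ∧ P = {x | x ∈ l}

/-- `G` is a rooted directed path graph: its maximal cliques are the nodes of a rooted directed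
tree such that, for every vertex `v`, the maximal cliques that contain `v` form a directed path.
(As every edge lies in a maximal clique, `G` is then the intersection graph of these paths.) -/
def IsRootedDirectedPathGraph {V : Type*} (G : SimpleGraph V) : Prop :=
  ∃ (T : SimpleGraph (MaxClique G)) (r : MaxClique G), T.IsTree ∧
    ∀ v : V, IsRootedPath T r {Q | v ∈ Q.1}

/-! ### A random access machine with a step count

Programs work on three kinds of memory, all cells of which are natural numbers: scalar word
variables, two-dimensional arrays of words, and two-dimensional arrays of numbers.
Words serve as data, as array indices and for control. A word operation increments, decrements,
reads an array cell or compares; so after `t` steps no word exceeds the largest initial word or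
constant of the program by more than `t`, and words in a computation with polynomially many steps
have logarithmically many bits.
Numbers can be added, multiplied and copied; they can influence neither control nor addresses, and
the semantics admits only computations that store numbers of at most `B` bits.
Each operation costs one step. -/

/-- A memory state. Variables and arrays are named by natural numbers. -/
structure Store where
  /-- the word variables -/
  var : ℕ → ℕ
  /-- the arrays of words: name, row, column -/
  arr : ℕ → ℕ → ℕ → ℕ
  /-- the arrays of numbers: name, row, column -/
  num : ℕ → ℕ → ℕ → ℕ

/-- Word-valued expressions. -/
inductive WExp where
  | lit (c : ℕ)
  | var (x : ℕ)
  | arr (a : ℕ) (i j : WExp)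
  | succ (e : WExp)
  | pred (e : WExp)

/-- The value of a word expression (the predecessor of `0` is `0`). -/
def WExp.eval (s : Store) : WExp → ℕ
  | .lit c => c
  | .var x => s.var x
  | .arr a i j => s.arr a (i.eval s) (j.eval s)
  | .succ e => e.eval s + 1
  | .pred e => e.eval s - 1

/-- The number of steps for evaluating a word expression. -/
def WExp.cost : WExp → ℕ
  | .lit _ => 1
  | .var _ => 1
  | .arr _ i j => i.cost + j.cost + 1
  | .succ e => e.cost + 1
  | .pred e => e.cost + 1

/-- Tests. -/
inductive Test where
  | eq (e f : WExp)
  | lt (e f : WExp)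
  | not (b : Test)
  | and (b c : Test)
  | or (b c : Test)

/-- The truth value of a test. -/
def Test.holds (s : Store) : Test → Prop
  | .eq e f => e.eval s = f.eval s
  | .lt e f => e.eval s < f.eval s
  | .not b => ¬ b.holds s
  | .and b c => b.holds s ∧ c.holds s
  | .or b c => b.holds s ∨ c.holds s

/-- The number of steps for evaluating a test. -/
def Test.cost : Test → ℕ
  | .eq e f => e.cost + f.cost + 1
  | .lt e f => e.cost + f.cost + 1
  | .not b => b.cost + 1
  | .and b c => b.cost + c.cost + 1
  | .or b c => b.cost + c.cost + 1

/-- Number-valued expressions. -/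
inductive NExp where
  | zero
  | one
  | num (a : ℕ) (i j : WExp)
  | add (e f : NExp)
  | mul (e f : NExp)

/-- The value of a number expression. -/
def NExp.eval (s : Store) : NExp → ℕ
  | .zero => 0
  | .one => 1
  | .num a i j => s.num a (i.eval s) (j.eval s)
  | .add e f => e.eval s + f.eval s
  | .mul e f => e.eval s * f.eval s

/-- The number of steps for evaluating a number expression. -/
def NExp.cost : NExp → ℕ
  | .zero => 1
  | .one => 1
  | .num _ i j => i.cost + j.cost + 1
  | .add e f => e.cost + f.cost + 1
  | .mul e f => e.cost + f.cost + 1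

/-- Programs. -/
inductive Prog where
  | skip
  | setVar (x : ℕ) (e : WExp)
  | setArr (a : ℕ) (i j : WExp) (e : WExp)
  | setNum (a : ℕ) (i j : WExp) (e : NExp)
  | seq (p q : Prog)
  | ite (b : Test) (p q : Prog)
  | loop (b : Test) (p : Prog)

/-- Assign `v` to the word variable `x`. -/
def Store.setVar (s : Store) (x v : ℕ) : Store :=
  { s with var := fun y => if y = x then v else s.var y }

/-- Assign `v` to the cell `(i, j)` of the word array `a`. -/
def Store.setArr (s : Store) (a i j v : ℕ) : Store :=
  { s with arr := fun b k l => if b = a ∧ k = i ∧ l = j then v else s.arr b k l }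

/-- Assign `v` to the cell `(i, j)` of the number array `a`. -/
def Store.setNum (s : Store) (a i j v : ℕ) : Store :=
  { s with num := fun b k l => if b = a ∧ k = i ∧ l = j then v else s.num b k l }

/-- `Run B p s s' t`: the program `p`, started in the state `s`, halts in the state `s'` after
exactly `t` steps, and every number that it stores has at most `B` bits. (`Prog.loop b p` repeats
`p` as long as `b` holds.) -/
inductive Run (B : ℕ) : Prog → Store → Store → ℕ → Prop where
  | skip (s : Store) : Run B .skip s s 1
  | setVar (s : Store) (x : ℕ) (e : WExp) :
      Run B (.setVar x e) s (s.setVar x (e.eval s)) (e.cost + 1)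
  | setArr (s : Store) (a : ℕ) (i j e : WExp) :
      Run B (.setArr a i j e) s (s.setArr a (i.eval s) (j.eval s) (e.eval s))
        (i.cost + j.cost + e.cost + 1)
  | setNum (s : Store) (a : ℕ) (i j : WExp) (e : NExp) (h : e.eval s < 2 ^ B) :
      Run B (.setNum a i j e) s (s.setNum a (i.eval s) (j.eval s) (e.eval s))
        (i.cost + j.cost + e.cost + 1)
  | seq {p q : Prog} {s s₁ s₂ : Store} {t₁ t₂ : ℕ} (hp : Run B p s s₁ t₁)
      (hq : Run B q s₁ s₂ t₂) : Run B (.seq p q) s s₂ (t₁ + t₂)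
  | iteTrue {b : Test} {p q : Prog} {s s₁ : Store} {t : ℕ} (hb : b.holds s)
      (hp : Run B p s s₁ t) : Run B (.ite b p q) s s₁ (b.cost + t + 1)
  | iteFalse {b : Test} {p q : Prog} {s s₁ : Store} {t : ℕ} (hb : ¬ b.holds s)
      (hq : Run B q s s₁ t) : Run B (.ite b p q) s s₁ (b.cost + t + 1)
  | loopDone {b : Test} {p : Prog} {s : Store} (hb : ¬ b.holds s) :
      Run B (.loop b p) s s (b.cost + 1)
  | loopStep {b : Test} {p : Prog} {s s₁ s₂ : Store} {t₁ t₂ : ℕ} (hb : b.holds s)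
      (hp : Run B p s s₁ t₁) (hl : Run B (.loop b p) s₁ s₂ t₂) :
      Run B (.loop b p) s s₂ (b.cost + t₁ + t₂ + 1)

open Classical in
/-- The initial state for the input graph `G` on the vertices `0, …, n - 1`: the variable `0` holds
`n`, the word array `0` holds the adjacency matrix of `G`, and everything else is `0`. -/
noncomputable def graphInput {n : ℕ} (G : SimpleGraph (Fin n)) : Store where
  var x := if x = 0 then n else 0
  arr a i j := if a = 0 ∧ ∃ (hi : i < n) (hj : j < n), G.Adj ⟨i, hi⟩ ⟨j, hj⟩ then 1 else 0
  num _ _ _ := 0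

/-!
# Counting the dominating sets of a rooted directed path graph in cubic time

**Orders.** Let the vertices of a rooted directed path graph be sorted such that those of a node of
the clique tree come before those that first occur below it. If `x` comes after `u`, and `x` has a
neighbour that is `u` or an earlier neighbour of `u`, then the path of `x` begins at or below the
node where `u` begins, and hence all neighbours of `x` that are not later than `u` are `u` or
neighbours of `u`. This property (`IsTreeOrder`) is all that the counting needs, so that a tree
need not be found.

**Finding an order.** A rooted clique tree shows that every set of vertices has a simplicial vertex
(`RootedModel.exists_simplicial`), so that a perfect elimination order is found greedily
(`Spec.peoProg`). It provides `n` cliques, the maximal ones among them (`PEO.exists_clq`), and `2n`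
connected sets, the blocks, among which are all components of the graph minus a maximal clique
(`PEO.exists_block`). The blocks, and the whole graph as the last one, are ordered by increasing size.
For each block, a clique `R` is sought that can be the top node of the part of a clique tree that
belongs to the block; it splits the rest of the block into smaller blocks. The tests in `Accept` are
such that
* each accepted clique yields an order, in which the clique comes first and the components follow,
  sorted by `blockKey` (`Blocks.isTreeOrder`);
* the top node of a block in a clique tree is accepted (`RootedModel.exists_accept`).

The main point is that two components `l` and `k` of the graph minus `R` can be arranged one after
the other unless each of them sees the boundary of the other one in a non-uniform way (`Conflict`).
A clique tree puts at most one of two conflicting components below `R`, and the boundaries of all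
the components that are not below `R` are nested. So it suffices to look at the one in conflict
with `l` whose boundary is largest, the `partner` of `l`, instead of at all pairs. This, and the
fact that all relations involve at most three indices, keeps the time cubic.

**Counting.** The order makes the graph an `ElimForest`, whose parent function is read off from the
graph. The vertices are processed from the last to the first; the chosen set is kept as a family of
independent parts, one for each row, and processing a vertex merges its row into the row of its
parent. A vertex is adjacent to all earlier vertices in its row when it is processed, so that the
effect of a choice of vertices in a row on the rest of the graph is described by one number, its
`state`: the first chosen vertex, or the last vertex that is not yet dominated. With the right
encoding, the state of a union is the maximum of the states (`state_union`). Hence two rows are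
merged in linear time by means of partial sums (`cntSets_union`, `ElimForest.rowCount_succ`,
`maxConv`). All numbers that are stored count subsets of the vertices, hence have `O(n)` bits.

**The machine.** `Spec` states total correctness and a bound on the steps with a hidden constant.
Most programs are sequences of `Prog.fill`, which computes a table by three nested loops;
`Spec.table` reduces its correctness to a statement about one entry. The variables `0, …, 4` hold
`n`, `1`, `2n`, `2n + 1`, `n + 1`, the variables `10, …, 13` are local to `Prog.fill`, and `20, …,
23` serve as counters and registers.
-/

/-! ### Total correctness with a step bound -/

/-- Started in `s`, the program `p` halts after at most `c` steps in a state that satisfies `Q`. -/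
def RunsTo (B : ℕ) (p : Prog) (s : Store) (c : ℕ) (Q : Store → Prop) : Prop :=
  ∃ s' t, Run B p s s' t ∧ t ≤ c ∧ Q s'

theorem RunsTo.mono {B p s c c' Q Q'} (h : RunsTo B p s c Q) (hc : c ≤ c')
    (hQ : ∀ s', Q s' → Q' s') : RunsTo B p s c' Q' := by
  obtain ⟨s', t, h1, h2, h3⟩ := h
  exact ⟨s', t, h1, h2.trans hc, hQ _ h3⟩

theorem RunsTo.seq {B p q s c₁ c₂ Q}
    (h : RunsTo B p s c₁ (fun s₁ => RunsTo B q s₁ c₂ Q)) :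
    RunsTo B (.seq p q) s (c₁ + c₂) Q := by
  obtain ⟨s', t, h1, h2, s'', t', h3, h4, h5⟩ := h
  exact ⟨s'', t + t', .seq h1 h3, by omega, h5⟩

theorem RunsTo.setVar {B s x e} {Q : Store → Prop} (h : Q (s.setVar x (e.eval s))) :
    RunsTo B (.setVar x e) s (e.cost + 1) Q :=
  ⟨_, _, .setVar s x e, le_rfl, h⟩

theorem RunsTo.setArr {B s a i j e} {Q : Store → Prop}
    (h : Q (s.setArr a (i.eval s) (j.eval s) (e.eval s))) :
    RunsTo B (.setArr a i j e) s (i.cost + j.cost + e.cost + 1) Q :=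
  ⟨_, _, .setArr s a i j e, le_rfl, h⟩

theorem RunsTo.setNum {B s a i j e} {Q : Store → Prop} (hb : e.eval s < 2 ^ B)
    (h : Q (s.setNum a (i.eval s) (j.eval s) (e.eval s))) :
    RunsTo B (.setNum a i j e) s (i.cost + j.cost + e.cost + 1) Q :=
  ⟨_, _, .setNum s a i j e hb, le_rfl, h⟩

theorem RunsTo.ite {B s b p q c} {Q : Store → Prop}
    (hp : b.holds s → RunsTo B p s c Q) (hq : ¬ b.holds s → RunsTo B q s c Q) :
    RunsTo B (.ite b p q) s (b.cost + c + 1) Q := by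
  by_cases hb : b.holds s
  · obtain ⟨s', t, h1, h2, h3⟩ := hp hb
    exact ⟨s', _, .iteTrue hb h1, by omega, h3⟩
  · obtain ⟨s', t, h1, h2, h3⟩ := hq hb
    exact ⟨s', _, .iteFalse hb h1, by omega, h3⟩

/-- `for x = 0, …, L - 1 do p`, where the variable `L` holds the bound. -/
def Prog.for (x L : ℕ) (p : Prog) : Prog :=
  .seq (.setVar x (.lit 0)) (.loop (.lt (.var x) (.var L)) (.seq p (.setVar x (.succ (.var x)))))

/-- The loop from the counter value `k = N - m` on. Each of the `m` rounds costs up to `7` steps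
for the test and the increment. -/
theorem RunsTo.loop_aux {B p x L N c} (I : ℕ → Store → Prop)
    (hb : ∀ k s, k < N → s.var x = k → s.var L = N → I k s → RunsTo B p s c
      (fun s' => s'.var x = k ∧ s'.var L = N ∧ I (k + 1) (s'.setVar x (k + 1))))
    (hL : L ≠ x) (m k : ℕ) (hk : k + m = N) (s : Store) (hx : s.var x = k) (hN : s.var L = N)
    (hI : I k s) :
    RunsTo B (.loop (.lt (.var x) (.var L)) (.seq p (.setVar x (.succ (.var x))))) s
      ((c + 7) * m + 4) (fun s' => s'.var x = N ∧ s'.var L = N ∧ I N s') := by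
  induction m generalizing k s with
  | zero =>
    refine ⟨s, _, .loopDone ?_, ?_, by omega, hN, by simpa [show k = N by omega] using hI⟩
    · simp only [Test.holds, WExp.eval]; omega
    · simp [Test.cost, WExp.cost]
  | succ m ih =>
    obtain ⟨s1, t1, h1, h2, h3, h4, h5⟩ := hb k s (by omega) hx hN hI
    obtain ⟨s2, t2, g1, g2, g3⟩ := ih (k + 1) (by omega) (s1.setVar x (k + 1))
      (by simp [Store.setVar]) (by simp [Store.setVar, hL, h4]) h5
    refine ⟨s2, _, .loopStep (t₂ := t2) ?_ (.seq h1 (.setVar s1 x _)) ?_, ?_, g3⟩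
    · simp only [Test.holds, WExp.eval]; omega

    · simpa [WExp.eval, h3] using g1
    · simp only [Test.cost, WExp.cost]
      nlinarith

/-- The invariant `I i` holds before round `i`. The body may change neither the counter `x` nor the
bound `L`. -/
theorem RunsTo.for {B p x L N c s} (I : ℕ → Store → Prop) (hL : L ≠ x) (hN : s.var L = N)
    (h0 : I 0 (s.setVar x 0))
    (hb : ∀ k s, k < N → s.var x = k → s.var L = N → I k s → RunsTo B p s c
      (fun s' => s'.var x = k ∧ s'.var L = N ∧ I (k + 1) (s'.setVar x (k + 1)))) :
    RunsTo B (.for x L p) s ((c + 7) * (N + 1)) (I N) := by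
  have := RunsTo.loop_aux (B := B) I hb hL N 0 (by omega) (s.setVar x 0) (by simp [Store.setVar])
    (by simp [Store.setVar, hL, hN]) h0
  refine RunsTo.mono (c := (1 + 1) + ((c + 7) * N + 4)) ?_ (by nlinarith) fun _ h => h
  exact RunsTo.seq (RunsTo.setVar (e := .lit 0)
    (RunsTo.mono this le_rfl fun s' h => h.2.2))

/-! ### Specifications with hidden constants -/

/-- From every state that satisfies `Pre x`, the program `p` reaches a state that satisfies `Post x`
within `O((n + 1) ^ d)` steps, where `n = sz x` and all stored numbers have at most `2 n` bits.
The parameter `x` carries the data that the specification refers to. -/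
def Spec {α : Type*} (sz : α → ℕ) (d : ℕ) (p : Prog) (Pre Post : α → Store → Prop) : Prop :=
  ∃ C, ∀ x B s, 2 * sz x ≤ B → Pre x s → RunsTo B p s (C * (sz x + 1) ^ d) (Post x)

/-- Weakening a specification, and passing from the parameter `y` of the new specification to a
parameter `x` of the old one that may depend on the initial state. In this way data of the state
itself can serve as a parameter. -/
theorem Spec.conseq {α β : Type*} {sz : α → ℕ} {sz' : β → ℕ} {d d' p} {Pre Post : α → Store → Prop}
    {Pre' Post' : β → Store → Prop} (h : Spec sz d p Pre Post) (hd : d ≤ d')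
    (H : ∀ y s, Pre' y s → ∃ x, sz x = sz' y ∧ Pre x s ∧ ∀ s', Post x s' → Post' y s') :
    Spec sz' d' p Pre' Post' := by
  obtain ⟨C, h⟩ := h
  refine ⟨C, fun y B s hB hs => ?_⟩
  obtain ⟨x, hx, h1, h2⟩ := H y s hs
  refine (h x B s (by omega) h1).mono ?_ h2
  rw [hx]
  exact Nat.mul_le_mul_left _ (Nat.pow_le_pow_right (by omega) hd)

theorem Spec.seq {α : Type*} {sz : α → ℕ} {d p q} {Pre Mid Post : α → Store → Prop}
    (h₁ : Spec sz d p Pre Mid) (h₂ : Spec sz d q Mid Post) : Spec sz d (.seq p q) Pre Post := by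
  obtain ⟨C₁, h₁⟩ := h₁
  obtain ⟨C₂, h₂⟩ := h₂
  refine ⟨C₁ + C₂, fun x B s hB hs => ?_⟩
  rw [add_mul]
  exact RunsTo.seq ((h₁ x B s hB hs).mono le_rfl fun s' h => h₂ x B s' hB h)

theorem Spec.setVar {α : Type*} {sz : α → ℕ} {d x e} {Pre Post : α → Store → Prop}
    (h : ∀ y s, Pre y s → Post y (s.setVar x (e.eval s))) :
    Spec sz d (.setVar x e) Pre Post :=
  ⟨e.cost + 1, fun y _ s _ hs => (RunsTo.setVar (Q := Post y) (h y s hs)).mono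
    (Nat.le_mul_of_pos_right _ (by positivity)) fun _ h => h⟩

theorem Spec.setArr {α : Type*} {sz : α → ℕ} {d a i j e} {Pre Post : α → Store → Prop}
    (h : ∀ y s, Pre y s → Post y (s.setArr a (i.eval s) (j.eval s) (e.eval s))) :
    Spec sz d (.setArr a i j e) Pre Post :=
  ⟨i.cost + j.cost + e.cost + 1, fun y _ s _ hs => (RunsTo.setArr (Q := Post y) (h y s hs)).mono
    (Nat.le_mul_of_pos_right _ (by positivity)) fun _ h => h⟩

theorem Spec.setNum {α : Type*} {sz : α → ℕ} {d a i j e} {Pre Post : α → Store → Prop}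
    (hb : ∀ y s, Pre y s → e.eval s < 2 ^ (2 * sz y))
    (h : ∀ y s, Pre y s → Post y (s.setNum a (i.eval s) (j.eval s) (e.eval s))) :
    Spec sz d (.setNum a i j e) Pre Post :=
  ⟨i.cost + j.cost + e.cost + 1, fun y B s hB hs => (RunsTo.setNum (Q := Post y)
    ((hb y s hs).trans_le (Nat.pow_le_pow_right (by omega) hB)) (h y s hs)).mono
    (Nat.le_mul_of_pos_right _ (by positivity)) fun _ h => h⟩

/-- The rule for loops: `I x k` holds before the round `k`. -/
theorem Spec.for {α : Type*} {sz : α → ℕ} {d v L p} (N : α → ℕ) (I : α → ℕ → Store → Prop)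
    {Pre Post : α → Store → Prop} (hL : L ≠ v) (hN : ∀ x, N x ≤ 2 * sz x + 1)
    (h0 : ∀ x s, Pre x s → s.var L = N x ∧ I x 0 (s.setVar v 0))
    (hb : Spec (α := α × ℕ) (fun x => sz x.1) d p
      (fun x s => x.2 < N x.1 ∧ s.var v = x.2 ∧ s.var L = N x.1 ∧ I x.1 x.2 s)
      (fun x s => s.var v = x.2 ∧ s.var L = N x.1 ∧ I x.1 (x.2 + 1) (s.setVar v (x.2 + 1))))
    (h1 : ∀ x s, I x (N x) s → Post x s) : Spec sz (d + 1) (.for v L p) Pre Post := by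
  obtain ⟨C, hb⟩ := hb
  refine ⟨2 * (C + 7), fun x B s hB hs => ?_⟩
  obtain ⟨h2, h3⟩ := h0 x s hs
  refine (RunsTo.for (c := C * (sz x + 1) ^ d) (I x) hL h2 h3 fun k s hk hx hl hI =>
    hb (x, k) B s hB ⟨hk, hx, hl, hI⟩).mono ?_ fun s' h => h1 x s' h
  have e1 : 1 ≤ (sz x + 1) ^ d := Nat.one_le_pow _ _ (by omega)
  calc (C * (sz x + 1) ^ d + 7) * (N x + 1)
      ≤ ((C + 7) * (sz x + 1) ^ d) * (2 * (sz x + 1)) :=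
        Nat.mul_le_mul (by nlinarith) (by have := hN x; omega)
    _ = 2 * (C + 7) * (sz x + 1) ^ (d + 1) := by ring

theorem RunsTo.skip {B s} {Q : Store → Prop} (h : Q s) : RunsTo B .skip s 1 Q :=
  ⟨_, _, .skip s, le_rfl, h⟩

/-! ### Filling a table -/

/-- The expression does not read the array `a`. -/
def WExp.avoids (a : ℕ) : WExp → Bool
  | .lit _ => true
  | .var _ => true
  | .arr b i j => (b != a) && i.avoids a && j.avoids a
  | .succ e => e.avoids a
  | .pred e => e.avoids a

/-- The test does not read the array `a`. -/
def Test.avoids (a : ℕ) : Test → Bool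
  | .eq e f => e.avoids a && f.avoids a
  | .lt e f => e.avoids a && f.avoids a
  | .not b => b.avoids a
  | .and b c => b.avoids a && c.avoids a
  | .or b c => b.avoids a && c.avoids a

/-- An expression that does not read the array `a` has the same value in states that differ only in
`a` (and in the numbers). -/
theorem WExp.eval_congr {a s s'} (hv : s.var = s'.var) (ha : ∀ b ≠ a, s.arr b = s'.arr b) :
    ∀ e : WExp, e.avoids a = true → e.eval s = e.eval s'
  | .lit _, _ => rfl
  | .var _, _ => by simp [WExp.eval, hv]
  | .arr b i j, h => by
    simp only [WExp.avoids, Bool.and_eq_true, bne_iff_ne] at h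
    simp [WExp.eval, eval_congr hv ha i h.1.2, eval_congr hv ha j h.2, ha b h.1.1]
  | .succ e, h => by simp [WExp.eval, eval_congr hv ha e h]
  | .pred e, h => by simp [WExp.eval, eval_congr hv ha e h]

theorem Test.holds_congr {a s s'} (hv : s.var = s'.var) (ha : ∀ b ≠ a, s.arr b = s'.arr b) :
    ∀ t : Test, t.avoids a = true → (t.holds s ↔ t.holds s')
  | .eq e f, h => by
    simp only [Test.avoids, Bool.and_eq_true] at h
    simp [Test.holds, WExp.eval_congr hv ha e h.1, WExp.eval_congr hv ha f h.2]
  | .lt e f, h => by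
    simp only [Test.avoids, Bool.and_eq_true] at h
    simp [Test.holds, WExp.eval_congr hv ha e h.1, WExp.eval_congr hv ha f h.2]
  | .not b, h => by simp [Test.holds, holds_congr hv ha b h]
  | .and b c, h => by
    simp only [Test.avoids, Bool.and_eq_true] at h
    simp [Test.holds, holds_congr hv ha b h.1, holds_congr hv ha c h.2]
  | .or b c, h => by
    simp only [Test.avoids, Bool.and_eq_true] at h
    simp [Test.holds, holds_congr hv ha b h.1, holds_congr hv ha c h.2]

/-- The state `s` with the values `i`, `j`, `k`, `r` in the variables `10`, `11`, `12`, `13`, which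
hold the row, the column, the counter of the inner loop and the accumulator of `Prog.fill`. -/
def Store.loc (s : Store) (i j k r : ℕ) : Store :=
  { s with var := fun y => if y = 10 then i else if y = 11 then j else if y = 12 then k else
      if y = 13 then r else s.var y }

/-- Fill the array `a` in the rows below `L₁` and the columns below `L₂`. The entry starts as
`init`, and for `k = 0, …, L₃ - 1` it is replaced by `e` if the test `t` holds. -/
def Prog.fill (a L₁ L₂ L₃ : ℕ) (init : WExp) (t : Test) (e : WExp) : Prog :=
  .for 10 L₁ (.for 11 L₂ (.seq (.setVar 12 (.lit 0)) (.seq (.setVar 13 (.lit 0))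
    (.seq (.setVar 13 init) (.seq (.for 12 L₃ (.ite t (.setVar 13 e) .skip))
      (.setArr a (.var 10) (.var 11) (.var 13)))))))

open Classical in
/-- The accumulator of `Prog.fill` after `k` rounds of the inner loop. -/
noncomputable def fillVal (s : Store) (init : WExp) (t : Test) (e : WExp) (i j : ℕ) : ℕ → ℕ
  | 0 => init.eval (s.loc i j 0 0)
  | k + 1 => if t.holds (s.loc i j k (fillVal s init t e i j k))
      then e.eval (s.loc i j k (fillVal s init t e i j k)) else fillVal s init t e i j k

/-- The states that agree outside of the variables `10, …, 13` and the array `a`. -/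
def AgreeOff (a : ℕ) (s s' : Store) : Prop :=
  s'.num = s.num ∧ (∀ y, y ∉ [10, 11, 12, 13] → s'.var y = s.var y) ∧ ∀ b ≠ a, s'.arr b = s.arr b

theorem AgreeOff.var_eq {a s s'} (h : AgreeOff a s s') {i j k r} (h0 : s'.var 10 = i)
    (h1 : s'.var 11 = j) (h2 : s'.var 12 = k) (h3 : s'.var 13 = r) :
    s'.var = (s.loc i j k r).var := by
  funext y
  simp only [Store.loc]
  split_ifs with g0 g1 g2 g3
  · rw [g0, h0]
  · rw [g1, h1]
  · rw [g2, h2]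
  · rw [g3, h3]
  · exact h.2.1 y (by simp; tauto)

open Classical in
/-- The tests and expressions may not read the array `a`: the entries written earlier then do not
influence the later ones, and `fillVal` can be computed in the initial state. -/
theorem RunsTo.fill {B a L₁ L₂ L₃ init t e s} (h₁ : L₁ ∉ [10, 11, 12, 13])
    (h₂ : L₂ ∉ [10, 11, 12, 13]) (h₃ : L₃ ∉ [10, 11, 12, 13]) (hi : init.avoids a = true)
    (ht : t.avoids a = true) (he : e.avoids a = true) :
    RunsTo B (.fill a L₁ L₂ L₃ init t e) s
      (((2 * (t.cost + e.cost + init.cost) + 39) *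
          ((s.var L₃ + 1) * (s.var L₂ + 1) * (s.var L₁ + 1))))
      (fun s' => AgreeOff a s s' ∧ ∀ i j, s'.arr a i j =
        if i < s.var L₁ ∧ j < s.var L₂ then fillVal s init t e i j (s.var L₃) else s.arr
            a i j) := by
  set N := s.var L₁
  set M := s.var L₂
  set K := s.var L₃
  set c := t.cost + e.cost + init.cost
  refine RunsTo.mono (c := ((((c + 9) * (K + 1) + 16 + c) + 7) * (M + 1) + 7) * (N + 1)) ?_ ?_
    fun _ h => h
  · refine (RunsTo.for (fun i s' => AgreeOff a s s' ∧ ∀ i' j, s'.arr a i' j =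
        if i' < i ∧ j < M then fillVal s init t e i' j K else s.arr a i' j) (by
          rintro rfl; simp at h₁) rfl ?_ ?_).mono le_rfl fun _ h => h
    · refine ⟨⟨rfl, fun y hy => ?_, fun b _ => rfl⟩, fun i j => by simp [Store.setVar]⟩
      simp only [List.mem_cons, not_or] at hy
      simp [Store.setVar, hy.1]
    intro i s₁ hiN hi₁ hN₁ ⟨hA₁, hT₁⟩
    refine RunsTo.mono (c := (((c + 9) * (K + 1) + 16 + c) + 7) * (M + 1))
      (Q := fun s' => s'.var 10 = i ∧ AgreeOff a s s' ∧ ∀ i' j', s'.arr a i' j' =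
        if (i' < i ∧ j' < M) ∨ (i' = i ∧ j' < M) then fillVal s init t e i' j' K
        else s.arr a i' j') ?_ le_rfl ?_
    · refine (RunsTo.for (fun j s' => s'.var 10 = i ∧ AgreeOff a s s' ∧ ∀ i' j', s'.arr a i' j' =
          if (i' < i ∧ j' < M) ∨ (i' = i ∧ j' < j) then fillVal s init t e i' j' K
          else s.arr a i' j') (by rintro rfl; simp at h₂) (hA₁.2.1 _ h₂) ?_ ?_).mono le_rfl
          fun _ h => h
      · refine ⟨by simp [Store.setVar, hi₁], ⟨hA₁.1, fun y hy => ?_, hA₁.2.2⟩, fun i' j' => ?_⟩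
        · have := hy
          simp only [List.mem_cons, not_or] at hy
          simp [Store.setVar, hy.2.1, hA₁.2.1 y this]
        · simp [Store.setVar, hT₁]
      intro j s₂ hjM hj₂ hM₂ ⟨hi₂, hA₂, hT₂⟩
      -- the state after the accumulator has been initialized
      have key : RunsTo B (.for 12 L₃ (.ite t (.setVar 13 e) .skip))
          (((s₂.setVar 12 0).setVar 13 0).setVar 13 (init.eval ((s₂.setVar 12 0).setVar 13 0)))
          ((c + 9) * (K + 1)) (fun s' => s'.var 10 = i ∧ s'.var 11 = j ∧ AgreeOff a s s' ∧
            s'.arr a = s₂.arr a ∧ s'.var 13 = fillVal s init t e i j K) := by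
        refine RunsTo.mono (c := ((t.cost + (e.cost + 1) + 1) + 7) * (K + 1))
          (RunsTo.for (fun k s' => s'.var 10 = i ∧ s'.var 11 = j ∧ AgreeOff a s s' ∧
            s'.arr a = s₂.arr a ∧ s'.var 13 = fillVal s init t e i j k)
            (by rintro rfl; simp at h₃) ?_ ?_ ?_) ?_ fun _ h => h
        · have := h₃
          simp only [List.mem_cons, not_or] at this
          simp [Store.setVar, this.2.2.1, this.2.2.2.1, hA₂.2.1 _ h₃, K]
        · have hA' : AgreeOff a s ((s₂.setVar 12 0).setVar 13 0) := by
            refine ⟨hA₂.1, fun y hy => ?_, hA₂.2.2⟩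
            have := hy
            simp only [List.mem_cons, not_or] at hy
            simp [Store.setVar, hy.2.2.1, hy.2.2.2.1, hA₂.2.1 y this]
          have hev : init.eval ((s₂.setVar 12 0).setVar 13 0) = fillVal s init t e i j 0 := by
            rw [fillVal]
            exact WExp.eval_congr (hA'.var_eq (by simp [Store.setVar, hi₂])
              (by simp [Store.setVar, hj₂]) (by simp [Store.setVar]) (by simp [Store.setVar]))
              hA'.2.2 _ hi
          rw [hev]
          refine ⟨by simp [Store.setVar, hi₂], by simp [Store.setVar, hj₂], ⟨hA₂.1, fun y hy => ?_,
            hA₂.2.2⟩, rfl, by simp [Store.setVar]⟩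
          have := hy
          simp only [List.mem_cons, not_or] at hy
          simp [Store.setVar, hy.2.2.1, hy.2.2.2.1, hA₂.2.1 y this]
        · intro k s₃ hk hk₃ hK₃ ⟨hi₃, hj₃, hA₃, ha₃, hr₃⟩
          have hv := hA₃.var_eq hi₃ hj₃ hk₃ hr₃
          have e1 : t.holds s₃ ↔ t.holds (s.loc i j k (fillVal s init t e i j k)) :=
            Test.holds_congr hv hA₃.2.2 _ ht
          have e2 : e.eval s₃ = e.eval (s.loc i j k (fillVal s init t e i j k)) :=
            WExp.eval_congr hv hA₃.2.2 _ he
          have hL : L₃ ≠ 13 := by rintro rfl; simp at h₃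
          refine RunsTo.ite (fun hb => RunsTo.setVar ?_) (fun hb => RunsTo.mono (RunsTo.skip ?_)
            (by omega) fun _ h => h)
          · refine ⟨by simp [Store.setVar, hk₃], by simp [Store.setVar, hL, hK₃],
              by simp [Store.setVar, hi₃], by simp [Store.setVar, hj₃],
              ⟨hA₃.1, fun y hy => ?_, hA₃.2.2⟩, ha₃, ?_⟩
            · have := hy
              simp only [List.mem_cons, not_or] at hy
              simp [Store.setVar, hy.2.2.1, hy.2.2.2.1, hA₃.2.1 y this]
            · rw [e1] at hb
              simp [Store.setVar, fillVal, hb, e2]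
          · refine ⟨hk₃, hK₃, by simp [Store.setVar, hi₃], by simp [Store.setVar, hj₃],
              ⟨hA₃.1, fun y hy => ?_, hA₃.2.2⟩, ha₃, ?_⟩
            · have := hy
              simp only [List.mem_cons, not_or] at hy
              simp [Store.setVar, hy.2.2.1, hA₃.2.1 y this]
            · rw [e1] at hb
              simp [Store.setVar, fillVal, hb, hr₃]
        · apply Nat.mul_le_mul_right; omega
      refine RunsTo.mono (c := 2 + (2 + (init.cost + 1 + ((c + 9) * (K + 1) + 4)))) ?_ (by omega)
        fun _ h => h
      refine RunsTo.seq (RunsTo.setVar (e := .lit 0) (RunsTo.seq (RunsTo.setVar (e := .lit 0)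
        (RunsTo.seq (RunsTo.setVar (RunsTo.seq (RunsTo.mono key le_rfl ?_)))))))
      intro s₃ ⟨hi₃, hj₃, hA₃, ha₃, hr₃⟩
      refine RunsTo.setArr (i := .var 10) (j := .var 11) (e := .var 13) ?_
      refine ⟨by simp [Store.setArr, hj₃], ?_, by simp [Store.setVar, Store.setArr, hi₃],
        ⟨hA₃.1, fun y hy => ?_, fun b hb => ?_⟩, fun i' j' => ?_⟩
      · simp [Store.setArr, hA₃.2.1 _ h₂]
      · have := hy
        simp only [List.mem_cons, not_or] at hy
        simp [Store.setVar, Store.setArr, hy.2.1, hA₃.2.1 y this]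
      · funext x y
        simp [Store.setVar, Store.setArr, hb, hA₃.2.2 b hb]
      · simp only [Store.setVar, Store.setArr, WExp.eval, hi₃, hj₃, hr₃, ha₃, hT₂, true_and]
        split_ifs <;> first | rfl | omega | (simp_all; try omega)
    · intro s' ⟨h1, h2, h3⟩
      refine ⟨h1, by rw [h2.2.1 _ h₁], ⟨h2.1, fun y hy => ?_, h2.2.2⟩, fun i' j' => ?_⟩
      · have := hy
        simp only [List.mem_cons, not_or] at hy
        simp [Store.setVar, hy.1, h2.2.1 y this]
      · simp only [Store.setVar, h3]
        congr 1
        apply propext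
        constructor
        · rintro (h | h) <;> omega
        · intro h; omega
  · have e1 : 1 ≤ (K + 1) * (M + 1) := Nat.mul_pos (by omega) (by omega)
    calc ((((c + 9) * (K + 1) + 16 + c) + 7) * (M + 1) + 7) * (N + 1)
        ≤ ((2 * c + 39) * ((K + 1) * (M + 1))) * (N + 1) := by
          apply Nat.mul_le_mul_right
          have e2 : (c + 9) * (K + 1) + 16 + c + 7 ≤ (2 * c + 32) * (K + 1) := by nlinarith
          have e3 := Nat.mul_le_mul_right (M + 1) e2
          nlinarith
      _ = _ := by ring

/-- The state is its own parameter here: the entries of the filled table refer to the state before.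
-/
theorem Spec.fill {d : ℕ} (c a L₁ L₂ L₃ : ℕ) (init : WExp) (t : Test) (e : WExp)
    (h₁ : L₁ ∉ [10, 11, 12, 13]) (h₂ : L₂ ∉ [10, 11, 12, 13]) (h₃ : L₃ ∉ [10, 11, 12, 13])
    (hi : init.avoids a = true) (ht : t.avoids a = true) (he : e.avoids a = true) :
    Spec (fun s : Store => s.var 0) d (.fill a L₁ L₂ L₃ init t e)
      (fun s₀ s => s = s₀ ∧ (s.var L₃ + 1) * (s.var L₂ + 1) * (s.var L₁ + 1) ≤
        c * (s.var 0 + 1) ^ d)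
      (fun s s' => AgreeOff a s s' ∧ ∀ i j, s'.arr a i j =
        if i < s.var L₁ ∧ j < s.var L₂ then fillVal s init t e i j (s.var L₃)
        else s.arr a i j) := by
  refine ⟨(2 * (t.cost + e.cost + init.cost) + 39) * c, ?_⟩
  rintro s₀ B s - ⟨rfl, hs⟩
  refine (RunsTo.fill h₁ h₂ h₃ hi ht he).mono ?_ fun _ h => h
  rw [mul_assoc _ c]
  exact Nat.mul_le_mul_left _ hs

open Classical in
/-- The truth value of a proposition as a number. -/
noncomputable def ind (p : Prop) : ℕ := if p then 1 else 0

@[simp] theorem ind_eq_one {p : Prop} : ind p = 1 ↔ p := by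
  unfold ind; split_ifs <;> simp_all

@[simp] theorem ind_eq_zero {p : Prop} : ind p = 0 ↔ ¬ p := by
  unfold ind; split_ifs <;> simp_all

/-- Setting the accumulator to `1` where the test holds computes an existential quantifier. -/
theorem fillVal_ex {s : Store} {t : Test} {i j K : ℕ} {φ : ℕ → Prop}
    (h : ∀ k < K, ∀ r, t.holds (s.loc i j k r) ↔ φ k) :
    fillVal s (.lit 0) t (.lit 1) i j K = ind (∃ k < K, φ k) := by
  induction K with
  | zero => simp [fillVal, WExp.eval, ind]
  | succ K ih =>
    rw [fillVal, h K (by omega), ih fun k hk => h k (by omega)]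
    simp only [Nat.exists_lt_succ_right, WExp.eval]
    by_cases h1 : φ K <;> by_cases h2 : ∃ k < K, φ k <;> simp [ind, h1, h2]

open Classical in
/-- Incrementing the accumulator where the test holds computes a cardinality. -/
theorem fillVal_count {s : Store} {t : Test} {i j K : ℕ} {init : WExp} {φ : ℕ → Prop}
    (h : ∀ k < K, ∀ r, t.holds (s.loc i j k r) ↔ φ k) :
    fillVal s init t (.succ (.var 13)) i j K =
      init.eval (s.loc i j 0 0) + ((Finset.range K).filter φ).card := by
  induction K with
  | zero => simp [fillVal]
  | succ K ih =>
    rw [fillVal, h K (by omega), ih fun k hk => h k (by omega), Finset.range_add_one,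
      Finset.filter_insert]
    simp only [WExp.eval, Store.loc]
    split_ifs <;> simp_all [Finset.card_insert_of_notMem]; omega

/-! ### Scattering a row -/

/-- `for i = 0, …, L - 1 do a (e₁, e₂) := e₃`, where the variable `10` holds `i`. -/
def Prog.scatter (a L : ℕ) (e₁ e₂ e₃ : WExp) : Prog :=
  .for 10 L (.setArr a e₁ e₂ e₃)

/-- The state `s` with the value `i` in the variable `10`. -/
def Store.at (s : Store) (i : ℕ) : Store := s.setVar 10 i

/-- The cells that are written have to be distinct, as the value is required to be present at the
end. -/
theorem Spec.scatter (a L : ℕ) (e₁ e₂ e₃ : WExp) (hL : L ∉ [10, 11, 12, 13])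
    (h₁ : e₁.avoids a = true) (h₂ : e₂.avoids a = true) (h₃ : e₃.avoids a = true) :
    Spec (fun s : Store => s.var 0) 1 (.scatter a L e₁ e₂ e₃)
      (fun s₀ s => s = s₀ ∧ s.var L ≤ 2 * s.var 0 + 1 ∧ ∀ i < s.var L, ∀ j < s.var L,
        e₁.eval (s.at i) = e₁.eval (s.at j) → e₂.eval (s.at i) = e₂.eval (s.at j) → i = j)
      (fun s s' => AgreeOff a s s' ∧
        (∀ i < s.var L, s'.arr a (e₁.eval (s.at i)) (e₂.eval (s.at i)) = e₃.eval (s.at i)) ∧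
        ∀ x y, (∀ i < s.var L, ¬ (e₁.eval (s.at i) = x ∧ e₂.eval (s.at i) = y)) →
          s'.arr a x y = s.arr a x y) := by
  have hL' : L ≠ 10 := by rintro rfl; simp at hL
  refine ⟨2 * (e₁.cost + e₂.cost + e₃.cost + 8), ?_⟩
  rintro s₀ B s - ⟨rfl, hb, hinj⟩
  refine RunsTo.mono (RunsTo.for (fun k s' => (AgreeOff a s s' ∧
        ∀ y, y ≠ 10 → s'.var y = s.var y) ∧
        (∀ i < k, i < s.var L →
          s'.arr a (e₁.eval (s.at i)) (e₂.eval (s.at i)) = e₃.eval (s.at i)) ∧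
        ∀ x y, (∀ i < k, ¬ (e₁.eval (s.at i) = x ∧ e₂.eval (s.at i) = y)) →
          s'.arr a x y = s.arr a x y) hL' rfl ?_ (c := e₁.cost + e₂.cost + e₃.cost + 1) ?_) ?_ ?_
  · refine ⟨⟨⟨rfl, fun y hy => ?_, fun b _ => rfl⟩, fun y hy => by simp [Store.setVar, hy]⟩,
      by simp, fun x y _ => rfl⟩
    simp only [List.mem_cons, not_or] at hy
    simp [Store.setVar, hy.1]
  · intro k s₁ hk hk₁ hL₁ ⟨⟨hA, hv⟩, h4, h5⟩
    have hv' : s₁.var = (s.at k).var := by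
      funext y
      by_cases hy : y = 10
      · simp [Store.at, Store.setVar, hy, hk₁]
      · simp [Store.at, Store.setVar, hy, hv]
    have E : ∀ e : WExp, e.avoids a = true → e.eval s₁ = e.eval (s.at k) := fun e he =>
      WExp.eval_congr hv' hA.2.2 e he
    refine RunsTo.setArr ?_
    rw [E _ h₁, E _ h₂, E _ h₃]
    refine ⟨hk₁, hL₁, ⟨⟨hA.1, fun y hy => ?_, fun b hb => ?_⟩, fun y hy => ?_⟩, fun i hi hi' => ?_,
      fun x y hxy => ?_⟩
    · have := hy
      simp only [List.mem_cons, not_or] at hy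
      simp [Store.setVar, Store.setArr, hy.1, hA.2.1 y this]
    · funext x y
      simp [Store.setVar, Store.setArr, hb, hA.2.2 b hb]
    · simp [Store.setVar, Store.setArr, hy, hv]
    · simp only [Store.setVar, Store.setArr, true_and]
      split_ifs with h
      · rw [hinj i hi' k hk h.1 h.2]
      · refine h4 i ?_ hi'
        rcases Nat.lt_succ_iff_lt_or_eq.1 hi with h' | rfl
        · exact h'
        · simp at h
    · have := hxy k (by omega)
      simp only [Store.setVar, Store.setArr, true_and]
      rw [if_neg (by tauto)]
      exact h5 x y fun i hi => hxy i (by omega)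
  · calc (e₁.cost + e₂.cost + e₃.cost + 1 + 7) * (s.var L + 1)
      ≤ (e₁.cost + e₂.cost + e₃.cost + 8) * (2 * (s.var 0 + 1)) :=
        Nat.mul_le_mul (by omega) (by omega)
    _ = _ := by ring
  · intro s' ⟨h4, h5, h6⟩
    exact ⟨h4.1, fun i hi => h5 i hi hi, h6⟩

/-! ### Rooted clique trees -/

/-- A rooted tree of cliques of the graph `adj` on `0, …, n - 1`: the ancestor relation `anc` of a
rooted tree of nodes, each of which is a maximal clique, such that the nodes of a vertex form a
vertical path. -/
structure RootedModel (n : ℕ) (adj : ℕ → ℕ → Prop) where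
  /-- the nodes -/
  N : Type
  /-- `anc x y`: the node `x` is an ancestor of `y` or `y` itself -/
  anc : N → N → Prop
  /-- `mem x v`: the vertex `v` belongs to the clique `x` -/
  mem : N → ℕ → Prop
  /-- the distance from the root -/
  depth : N → ℕ
  refl : ∀ x, anc x x
  trans : ∀ {x y z}, anc x y → anc y z → anc x z
  depth_lt : ∀ {x y}, anc x y → x = y ∨ depth x < depth y
  chain : ∀ {x y z}, anc x z → anc y z → anc x y ∨ anc y x
  root : ∃ r, ∀ x, anc r x
  mem_lt : ∀ {x v}, mem x v → v < n
  adj_iff : ∀ {u v}, adj u v ↔ u ≠ v ∧ ∃ x, mem x u ∧ mem x v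
  nonempty : ∀ {v}, v < n → ∃ x, mem x v
  total : ∀ {v x y}, mem x v → mem y v → anc x y ∨ anc y x
  convex : ∀ {v x y z}, mem x v → mem z v → anc x y → anc y z → mem y v
  maximal : ∀ {x v}, v < n → (∀ u, mem x u → u = v ∨ adj u v) → mem x v

/-- A node of a rooted tree has at most one parent. -/
theorem RootedEdge.unique {N : Type*} {T : SimpleGraph N} (hT : T.IsTree) {r x x' y : N}
    (h : RootedEdge T r x y) (h' : RootedEdge T r x' y) : x = x' := by
  obtain ⟨w, hw⟩ := (hT.connected r x).exists_walk_length_eq_dist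
  obtain ⟨w', hw'⟩ := (hT.connected r x').exists_walk_length_eq_dist
  have p : (w.concat h.1).IsPath := by
    apply SimpleGraph.Walk.isPath_of_length_eq_dist
    rw [SimpleGraph.Walk.length_concat, hw, h.2]
  have p' : (w'.concat h'.1).IsPath := by
    apply SimpleGraph.Walk.isPath_of_length_eq_dist
    rw [SimpleGraph.Walk.length_concat, hw', h'.2]
  have := (hT.isAcyclic.subsingleton_path r y).elim ⟨_, p⟩ ⟨_, p'⟩
  have := congrArg SimpleGraph.Walk.penultimate (congrArg Subtype.val this)
  simpa using this

/-- The root is an ancestor of each node. -/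
theorem RootedEdge.root_anc {N : Type*} {T : SimpleGraph N} (hT : T.IsTree) (r x : N) :
    Relation.ReflTransGen (RootedEdge T r) r x := by
  induction hd : T.dist r x generalizing x with
  | zero =>
    have := (hT.connected r x).dist_eq_zero_iff.1 hd
    exact this ▸ .refl
  | succ d ih =>
    obtain ⟨w, hw⟩ := (hT.connected r x).exists_walk_length_eq_dist
    have hn : ¬ w.Nil := by
      intro h
      have := SimpleGraph.Walk.length_eq_zero_iff.2 h
      omega
    have h1 := w.adj_penultimate hn
    have h2 := SimpleGraph.dist_le w.dropLast
    have h3 : w.dropLast.length + 1 = w.length := by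
      rw [SimpleGraph.Walk.length_dropLast_add_one hn]
    have h4 : T.dist r x ≤ T.dist r w.penultimate + 1 := by
      have := hT.connected.dist_triangle (u := r) (v := w.penultimate) (w := x)
      rw [SimpleGraph.dist_eq_one_iff_adj.2 h1] at this
      exact this
    exact (ih _ (by omega)).tail ⟨h1, by omega⟩

theorem RootedEdge.depth_lt {N : Type*} {T : SimpleGraph N} {r x y : N}
    (h : Relation.ReflTransGen (RootedEdge T r) x y) : x = y ∨ T.dist r x < T.dist r y := by
  induction h with
  | refl => exact .inl rfl
  | tail _ h ih =>
    have := h.2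
    rcases ih with rfl | ih <;> right <;> omega

/-- The ancestors of a node form a chain. -/
theorem RootedEdge.chain {N : Type*} {T : SimpleGraph N} (hT : T.IsTree) {r x y z : N}
    (h : Relation.ReflTransGen (RootedEdge T r) x z)
    (h' : Relation.ReflTransGen (RootedEdge T r) y z) :
    Relation.ReflTransGen (RootedEdge T r) x y ∨ Relation.ReflTransGen (RootedEdge T r) y x := by
  induction h with
  | refl => exact .inr h'
  | @tail b c hb hc ih =>
    rcases h'.cases_tail with h | ⟨d, h1, h2⟩
    · exact .inl (h ▸ hb.tail hc)
    · rw [RootedEdge.unique hT h2 hc] at h1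
      exact ih h1

/-- The first node of a directed path is the only one whose parent may be outside of the path. -/
theorem RootedEdge.parent_mem {N : Type*} {T : SimpleGraph N} (hT : T.IsTree) {r y y' : N}
    (h : RootedEdge T r y' y) : ∀ l : List N, l.IsChain (RootedEdge T r) → y ∈ l →
      y' ∈ l ∨ ∀ x ∈ l, Relation.ReflTransGen (RootedEdge T r) y x
  | [], _, hy => by simp at hy
  | a :: t, hl, hy => by
    have hp : (a :: t).Pairwise (Relation.ReflTransGen (RootedEdge T r)) :=
      List.isChain_iff_pairwise.1 (hl.imp fun _ _ h => .single h)
    rw [List.pairwise_cons] at hp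
    by_cases hya : y = a
    · subst hya
      right
      intro x hx
      rcases List.mem_cons.1 hx with rfl | hx
      · exact .refl
      · exact hp.1 x hx
    have hyt : y ∈ t := by simpa [hya] using hy
    rcases RootedEdge.parent_mem hT h t hl.tail hyt with h1 | h1
    · exact .inl (List.mem_cons_of_mem _ h1)
    left
    cases t with
    | nil => simp at hyt
    | cons b t =>
      have hb : y = b := by
        rcases RootedEdge.depth_lt (h1 b (by simp)) with h2 | h2
        · exact h2
        rcases List.mem_cons.1 hyt with h3 | h3
        · exact h3
        rcases RootedEdge.depth_lt ((List.pairwise_cons.1 hp.2).1 y h3) with h4 | h4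
        · exact h4.symm
        · omega
      rw [List.isChain_cons_cons] at hl
      rw [RootedEdge.unique hT h (hb ▸ hl.1)]
      simp

/-- A directed path contains each node between two of its nodes. -/
theorem IsRootedPath.convex {N : Type*} {T : SimpleGraph N} (hT : T.IsTree) {r x y z : N}
    {P : Set N} (hP : IsRootedPath T r P) (hx : x ∈ P) (hz : z ∈ P)
    (h1 : Relation.ReflTransGen (RootedEdge T r) x y)
    (h2 : Relation.ReflTransGen (RootedEdge T r) y z) : y ∈ P := by
  obtain ⟨l, -, hl, rfl⟩ := hP
  induction h2 with
  | refl => exact hz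
  | @tail b c hb hc ih =>
    refine ih ?_
    rcases RootedEdge.parent_mem hT hc l hl hz with h | h
    · exact h
    · exfalso
      have h3 := RootedEdge.depth_lt (h x hx)
      have h4 := RootedEdge.depth_lt h1
      have h5 := RootedEdge.depth_lt hb
      have h6 := hc.2
      have h7 : T.dist r c ≤ T.dist r x := by rcases h3 with rfl | h3 <;> omega
      have h8 : T.dist r x ≤ T.dist r y := by rcases h4 with rfl | h4 <;> omega
      have h9 : T.dist r y ≤ T.dist r b := by rcases h5 with rfl | h5 <;> omega
      omega

/-- Of two nodes of a directed path, one is an ancestor of the other. -/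
theorem IsRootedPath.total {N : Type*} {T : SimpleGraph N} {r x y : N}
    {P : Set N} (hP : IsRootedPath T r P) (hx : x ∈ P) (hy : y ∈ P) :
    Relation.ReflTransGen (RootedEdge T r) x y ∨ Relation.ReflTransGen (RootedEdge T r) y x := by
  obtain ⟨l, -, hl, rfl⟩ := hP
  have hp : l.Pairwise (Relation.ReflTransGen (RootedEdge T r)) :=
    List.isChain_iff_pairwise.1 (hl.imp fun _ _ h => .single h)
  by_cases hxy : x = y
  · exact .inl (hxy ▸ .refl)
  have : Std.Symm fun x y => Relation.ReflTransGen (RootedEdge T r) x y ∨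
    Relation.ReflTransGen (RootedEdge T r) y x := ⟨fun _ _ h => h.symm⟩
  exact (hp.imp (S := fun x y => Relation.ReflTransGen (RootedEdge T r) x y ∨
    Relation.ReflTransGen (RootedEdge T r) y x) fun h => .inl h).forall hx hy hxy

/-- The adjacency of a graph on `Fin n` as a relation between natural numbers. -/
def natAdj {n : ℕ} (G : SimpleGraph (Fin n)) (i j : ℕ) : Prop :=
  ∃ (hi : i < n) (hj : j < n), G.Adj ⟨i, hi⟩ ⟨j, hj⟩

/-- The clique tree in the definition of a rooted directed path graph, reduced to its ancestor
relation. -/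
theorem IsRootedDirectedPathGraph.nonempty_model {n : ℕ} {G : SimpleGraph (Fin n)}
    (hG : IsRootedDirectedPathGraph G) : Nonempty (RootedModel n (natAdj G)) := by
  obtain ⟨T, r, hT, hP⟩ := hG
  refine ⟨{
    N := MaxClique G
    anc := Relation.ReflTransGen (RootedEdge T r)
    mem := fun x v => ∃ h : v < n, (⟨v, h⟩ : Fin n) ∈ x.1
    depth := T.dist r
    refl := fun x => .refl
    trans := fun h h' => h.trans h'
    depth_lt := RootedEdge.depth_lt
    chain := RootedEdge.chain hT
    root := ⟨r, RootedEdge.root_anc hT r⟩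
    mem_lt := fun ⟨h, _⟩ => h
    adj_iff := fun {u v} => ⟨?_, ?_⟩
    nonempty := fun {v} hv => ?_
    total := fun ⟨h, hx⟩ ⟨_, hy⟩ => (hP ⟨_, h⟩).total hx hy
    convex := fun ⟨h, hx⟩ ⟨_, hy⟩ h1 h2 => ⟨h, (hP ⟨_, h⟩).convex hT hx hy h1 h2⟩
    maximal := fun {x v} hv h => ?_ }⟩
  · rintro ⟨hu, hv, h⟩
    refine ⟨fun e => h.ne (by simp [e]), ?_⟩
    have hc : G.IsClique {⟨u, hu⟩, ⟨v, hv⟩} := by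
      rw [SimpleGraph.isClique_pair]; exact fun _ => h
    obtain ⟨Q, h1, h2⟩ := Finite.exists_le_maximal (p := fun Q : Set (Fin n) => G.IsClique Q) hc
    exact ⟨⟨Q, h2⟩, ⟨hu, h1 (by simp)⟩, ⟨hv, h1 (by simp)⟩⟩
  · rintro ⟨hne, x, ⟨hu, h1⟩, ⟨hv, h2⟩⟩
    exact ⟨hu, hv, x.2.1 h1 h2 (by simpa using hne)⟩
  · obtain ⟨l, hl, -, h⟩ := hP ⟨v, hv⟩
    obtain ⟨x, hx⟩ := List.exists_mem_of_ne_nil l hl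
    have : x ∈ {Q : MaxClique G | (⟨v, hv⟩ : Fin n) ∈ Q.1} := by rw [h]; exact hx
    exact ⟨x, hv, this⟩
  · refine ⟨hv, ?_⟩
    have hc : G.IsClique (insert ⟨v, hv⟩ x.1) := by
      rw [SimpleGraph.isClique_insert]
      refine ⟨x.2.1, fun b hb hne => ?_⟩
      rcases h b.1 ⟨b.2, hb⟩ with h | ⟨_, _, h⟩
      · exact absurd (Fin.ext h.symm) hne
      · exact h.symm
    exact x.2.2 hc (Set.subset_insert _ _) (Set.mem_insert _ _)

/-! ### Connected sets and separators in a graph with a perfect elimination order -/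

/-- The set `C` is connected in the graph `adj` (or empty): a subset that is closed under taking
neighbours in `C` is empty or everything. -/
def Conn (adj : ℕ → ℕ → Prop) (C : ℕ → Prop) : Prop :=
  ∀ (D : ℕ → Prop) (a : ℕ), C a → D a → (∀ x y, C x → C y → adj x y → D x → D y) → ∀ b, C b → D b

/-- `b` can be reached from `a` by a walk all of whose vertices after `a` lie in `S`. -/
def Reach (adj : ℕ → ℕ → Prop) (S : ℕ → Prop) : ℕ → ℕ → Prop :=
  Relation.ReflTransGen fun x y => adj x y ∧ S y

theorem Reach.closed {adj : ℕ → ℕ → Prop} {S C : ℕ → Prop} {a b : ℕ} (h : Reach adj S a b)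
    (ha : C a) (hC : ∀ x y, C x → adj x y → S y → C y) : C b := by
  induction h with
  | refl => exact ha
  | tail _ h ih => exact hC _ _ ih h.1 h.2

theorem Reach.conn {adj : ℕ → ℕ → Prop} (hs : ∀ {u v}, adj u v → adj v u) {S : ℕ → Prop} {a : ℕ} :
    Conn adj (Reach adj S a) := by
  intro E c hc hEc hE d hd
  have ha : E a := by
    have : ∀ x, Reach adj S a x → E x → E a := by
      intro x hx
      induction hx with
      | refl => exact id
      | @tail y z hy hz ih =>
        exact fun hEz => ih (hE z y (Relation.ReflTransGen.tail hy hz) hy (hs hz.1) hEz)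
    exact this c hc hEc
  refine (hd.closed (C := fun x => Reach adj S a x ∧ E x) ⟨.refl, ha⟩ ?_).2
  intro x z hx hxz hz
  have : Reach adj S a z := Relation.ReflTransGen.tail hx.1 ⟨hxz, hz⟩
  exact ⟨this, hE x z hx.1 this hxz hx.2⟩

/-- The outer boundary of a set of vertices. -/
def Bd (adj : ℕ → ℕ → Prop) (C : ℕ → Prop) (w : ℕ) : Prop := ¬ C w ∧ ∃ u, C u ∧ adj u w

/-- A connected set that meets `D`, but not the boundary of `D`, is contained in `D`. -/
theorem Conn.subset {adj : ℕ → ℕ → Prop} {C D F : ℕ → Prop} (hC : Conn adj C) {a : ℕ} (ha : C a)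
    (hD : D a) (hB : ∀ w, Bd adj D w → F w) (hF : ∀ w, C w → ¬ F w) : ∀ b, C b → D b := by
  refine hC D a ha hD fun x y _ hy hxy hx => ?_
  by_contra h
  exact hF y hy (hB y ⟨h, x, hx, hxy⟩)

/-- A clique that misses none of its common neighbours. -/
structure IsMaxClique (n : ℕ) (adj : ℕ → ℕ → Prop) (y : ℕ → Prop) : Prop where
  lt : ∀ v, y v → v < n
  clique : ∀ u v, y u → y v → u = v ∨ adj u v
  maximal : ∀ v, v < n → (∀ u, y u → u = v ∨ adj u v) → y v

/-- A perfect elimination order: the later neighbours of each vertex form a clique. -/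
structure PEO (n : ℕ) (adj : ℕ → ℕ → Prop) (pos : ℕ → ℕ) : Prop where
  symm : ∀ {u v}, adj u v → adj v u
  irrefl : ∀ {u}, ¬ adj u u
  lt : ∀ {u v}, adj u v → v < n
  inj : ∀ {u v}, u < n → v < n → pos u = pos v → u = v
  pos_lt : ∀ {v}, v < n → pos v < n
  clique : ∀ {v u w}, adj v u → adj v w → pos v < pos u → pos v < pos w → u = w ∨ adj u w

/-- The later neighbours of a vertex. -/
def Later (adj : ℕ → ℕ → Prop) (pos : ℕ → ℕ) (v u : ℕ) : Prop := adj v u ∧ pos v < pos u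

theorem exists_pos_max {n : ℕ} (pos : ℕ → ℕ) {C : ℕ → Prop} (hC : ∀ v, C v → v < n)
    (h : ∃ v, C v) : ∃ d, C d ∧ ∀ v, C v → pos v ≤ pos d := by
  classical
  obtain ⟨v, hv⟩ := h
  obtain ⟨d, h1, h2⟩ := Finset.exists_max_image ((Finset.range n).filter C) pos
    ⟨v, by simp [hv, hC v hv]⟩
  simp only [Finset.mem_filter, Finset.mem_range] at h1 h2
  exact ⟨d, h1.2, fun v hv => h2 v ⟨hC v hv, hv⟩⟩

theorem exists_pos_min {n : ℕ} (pos : ℕ → ℕ) {C : ℕ → Prop} (hC : ∀ v, C v → v < n)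
    (h : ∃ v, C v) : ∃ d, C d ∧ ∀ v, C v → pos d ≤ pos v := by
  classical
  obtain ⟨v, hv⟩ := h
  obtain ⟨d, h1, h2⟩ := Finset.exists_min_image ((Finset.range n).filter C) pos
    ⟨v, by simp [hv, hC v hv]⟩
  simp only [Finset.mem_filter, Finset.mem_range] at h1 h2
  exact ⟨d, h1.2, fun v hv => h2 v ⟨hC v hv, hv⟩⟩

namespace PEO

variable {n : ℕ} {adj : ℕ → ℕ → Prop} {pos : ℕ → ℕ} {C : ℕ → Prop}

/-- Deleting simplicial vertices one after the other does not destroy connectivity. -/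
theorem conn_ge (h : PEO n adj pos) (hn : ∀ v, C v → v < n) (hC : Conn adj C) (t : ℕ) :
    Conn adj fun v => C v ∧ t ≤ pos v := by
  induction t with
  | zero => simpa using hC
  | succ t ih =>
    rintro D a ⟨ha, hat⟩ hDa hD b ⟨hb, hbt⟩
    have key := ih (fun v => (t < pos v ∧ D v) ∨ (pos v = t ∧ ∃ x, C x ∧ t < pos x ∧ adj v x ∧ D x))
      a ⟨ha, by omega⟩ (.inl ⟨hat, hDa⟩) ?_ b ⟨hb, by omega⟩
    · rcases key with h | h
      · exact h.2
      · omega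
    rintro x y ⟨hx, hxt⟩ ⟨hy, hyt⟩ hxy (⟨h1, h2⟩ | ⟨h1, z, hz, h2, h3, h4⟩)
    · rcases hyt.eq_or_lt with e | e
      · exact .inr ⟨e.symm, x, hx, h1, h.symm hxy, h2⟩
      · exact .inl ⟨e, hD x y ⟨hx, h1⟩ ⟨hy, e⟩ hxy h2⟩
    · have hyt' : t < pos y := by
        rcases hyt.eq_or_lt with e | e
        · have := h.inj (hn x hx) (hn y hy) (by omega)
          subst this
          exact absurd hxy h.irrefl
        · exact e
      refine .inl ⟨hyt', ?_⟩
      rcases h.clique h3 hxy (by omega) (by omega) with rfl | h5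
      · exact h4
      · exact hD z y ⟨hz, h2⟩ ⟨hy, hyt'⟩ h5 h4

/-- In a connected set each vertex except for the last one has a later neighbour. -/
theorem exists_later (h : PEO n adj pos) (hn : ∀ v, C v → v < n) (hC : Conn adj C) {c d : ℕ}
    (hc : C c) (hd : C d) (hcd : pos c < pos d) : ∃ c', C c' ∧ adj c c' ∧ pos c < pos c' := by
  by_contra! hno
  have := h.conn_ge hn hC (pos c) (fun v => v = c) c ⟨hc, le_rfl⟩ rfl ?_ d ⟨hd, hcd.le⟩
  · subst this; omega
  rintro x y ⟨hx, _⟩ ⟨hy, hyt⟩ hxy rfl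
  exact h.inj (hn y hy) (hn x hx) (le_antisymm (hno y hy hxy) hyt)

/-- A vertex on the boundary of a connected set has a later neighbour in it, or else it is later
than the whole set and adjacent to the last vertex. -/
theorem boundary (h : PEO n adj pos) (hn : ∀ v, C v → v < n) (hC : Conn adj C) {d k : ℕ}
    (hd : C d) (hmax : ∀ v, C v → pos v ≤ pos d) (hk : Bd adj C k) :
    (pos k < pos d ∧ ∃ p, C p ∧ adj k p ∧ pos k < pos p) ∨ (pos d < pos k ∧ adj k d) := by
  obtain ⟨hkC, c₀, hc₀, hk₀⟩ := hk
  obtain ⟨c, ⟨hc, hkc⟩, hcm⟩ := exists_pos_max (n := n) pos (C := fun v => C v ∧ adj k v)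
    (fun v hv => hn v hv.1) ⟨c₀, hc₀, h.symm hk₀⟩
  have hkn : k < n := h.lt hk₀
  have hne : ∀ v, C v → pos v ≠ pos k := fun v hv e => hkC (h.inj (hn v hv) hkn e ▸ hv)
  rcases (hmax c hc).eq_or_lt with e | e
  · have : c = d := h.inj (hn c hc) (hn d hd) e
    subst this
    rcases lt_or_gt_of_ne (hne c hc) with h1 | h1
    · exact .inr ⟨h1, hkc⟩
    · exact .inl ⟨h1, c, hc, hkc, h1⟩
  · rcases lt_or_gt_of_ne (hne c hc) with h1 | h1
    · exfalso
      obtain ⟨c', hc', h2, h3⟩ := h.exists_later hn hC hc hd e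
      rcases h.clique h2 (h.symm hkc) h3 h1 with rfl | h4
      · exact hkC hc'
      · have := hcm c' ⟨hc', h.symm h4⟩
        omega
    · exact .inl ⟨by omega, c, hc, hkc, h1⟩

end PEO

/-! ### Blocks -/

/-- The vertices from which block `b` is searched. For `b < n` this is `b` alone; for `b = n + e`
these are the vertices outside of `Later e` of the clique formed by the first later neighbour `f`
of `e` and the later neighbours of `f`. -/
def seed (n : ℕ) (adj : ℕ → ℕ → Prop) (pos : ℕ → ℕ) (b j : ℕ) : Prop :=
  if b < n then j = b else ∃ f, Later adj pos (b - n) f ∧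
    (∀ k, Later adj pos (b - n) k → k = f ∨ Later adj pos f k) ∧ Later adj pos f j ∧
      ¬ Later adj pos (b - n) j

/-- The vertex whose later neighbours separate block `b`. -/
def blockBase (n b : ℕ) : ℕ := if b < n then b else b - n

/-- Block `b < 2n` is the connected component, or empty, that contains the seeds of `b` after the
later neighbours of `blockBase n b` have been deleted; block `2n` is the whole graph. -/
def Block (n : ℕ) (adj : ℕ → ℕ → Prop) (pos : ℕ → ℕ) (b u : ℕ) : Prop :=
  if b < 2 * n then
    ∃ s, seed n adj pos b s ∧ Reach adj (fun v => ¬ Later adj pos (blockBase n b) v) s u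
  else u < n

namespace PEO

variable {n : ℕ} {adj : ℕ → ℕ → Prop} {pos : ℕ → ℕ} {b : ℕ}

theorem seed_not_later (h : PEO n adj pos) {j : ℕ} (hj : seed n adj pos b j) :
    ¬ Later adj pos (blockBase n b) j := by
  unfold seed at hj
  unfold blockBase
  split_ifs at hj ⊢ with hb
  · subst hj
    exact fun h' => h.irrefl h'.1
  · obtain ⟨f, -, -, -, h4⟩ := hj
    exact h4

theorem seed_lt (h : PEO n adj pos) {j : ℕ} (hj : seed n adj pos b j) : j < n := by
  unfold seed at hj
  split_ifs at hj with hb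
  · omega
  · obtain ⟨f, -, -, h3, -⟩ := hj
    exact h.lt h3.1

theorem seed_adj (h : PEO n adj pos) {i j : ℕ} (hi : seed n adj pos b i)
    (hj : seed n adj pos b j) : i = j ∨ adj i j := by
  unfold seed at hi hj
  split_ifs at hi hj with hb
  · exact .inl (hi.trans hj.symm)
  · obtain ⟨f, h1, h2, h3, -⟩ := hi
    obtain ⟨f', h1', h2', h3', -⟩ := hj
    have : f = f' := by
      rcases h2 f' h1' with e | e
      · exact e.symm
      rcases h2' f h1 with e' | e'
      · exact e'
      · exact absurd e.2 (by have := e'.2; omega)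
    subst this
    exact h.clique h3.1 h3'.1 h3.2 h3'.2

theorem block_of_seed {j : ℕ} (hb : b < 2 * n) (hj : seed n adj pos b j) :
    Block n adj pos b j := by
  unfold Block
  rw [if_pos hb]
  exact ⟨j, hj, .refl⟩

theorem block_closed (hb : b < 2 * n) {u v : ℕ} (hu : Block n adj pos b u) (huv : adj u v)
    (hv : ¬ Later adj pos (blockBase n b) v) : Block n adj pos b v := by
  unfold Block at *
  rw [if_pos hb] at *
  obtain ⟨s, h1, h2⟩ := hu
  exact ⟨s, h1, h2.tail ⟨huv, hv⟩⟩

theorem block_not_later (h : PEO n adj pos) (hb : b < 2 * n) {u : ℕ}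
    (hu : Block n adj pos b u) : ¬ Later adj pos (blockBase n b) u := by
  unfold Block at hu
  rw [if_pos hb] at hu
  obtain ⟨s, h1, h2⟩ := hu
  exact h2.closed (h.seed_not_later h1) fun _ _ _ _ h => h

theorem block_lt (h : PEO n adj pos) {u : ℕ} (hu : Block n adj pos b u) : u < n := by
  unfold Block at hu
  split_ifs at hu with hb
  · obtain ⟨s, h1, h2⟩ := hu
    exact h2.closed (C := fun v => v < n) (h.seed_lt h1) fun _ _ _ h' _ => h.lt h'
  · exact hu

theorem block_conn (h : PEO n adj pos) (hb : b < 2 * n) : Conn adj (Block n adj pos b) := by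
  intro D a ha hDa hD c hc
  have ha' := ha
  have hc' := hc
  unfold Block at ha' hc'
  rw [if_pos hb] at ha' hc'
  obtain ⟨s, hs, h1⟩ := ha'
  obtain ⟨s', hs', h2⟩ := hc'
  have hsD : D s := by
    -- propagate membership in `D` backwards along the walk from `s` to `a`
    have : ∀ x, Reach adj (fun v => ¬ Later adj pos (blockBase n b) v) s x → D x → D s := by
      intro x hx
      induction hx with
      | refl => exact id
      | @tail y z hy hz ih =>
        intro hDz
        have hyB : Block n adj pos b y := by
          unfold Block; rw [if_pos hb]; exact ⟨s, hs, hy⟩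
        exact ih (hD z y (block_closed hb hyB hz.1 hz.2) hyB (h.symm hz.1) hDz)
    exact this a h1 hDa
  have hsD' : D s' := by
    rcases h.seed_adj hs hs' with rfl | e
    · exact hsD
    · exact hD s s' (block_of_seed hb hs) (block_of_seed hb hs') e hsD
  refine (h2.closed (C := fun x => Block n adj pos b x ∧ D x) ⟨block_of_seed hb hs', hsD'⟩ ?_).2
  intro x y hx hxy hy
  have := block_closed hb hx.1 hxy hy
  exact ⟨this, hD x y hx.1 this hxy hx.2⟩

/-- A connected set that is separated by the later neighbours of `blockBase n b` and contains a
seed of `b` is block `b`. -/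
theorem block_eq (h : PEO n adj pos) (hb : b < 2 * n) {C : ℕ → Prop} (hC : Conn adj C)
    (hK : ∀ w, Bd adj C w → Later adj pos (blockBase n b) w)
    (hK' : ∀ w, C w → ¬ Later adj pos (blockBase n b) w) {s : ℕ} (hs : seed n adj pos b s)
    (hsC : C s) (u : ℕ) : C u ↔ Block n adj pos b u := by
  constructor
  · intro hu
    refine hC.subset (D := Block n adj pos b) hsC (block_of_seed hb hs) (F := fun w => Later adj pos
      (blockBase n b) w) (fun w hw => ?_) hK' u hu
    by_contra hno
    obtain ⟨x, hx, hxw⟩ := hw.2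
    exact hw.1 (block_closed hb hx hxw hno)
  · exact (h.block_conn hb).subset (block_of_seed hb hs) hsC hK
      (fun w hw => h.block_not_later hb hw) u

/-- Every connected component of the graph minus a maximal clique `y` is a block. -/
theorem exists_block (h : PEO n adj pos) {y C : ℕ → Prop} (hy : IsMaxClique n adj y)
    (hC : Conn adj C) (hn : ∀ v, C v → v < n) (hne : ∃ v, C v) (hd : ∀ v, C v → ¬ y v)
    (hK : ∀ w, Bd adj C w → y w) : ∃ b < 2 * n, ∀ u, C u ↔ Block n adj pos b u := by
  obtain ⟨d, hdC, hdm⟩ := exists_pos_max pos hn hne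
  by_cases hA : ∀ k, Bd adj C k → pos d < pos k
  · -- the boundary consists of the later neighbours of the last vertex of the component
    have hdn := hn d hdC
    refine ⟨d, by omega, fun u => h.block_eq (by omega) hC ?_ ?_ (s := d) ?_ hdC u⟩
    · intro w hw
      rw [blockBase, if_pos hdn]
      rcases h.boundary hn hC hdC hdm hw with h1 | h1
      · exact absurd (hA w hw) (by omega)
      · exact ⟨h.symm h1.2, h1.1⟩
    · intro w hw hl
      rw [blockBase, if_pos hdn] at hl
      exact absurd (hdm w hw) (by have := hl.2; omega)
    · rw [seed, if_pos hdn]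
  · push Not at hA
    obtain ⟨k₀, hk₀, hkd₀⟩ := hA
    have hBn : ∀ w, Bd adj C w → w < n := fun w hw => hy.lt w (hK w hw)
    obtain ⟨f, hf, hfm⟩ := exists_pos_min pos hBn ⟨k₀, hk₀⟩
    -- `p` is adjacent to the whole boundary
    obtain ⟨p, hpC, hfp, hpp⟩ : ∃ p, C p ∧ adj f p ∧ pos f < pos p := by
      rcases h.boundary hn hC hdC hdm hf with h1 | h1
      · exact h1.2
      · have := hfm k₀ hk₀; omega
    have hfk : ∀ k, Bd adj C k → k = f ∨ Later adj pos f k := by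
      intro k hk
      rcases hy.clique f k (hK f hf) (hK k hk) with e | e
      · exact .inl e.symm
      · refine .inr ⟨e, lt_of_le_of_ne (hfm k hk) fun e' => ?_⟩
        have := h.inj (hBn f hf) (hBn k hk) e'
        subst this
        exact h.irrefl e
    have hpk : ∀ k, Bd adj C k → adj k p := by
      intro k hk
      rcases hfk k hk with rfl | e
      · exact hfp
      · rcases h.clique e.1 hfp e.2 hpp with rfl | e'
        · exact absurd hpC hk.1
        · exact e'
    obtain ⟨q, hqy, hqK⟩ : ∃ q, y q ∧ ¬ Bd adj C q := by
      by_contra! hall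
      exact hd p hpC (hy.maximal p (hn p hpC) fun u hu => .inr (hpk u (hall u hu)))
    -- the component `D` of the rest of the clique, on the other side of the boundary
    set D : ℕ → Prop := fun u => Reach adj (fun v => ¬ Bd adj C v) q u with hD
    have hDn : ∀ v, D v → v < n := fun v hv =>
      Reach.closed (C := fun v => v < n) hv (hy.lt q hqy) fun _ _ _ h' _ => h.lt h'
    have hDK : ∀ v, D v → ¬ Bd adj C v := fun v hv =>
      Reach.closed (C := fun v => ¬ Bd adj C v) hv hqK fun _ _ _ _ h' => h'
    have hDcl : ∀ u v, D u → adj u v → ¬ Bd adj C v → D v := fun u v hu huv hv =>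
      Relation.ReflTransGen.tail hu ⟨huv, hv⟩
    have hDC : ∀ v, D v → ¬ C v := fun v hv => by
      refine (Reach.closed (C := fun v => ¬ Bd adj C v ∧ ¬ C v) hv
        ⟨hqK, fun h' => hd q h' hqy⟩ fun a b' ha hab hb => ⟨hb, fun hb' => ?_⟩).2
      exact ha.1 ⟨ha.2, b', hb', h.symm hab⟩
    have hDc : Conn adj D := Reach.conn h.symm
    have hqk : ∀ k, Bd adj C k → Bd adj D k := by
      intro k hk
      refine ⟨fun h' => hDK k h' hk, q, .refl, ?_⟩
      rcases hy.clique q k hqy (hK k hk) with rfl | e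
      · exact absurd hk hqK
      · exact e
    obtain ⟨e, heD, hem⟩ := exists_pos_max pos hDn ⟨q, .refl⟩
    have hfe : pos e < pos f ∧ adj f e := by
      rcases h.boundary hDn hDc heD hem (hqk f hf) with ⟨_, r, hrD, hfr, hpr⟩ | h1
      · exfalso
        rcases h.clique hfp hfr hpp hpr with rfl | e'
        · exact hDC p hrD hpC
        · exact hDC p (hDcl r p hrD (h.symm e') fun h' => h'.1 hpC) hpC
      · exact h1
    have hLe : ∀ k, Later adj pos e k ↔ Bd adj C k := by
      intro k
      constructor
      · intro hk
        by_contra hno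
        exact absurd (hem k (hDcl e k heD hk.1 hno)) (by have := hk.2; omega)
      · intro hk
        rcases h.boundary hDn hDc heD hem (hqk k hk) with h1 | h1
        · have := hfm k hk; omega
        · exact ⟨h.symm h1.2, h1.1⟩
    have hen := hDn e heD
    have hbase : blockBase n (n + e) = e := by simp [blockBase]
    refine ⟨n + e, by omega, fun u => h.block_eq (by omega) hC ?_ ?_ (s := p) ?_ hpC u⟩
    · intro w hw
      rw [hbase, hLe]; exact hw
    · intro w hw
      rw [hbase, hLe]; exact fun h' => h'.1 hw
    · rw [seed, if_neg (by omega), Nat.add_sub_cancel_left]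
      refine ⟨f, (hLe f).2 hf, fun k hk => hfk k ((hLe k).1 hk), ⟨hfp, hpp⟩, fun h' => ?_⟩
      exact ((hLe p).1 h').1 hpC

end PEO

/-! ### Cliques of a perfect elimination order -/

/-- The clique formed by `v` and its later neighbours. -/
def Clq (adj : ℕ → ℕ → Prop) (pos : ℕ → ℕ) (v u : ℕ) : Prop := u = v ∨ Later adj pos v u

theorem PEO.clq_clique {n : ℕ} {adj : ℕ → ℕ → Prop} {pos : ℕ → ℕ} (h : PEO n adj pos) {v u w : ℕ}
    (hu : Clq adj pos v u) (hw : Clq adj pos v w) : u = w ∨ adj u w := by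
  rcases hu with rfl | hu <;> rcases hw with rfl | hw
  · exact .inl rfl
  · exact .inr hw.1
  · exact .inr (h.symm hu.1)
  · exact h.clique hu.1 hw.1 hu.2 hw.2

/-- Each maximal clique consists of its first vertex and the later neighbours of this vertex, so
that the maximal cliques are among `n` known cliques. -/
theorem PEO.exists_clq {n : ℕ} {adj : ℕ → ℕ → Prop} {pos : ℕ → ℕ} (h : PEO n adj pos)
    (hn : 0 < n) {y : ℕ → Prop} (hy : IsMaxClique n adj y) :
    ∃ v < n, ∀ u, y u ↔ Clq adj pos v u := by
  have hne : ∃ v, y v := by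
    by_contra! hno
    exact hno 0 (hy.maximal 0 hn fun u hu => absurd hu (hno u))
  obtain ⟨v, hv, hvm⟩ := exists_pos_min pos hy.lt hne
  have hsub : ∀ u, y u → Clq adj pos v u := by
    intro u hu
    rcases hy.clique v u hv hu with e | e
    · exact .inl e.symm
    · refine .inr ⟨e, lt_of_le_of_ne (hvm u hu) fun e' => ?_⟩
      have := h.inj (hy.lt v hv) (hy.lt u hu) e'
      subst this
      exact h.irrefl e
  refine ⟨v, hy.lt v hv, fun u => ⟨hsub u, fun hu => ?_⟩⟩
  have hun : u < n := by
    rcases hu with rfl | hu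
    · exact hy.lt _ hv
    · exact h.lt hu.1
  exact hy.maximal u hun fun w hw => h.clq_clique (hsub w hw) hu |>.imp id id

/-! ### Connected sets in a rooted clique tree -/

namespace RootedModel

variable {n : ℕ} {adj : ℕ → ℕ → Prop} (M : RootedModel n adj)

include M

theorem adj_symm {u v : ℕ} (h : adj u v) : adj v u := by
  rw [M.adj_iff] at *
  obtain ⟨h1, x, h2, h3⟩ := h
  exact ⟨h1.symm, x, h3, h2⟩

theorem adj_irrefl {u : ℕ} : ¬ adj u u := fun h => (M.adj_iff.1 h).1 rfl

theorem adj_lt {u v : ℕ} (h : adj u v) : v < n := by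
  obtain ⟨_, x, _, h3⟩ := M.adj_iff.1 h
  exact M.mem_lt h3

theorem antisymm {x y : M.N} (h : M.anc x y) (h' : M.anc y x) : x = y := by
  rcases M.depth_lt h with e | e
  · exact e
  rcases M.depth_lt h' with e' | e'
  · exact e'.symm
  · omega

theorem eq_or_adj {x : M.N} {u v : ℕ} (hu : M.mem x u) (hv : M.mem x v) : u = v ∨ adj u v := by
  by_cases h : u = v
  · exact .inl h
  · exact .inr (M.adj_iff.2 ⟨h, x, hu, hv⟩)

theorem isMaxClique (x : M.N) : IsMaxClique n adj (M.mem x) :=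
  ⟨fun _ h => M.mem_lt h, fun _ _ hu hv => M.eq_or_adj hu hv, fun _ hv h => M.maximal hv h⟩

/-- A set of vertices has a simplicial vertex: one whose nodes begin as deep as possible. -/
theorem exists_simplicial {H : ℕ → Prop} (hH : ∀ v, H v → v < n) (hne : ∃ v, H v) :
    ∃ v, H v ∧ ∀ u w, H u → H w → adj v u → adj v w → u = w ∨ adj u w := by
  have htop : ∀ v, ∃ t : M.N, v < n → M.mem t v ∧ ∀ x, M.mem x v → M.anc t x := by
    intro v
    by_cases hv : v < n
    · obtain ⟨x₀, hx₀⟩ := M.nonempty hv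
      obtain ⟨t, ht, hm⟩ := exists_min_of M (fun x => M.mem x v) ⟨x₀, hx₀⟩
      refine ⟨t, fun _ => ⟨ht, fun x hx => ?_⟩⟩
      rcases M.total ht hx with h | h
      · exact h
      rcases M.depth_lt h with rfl | h'
      · exact h
      · have := hm x hx; omega
    · exact ⟨M.root.choose, fun h => absurd h hv⟩
  choose t ht using htop
  obtain ⟨v, hv, hvm⟩ := exists_pos_max (fun v => M.depth (t v)) hH hne
  have key : ∀ u, H u → adj v u → M.mem (t v) u := by
    intro u hu huv
    obtain ⟨-, x, h1, h2⟩ := M.adj_iff.1 huv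
    have h3 := (ht v (hH v hv)).2 x h1
    have h4 := (ht u (hH u hu)).2 x h2
    rcases M.chain h4 h3 with h5 | h5
    · exact M.convex (ht u (hH u hu)).1 h2 h5 h3
    · rcases M.depth_lt h5 with e | e
      · rw [e]; exact (ht u (hH u hu)).1
      · have := hvm u hu; omega
  exact ⟨v, hv, fun u w hu hw h1 h2 => M.eq_or_adj (key u hu h1) (key w hw h2)⟩
where
  exists_min_of (M : RootedModel n adj) (P : M.N → Prop) (h : ∃ x, P x) :
      ∃ x, P x ∧ ∀ y, P y → M.depth x ≤ M.depth y := by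
    classical
    have h' : ∃ d x, P x ∧ M.depth x = d := ⟨_, h.choose, h.choose_spec, rfl⟩
    obtain ⟨x, h1, h2⟩ := Nat.find_spec h'
    exact ⟨x, h1, fun y hy => h2 ▸ Nat.find_min' h' ⟨y, hy, rfl⟩⟩

/-- The nodes that meet a connected set disjoint from the clique `y` are all below `y` or all not
below `y`. -/
theorem below_iff {C : ℕ → Prop} (hC : Conn adj C) {y : M.N} (hy : ∀ v, C v → ¬ M.mem y v)
    {u v : ℕ} (hu : C u) (hv : C v) {x x' : M.N} (hx : M.mem x u) (hx' : M.mem x' v)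
    (h : M.anc y x) : M.anc y x' := by
  have one : ∀ {v x x'}, C v → M.mem x v → M.mem x' v → M.anc y x → M.anc y x' := by
    intro v x x' hv hx hx' h
    rcases M.total hx hx' with h1 | h1
    · exact M.trans h h1
    · rcases M.chain h h1 with h2 | h2
      · exact h2
      · exact absurd (M.convex hx' hx h2 h) (hy v hv)
  refine hC (fun v => ∀ x, M.mem x v → M.anc y x) u hu (fun x' hx' => one hu hx hx' h) ?_
      v hv x' hx'
  intro a b ha hb hab hD x'' hx''
  obtain ⟨-, z, h1, h2⟩ := M.adj_iff.1 hab
  exact one hb h2 hx'' (hD z h1)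

/-- The first node of a connected set. -/
theorem exists_top {C : ℕ → Prop} (hC : Conn adj C) (hn : ∀ v, C v → v < n) (hne : ∃ v, C v) :
    ∃ t, (∃ v, C v ∧ M.mem t v) ∧ ∀ v x, C v → M.mem x v → M.anc t x := by
  obtain ⟨v₀, hv₀⟩ := hne
  obtain ⟨x₀, hx₀⟩ := M.nonempty (hn v₀ hv₀)
  obtain ⟨t, ⟨v, hv, htv⟩, hm⟩ := exists_simplicial.exists_min_of M (fun x => ∃ v, C v ∧ M.mem x v)
    ⟨x₀, v₀, hv₀, hx₀⟩
  refine ⟨t, ⟨v, hv, htv⟩, ?_⟩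
  have up : ∀ {w x}, C w → M.mem x w → M.anc x t → M.anc t x := by
    intro w x hw hx h
    rcases M.depth_lt h with rfl | h'
    · exact h
    · have := hm x ⟨w, hw, hx⟩; omega
  have := hC (fun v => ∀ x, M.mem x v → M.anc t x) v hv (fun x hx => ?_)
      (fun a b ha hb hab hD x hx => ?_)
  · exact fun v x hv hx => this v hv x hx
  · rcases M.total htv hx with h | h
    · exact h
    · exact up hv hx h
  · obtain ⟨-, z, h1, h2⟩ := M.adj_iff.1 hab
    rcases M.total h2 hx with h | h
    · exact M.trans (hD z h1) h
    · rcases M.chain (hD z h1) h with h' | h'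
      · exact h'
      · exact up hb hx h'

/-- A connected set meets every node between two nodes that it meets. -/
theorem meets_between {C : ℕ → Prop} (hC : Conn adj C) {x m x' : M.N} (h1 : M.anc x m)
    (h2 : M.anc m x') {u v : ℕ} (hu : C u) (hv : C v) (hx : M.mem x u) (hx' : M.mem x' v) :
    ∃ w, C w ∧ M.mem m w := by
  by_contra! hno
  have := M.below_iff hC hno hv hu hx' hx h2
  exact hno u hu (M.antisymm h1 this ▸ hx)

end RootedModel

/-! ### Searching and counting below a bound -/

open Classical in
/-- The last `k < K` with `φ k`, increased by one; `0` if there is none. -/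
noncomputable def lastOf (φ : ℕ → Prop) : ℕ → ℕ
  | 0 => 0
  | K + 1 => if φ K then K + 1 else lastOf φ K

theorem lastOf_eq_zero {φ : ℕ → Prop} {K : ℕ} : lastOf φ K = 0 ↔ ∀ k < K, ¬ φ k := by
  induction K with
  | zero => simp [lastOf]
  | succ K ih =>
    rw [lastOf, Nat.forall_lt_succ_right]
    split_ifs with h
    · simp [h]
    · simp [h, ih]

theorem lastOf_eq_succ {φ : ℕ → Prop} {K l : ℕ} (h : lastOf φ K = l + 1) : l < K ∧ φ l := by
  induction K with
  | zero => simp [lastOf] at h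
  | succ K ih =>
    rw [lastOf] at h
    split_ifs at h with h1
    · obtain rfl : K = l := by omega
      exact ⟨by omega, h1⟩
    · have := ih h
      exact ⟨by omega, this.2⟩

theorem lastOf_congr {φ ψ : ℕ → Prop} {K : ℕ} (h : ∀ k < K, φ k ↔ ψ k) :
    lastOf φ K = lastOf ψ K := by
  induction K with
  | zero => rfl
  | succ K ih =>
    rw [lastOf, lastOf, ih fun k hk => h k (by omega), propext (h K (by omega))]

open Classical in
/-- The first `k < K` with `φ k` for which `key k` is least, increased by one; `0` if there is
none. -/
noncomputable def argMin (φ : ℕ → Prop) (key : ℕ → ℕ) : ℕ → ℕ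
  | 0 => 0
  | K + 1 => if φ K ∧ (argMin φ key K = 0 ∨ key K < key (argMin φ key K - 1)) then K + 1
      else argMin φ key K

theorem argMin_spec (φ : ℕ → Prop) (key : ℕ → ℕ) (K : ℕ) :
    (argMin φ key K = 0 ∧ ∀ k < K, ¬ φ k) ∨ ∃ m < K, argMin φ key K = m + 1 ∧ φ m ∧
      ∀ k < K, φ k → key m ≤ key k := by
  induction K with
  | zero => simp [argMin]
  | succ K ih =>
    rw [argMin]
    rcases ih with ⟨h1, h2⟩ | ⟨m, hm, h1, h2, h3⟩
    · by_cases h : φ K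
      · refine .inr ⟨K, by omega, by simp [h, h1], h, fun k hk hφ => ?_⟩
        rcases Nat.lt_succ_iff_lt_or_eq.1 hk with h' | rfl
        · exact absurd hφ (h2 k h')
        · exact le_rfl
      · refine .inl ⟨by simp [h, h1], fun k hk => ?_⟩
        rcases Nat.lt_succ_iff_lt_or_eq.1 hk with h' | rfl
        · exact h2 k h'
        · exact h
    · right
      by_cases h : φ K ∧ key K < key m
      · refine ⟨K, by omega, by simp [h, h1], h.1, fun k hk hφ => ?_⟩
        rcases Nat.lt_succ_iff_lt_or_eq.1 hk with h' | rfl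
        · exact h.2.le.trans (h3 k h' hφ)
        · exact le_rfl
      · refine ⟨m, by omega, ?_, h2, fun k hk hφ => ?_⟩
        · rw [h1, if_neg]
          simpa using h
        · rcases Nat.lt_succ_iff_lt_or_eq.1 hk with h' | rfl
          · exact h3 k h' hφ
          · by_contra h'
            exact h ⟨hφ, by omega⟩

open Classical in
/-- The number of `k < n` with `φ k`. -/
noncomputable def cnt (n : ℕ) (φ : ℕ → Prop) : ℕ := ((Finset.range n).filter φ).card

open Classical in
theorem cnt_congr {n : ℕ} {φ ψ : ℕ → Prop} (h : ∀ k < n, φ k ↔ ψ k) : cnt n φ = cnt n ψ := by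
  unfold cnt
  congr 1
  ext k
  simp only [Finset.mem_filter, Finset.mem_range]
  exact and_congr_right fun hk => h k hk

open Classical in
theorem cnt_mono {n : ℕ} {φ ψ : ℕ → Prop} (h : ∀ k < n, φ k → ψ k) : cnt n φ ≤ cnt n ψ := by
  refine Finset.card_le_card fun k => ?_
  simp only [Finset.mem_filter, Finset.mem_range]
  exact fun hk => ⟨hk.1, h k hk.1 hk.2⟩

open Classical in
theorem cnt_lt {n : ℕ} {φ ψ : ℕ → Prop} (h : ∀ k < n, φ k → ψ k) {k : ℕ} (hk : k < n)
    (h1 : ψ k) (h2 : ¬ φ k) : cnt n φ < cnt n ψ := by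
  refine Finset.card_lt_card (Finset.ssubset_iff_of_subset (fun k => ?_) |>.2 ⟨k, ?_, ?_⟩)
  · simp only [Finset.mem_filter, Finset.mem_range]
    exact fun hk => ⟨hk.1, h k hk.1 hk.2⟩
  · simp [hk, h1]
  · simp [h2]

open Classical in
theorem cnt_add_le {n : ℕ} {φ ψ χ : ℕ → Prop} (h1 : ∀ k < n, φ k → χ k)
    (h2 : ∀ k < n, ψ k → χ k) (h3 : ∀ k < n, φ k → ¬ ψ k) : cnt n φ + cnt n ψ ≤ cnt n χ := by
  unfold cnt
  classical
  rw [← Finset.card_union_of_disjoint]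
  · refine Finset.card_le_card fun k => ?_
    simp only [Finset.mem_union, Finset.mem_filter, Finset.mem_range]
    rintro (h | h)
    · exact ⟨h.1, h1 k h.1 h.2⟩
    · exact ⟨h.1, h2 k h.1 h.2⟩
  · rw [Finset.disjoint_left]
    simp only [Finset.mem_filter, Finset.mem_range]
    exact fun k hk hk' => h3 k hk.1 hk.2 hk'.2

open Classical in
theorem cnt_le {n : ℕ} {φ : ℕ → Prop} : cnt n φ ≤ n := by
  unfold cnt
  exact (Finset.card_filter_le _ _).trans (by simp)

open Classical in
theorem cnt_eq_zero {n : ℕ} {φ : ℕ → Prop} : cnt n φ = 0 ↔ ∀ k < n, ¬ φ k := by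
  rw [cnt, Finset.card_eq_zero, Finset.filter_eq_empty_iff]
  simp

open Classical in
theorem cnt_erase {n : ℕ} {φ ψ : ℕ → Prop} {p : ℕ} (hp : p < n) (h : φ p)
    (hψ : ∀ k < n, ψ k ↔ φ k ∧ k ≠ p) : cnt n ψ = cnt n φ - 1 := by
  rw [cnt, cnt, ← Finset.card_erase_of_mem (a := p) (by simp [hp, h])]
  congr 1
  ext k
  simp only [Finset.mem_erase, Finset.mem_filter, Finset.mem_range]
  constructor
  · exact fun hk => ⟨((hψ k hk.1).1 hk.2).2, hk.1, ((hψ k hk.1).1 hk.2).1⟩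
  · exact fun hk => ⟨hk.2.1, (hψ k hk.2.1).2 ⟨hk.2.2, hk.1⟩⟩

theorem eq_of_cnt_le {n : ℕ} {φ ψ : ℕ → Prop} (h : ∀ k < n, φ k → ψ k) (hc : cnt n ψ ≤ cnt n φ)
    {k : ℕ} (hk : k < n) (h1 : ψ k) : φ k := by
  by_contra h2
  exact absurd (cnt_lt h hk h1 h2) (by omega)

/-! ### Combining the orders of the blocks -/

/-- A family of connected sets `C b` with `b < 2n`, the set `C (2n)` of all vertices, and cliques
`Q R`. -/
structure Blocks (n : ℕ) (adj : ℕ → ℕ → Prop) (Q C : ℕ → ℕ → Prop) : Prop where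
  symm : ∀ {u v}, adj u v → adj v u
  irrefl : ∀ {u}, ¬ adj u u
  adj_lt : ∀ {u v}, adj u v → v < n
  lt : ∀ {b u}, C b u → u < n
  conn : ∀ {b}, b < 2 * n → Conn adj (C b)
  univ : ∀ {u}, u < n → C (2 * n) u
  clique : ∀ {R u w}, Q R u → Q R w → u = w ∨ adj u w

/-- The boundary of block `l` is not uniform on block `i`: some vertex of block `i` is adjacent to
some, but not all vertices of the boundary. -/
def Mixed (adj : ℕ → ℕ → Prop) (C : ℕ → ℕ → Prop) (l i : ℕ) : Prop :=
  ∃ u, C i u ∧ (∃ x, Bd adj (C l) x ∧ adj u x) ∧ ∃ x, Bd adj (C l) x ∧ ¬ adj u x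

/-- Block `l` is a connected component (or empty) of the graph minus the clique `R`. -/
def Splits (adj : ℕ → ℕ → Prop) (Q C : ℕ → ℕ → Prop) (R l : ℕ) : Prop :=
  (∀ x, Bd adj (C l) x → Q R x) ∧ ∀ x, C l x → ¬ Q R x

/-- `l` and `k` are different components of the graph minus the clique `R`, and neither boundary is
uniform on the other component. Then they cannot both be below the node `R` of a rooted clique tree.
(That `l` is a component is understood.) -/
def Conflict (adj : ℕ → ℕ → Prop) (Q C : ℕ → ℕ → Prop) (R l k : ℕ) : Prop :=
  Splits adj Q C R k ∧ Mixed adj C l k ∧ Mixed adj C k l ∧ ¬ ∃ x, C k x ∧ C l x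

/-- Blocks are sorted by decreasing size of their boundaries; among blocks with equal boundaries
those come first on which this boundary is uniform. -/
noncomputable def blockKey (n : ℕ) (adj : ℕ → ℕ → Prop) (C : ℕ → ℕ → Prop) (b : ℕ) : ℕ :=
  ind (Mixed adj C b b) + 2 * cnt n fun k => ¬ Bd adj (C b) k

/-- A component, increased by one, of the graph minus the clique `R` that contains `u`. -/
noncomputable def compOf (n : ℕ) (adj : ℕ → ℕ → Prop) (Q C : ℕ → ℕ → Prop) (R u : ℕ) : ℕ :=
  lastOf (fun l => Splits adj Q C R l ∧ C l u) (2 * n)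

/-- The component, increased by one, in conflict with `l` at the clique `R` whose boundary is
largest. -/
noncomputable def partner (n : ℕ) (adj : ℕ → ℕ → Prop) (Q C : ℕ → ℕ → Prop) (R l : ℕ) : ℕ :=
  argMin (Conflict adj Q C R l) (blockKey n adj C) (2 * n)

/-- Some component in conflict with `l` has a boundary that is not contained in the one of the
partner of `l`. -/
def Dead (n : ℕ) (adj : ℕ → ℕ → Prop) (Q C : ℕ → ℕ → Prop) (R l : ℕ) : Prop :=
  ∃ k < 2 * n, Conflict adj Q C R l k ∧
    ∃ x, Bd adj (C k) x ∧ ¬ Bd adj (C (partner n adj Q C R l - 1)) x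

/-- The component `c - 1` of the graph minus the clique `R` is an obstacle to choosing `R` as the
top node of block `b`. Here `c = 0` stands for a vertex without a component among the blocks, and
`top l = 0` for a block without an order. If `l = c - 1` is below the node `R` of a clique tree, then
the components in conflict with it are not. Hence their boundaries are nested, so that `l` is not
dead, and the partner of `l` is disjoint from block `b`. -/
def Obstacle (n : ℕ) (adj : ℕ → ℕ → Prop) (Q C : ℕ → ℕ → Prop) (top : ℕ → ℕ) (b R c : ℕ) : Prop :=
  c = 0 ∨ top (c - 1) = 0 ∨ Dead n adj Q C R (c - 1) ∨ (partner n adj Q C R (c - 1) ≠ 0 ∧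
    ∃ x, C (partner n adj Q C R (c - 1) - 1) x ∧ C b x)

/-- The clique `R` is accepted as the top node of block `b`: it contains the boundary of the block
and is contained in the block and its boundary, it meets the block, and no component of the rest of
the block is an obstacle. -/
def Accept (n : ℕ) (adj : ℕ → ℕ → Prop) (Q C : ℕ → ℕ → Prop) (top : ℕ → ℕ) (b R : ℕ) : Prop :=
  (∀ x, Bd adj (C b) x → Q R x) ∧ (∀ x, Q R x → Bd adj (C b) x ∨ C b x) ∧ (∃ x, Q R x ∧ C b x) ∧
    ∀ u, C b u → ¬ Q R u → ¬ Obstacle n adj Q C top b R (compOf n adj Q C R u)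

/-- Components are listed in the order of their keys. -/
def Before (n : ℕ) (adj : ℕ → ℕ → Prop) (C : ℕ → ℕ → Prop) (i l : ℕ) : Prop :=
  blockKey n adj C i < blockKey n adj C l ∨ blockKey n adj C i = blockKey n adj C l ∧ i < l

/-- The vertices of a block that precede `u`, apart from those in the same component of the graph
minus the clique `R`. -/
def Precedes (n : ℕ) (adj : ℕ → ℕ → Prop) (Q C : ℕ → ℕ → Prop) (b R u k : ℕ) : Prop :=
  C b k ∧ ((Q R u ∧ Q R k ∧ k < u) ∨ (¬ Q R u ∧ (Q R k ∨
    Before n adj C (compOf n adj Q C R k - 1) (compOf n adj Q C R u - 1))))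

/-- The order property of a rooted clique tree, relative to a set `K` that precedes the set `C`:
if `x` comes after `u` and has a neighbour `w` that is `u` or an earlier neighbour of `u`, then all
neighbours of `x` that are not later than `u` are `u` or neighbours of `u`. -/
structure IsTreeOrder (n : ℕ) (adj : ℕ → ℕ → Prop) (K C : ℕ → Prop) (ρ : ℕ → ℕ) : Prop where
  lt : ∀ u, C u → ρ u < cnt n C
  inj : ∀ u v, C u → C v → ρ u = ρ v → u = v
  order : ∀ u x w l, C u → C x → ρ u < ρ x → (K w ∨ (C w ∧ ρ w ≤ ρ u)) →
    (K l ∨ (C l ∧ ρ l ≤ ρ u)) → adj x w → adj x l → (w = u ∨ adj w u) → l = u ∨ adj l u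

namespace Blocks

variable {n : ℕ} {adj Q C : ℕ → ℕ → Prop}

theorem bd_lt (h : Blocks n adj Q C) {b w : ℕ} (hw : Bd adj (C b) w) : w < n := by
  obtain ⟨_, u, _, h2⟩ := hw
  exact h.adj_lt h2

theorem compOf_spec {R u l : ℕ} (hl : compOf n adj Q C R u = l + 1) :
    l < 2 * n ∧ Splits adj Q C R l ∧ C l u := lastOf_eq_succ hl

theorem splits_closed {R l x y : ℕ} (hl : Splits adj Q C R l) (hx : C l x) (hxy : adj x y) :
    C l y ∨ Q R y := by
  by_cases hy : C l y
  · exact .inl hy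
  · exact .inr (hl.1 y ⟨hy, x, hx, hxy⟩)

theorem splits_subset (h : Blocks n adj Q C) {R l : ℕ} (hl : l < 2 * n) (hs : Splits adj Q C R l)
    {D : ℕ → Prop} (hD : ∀ w, Bd adj D w → Q R w) {u : ℕ} (hu : C l u) (hu' : D u) :
    ∀ v, C l v → D v :=
  (h.conn hl).subset hu hu' hD hs.2

theorem splits_eq (h : Blocks n adj Q C) {R l l' : ℕ} (hl : l < 2 * n) (hl' : l' < 2 * n)
    (hs : Splits adj Q C R l) (hs' : Splits adj Q C R l') {u : ℕ} (hu : C l u) (hu' : C l' u) :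
    C l = C l' := by
  funext v
  exact propext ⟨h.splits_subset hl hs hs'.1 hu hu' v, h.splits_subset hl' hs' hs.1 hu' hu v⟩

theorem compOf_eq (h : Blocks n adj Q C) {R l u v : ℕ} (hl : compOf n adj Q C R u = l + 1)
    (hv : C l v) : compOf n adj Q C R v = l + 1 := by
  rw [← hl]
  obtain ⟨h1, h2, h3⟩ := compOf_spec hl
  refine lastOf_congr fun k hk => and_congr_right fun hs => ⟨fun h4 => ?_, fun h4 => ?_⟩
  · rw [h.splits_eq hk h1 hs h2 h4 hv]; exact h3
  · rw [h.splits_eq hk h1 hs h2 h4 h3]; exact hv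

/-- Of two components without conflict, the boundary of the later one is uniform on the earlier
one. -/
theorem not_mixed_of_before (h : Blocks n adj Q C) {R i l : ℕ} (hi : Splits adj Q C R i)
    (hl : Splits adj Q C R l) (hb : Before n adj C i l)
    (hc : ¬ (Mixed adj C l i ∧ Mixed adj C i l)) : ¬ Mixed adj C l i := by
  intro hm
  have hu : ¬ Mixed adj C i l := fun hm' => hc ⟨hm, hm'⟩
  obtain ⟨u, hui, ⟨x, hx, hux⟩, ⟨y, hy, huy⟩⟩ := hm
  have hxi : Bd adj (C i) x := ⟨fun hx' => hi.2 x hx' (hl.1 x hx), u, hui, hux⟩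
  obtain ⟨-, v, hv, hvx⟩ := hx
  have hsub : ∀ z, Bd adj (C i) z → Bd adj (C l) z := by
    intro z hz
    refine ⟨fun hz' => hl.2 z hz' (hi.1 z hz), v, hv, ?_⟩
    by_contra hvz
    exact hu ⟨v, hv, ⟨x, hxi, hvx⟩, ⟨z, hz, hvz⟩⟩
  have hcnt : cnt n (fun k => ¬ Bd adj (C l) k) ≤ cnt n fun k => ¬ Bd adj (C i) k :=
    cnt_mono fun k _ hk hk' => hk (hsub k hk')
  have hkey : blockKey n adj C i ≤ blockKey n adj C l := by
    rcases hb with hb | hb <;> omega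
  have hb1 : ∀ p : Prop, ind p ≤ 1 := fun p => by unfold ind; split_ifs <;> omega
  unfold blockKey at hkey
  have h1 := hb1 (Mixed adj C i i)
  have h2 := hb1 (Mixed adj C l l)
  have heq : ∀ z, Bd adj (C l) z → Bd adj (C i) z := by
    intro z hz
    by_contra hz'
    exact eq_of_cnt_le (φ := fun k => ¬ Bd adj (C l) k) (ψ := fun k => ¬ Bd adj (C i) k)
      (fun k _ hk hk' => hk (hsub k hk')) (by omega) (h.bd_lt hz) hz' hz
  have hii : ind (Mixed adj C i i) = 1 := ind_eq_one.2 ⟨u, hui, ⟨x, hxi, hux⟩, ⟨y, heq y hy, huy⟩⟩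
  have hll : ind (Mixed adj C l l) = 1 := by omega
  obtain ⟨v', hv', ⟨x', hx', hvx'⟩, ⟨y', hy', hvy'⟩⟩ := ind_eq_one.1 hll
  exact hu ⟨v', hv', ⟨x', heq x' hx', hvx'⟩, ⟨y', heq y' hy', hvy'⟩⟩

/-- Accepting a clique yields an order of the block from the orders of the components: the vertices
of the clique come first, and the components follow in the order of their keys. Two components inside
of the block have no conflict, since the partner of one of them would contain the boundary of the
other one in its own boundary and thus be adjacent to the block. Therefore
`Blocks.not_mixed_of_before` applies, and it gives the order property for vertices in different
components. -/
theorem isTreeOrder (h : Blocks n adj Q C) {b R : ℕ} {top : ℕ → ℕ} {RP : ℕ → ℕ → ℕ}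
    (hb : b ≤ 2 * n) (hA : Accept n adj Q C top b R) (h0 : ∀ u, RP 0 u = 0)
    (hRP : ∀ l < 2 * n, top l ≠ 0 → IsTreeOrder n adj (Bd adj (C l)) (C l) (RP (l + 1))) :
    IsTreeOrder n adj (Bd adj (C b)) (C b) fun u =>
      RP (compOf n adj Q C R u) u + cnt n (Precedes n adj Q C b R u) := by
  obtain ⟨hK, hQ, ⟨q, hqR, hqb⟩, hcov⟩ := hA
  have hQ0 : ∀ u, Q R u → compOf n adj Q C R u = 0 := fun u hu => by
    rw [compOf, lastOf_eq_zero]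
    exact fun k _ hk => hk.1.2 u hk.2 hu
  -- the component of a vertex outside of the clique
  have hcomp : ∀ u, C b u → ¬ Q R u → ∃ l, compOf n adj Q C R u = l + 1 ∧ l < 2 * n ∧
      Splits adj Q C R l ∧ C l u ∧ top l ≠ 0 ∧ ¬ Dead n adj Q C R l ∧
      (partner n adj Q C R l = 0 ∨ ∀ x, C (partner n adj Q C R l - 1) x → ¬ C b x) := by
    intro u hu hq
    have h1 := hcov u hu hq
    unfold Obstacle at h1
    push Not at h1
    obtain ⟨l, hl⟩ := Nat.exists_eq_succ_of_ne_zero h1.1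
    obtain ⟨h2, h3, h4⟩ := compOf_spec hl
    rw [hl, Nat.succ_sub_one] at h1
    refine ⟨l, hl, h2, h3, h4, h1.2.1, h1.2.2.1, ?_⟩
    by_cases h5 : partner n adj Q C R l = 0
    · exact .inl h5
    · exact .inr (h1.2.2.2 h5)
  have hsub : ∀ {l u}, l < 2 * n → Splits adj Q C R l → C l u → C b u → ∀ v, C l v → C b v :=
    fun hl hs hu hbu => h.splits_subset hl hs hK hu hbu
  -- components inside of the block have no conflict
  have hnc : ∀ {i l u v}, i < 2 * n → l < 2 * n → Splits adj Q C R i → Splits adj Q C R l →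
      C i u → C b u → C b v → compOf n adj Q C R v = l + 1 → ¬ Q R v → ¬ C l u →
      ¬ (Mixed adj C l i ∧ Mixed adj C i l) := by
    intro i l u v hi hl hsi hsl hui hub hvb hvl hvR hlu hm
    obtain ⟨l', hl', h1, h2, h3, -, hdead, hpart⟩ := hcomp v hvb hvR
    obtain rfl : l = l' := by omega
    have hconf : Conflict adj Q C R l i := by
      refine ⟨hsi, hm.1, hm.2, ?_⟩
      rintro ⟨x, hx, hx'⟩
      rw [h.splits_eq hi hl hsi hsl hx hx'] at hui
      exact hlu hui
    rcases argMin_spec (Conflict adj Q C R l) (blockKey n adj C) (2 * n) with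
      ⟨-, h4⟩ | ⟨m, hm2, hm', hmc, -⟩
    · exact h4 i hi hconf
    have hm1 : partner n adj Q C R l = m + 1 := hm'
    have hKm : ∀ x, Bd adj (C i) x → Bd adj (C m) x := by
      intro x hx
      by_contra hx'
      exact hdead ⟨i, hi, hconf, x, hx, by rw [hm1]; exact hx'⟩
    have hmb : ∀ x, C m x → ¬ C b x := by
      rcases hpart with h5 | h5
      · omega
      · rw [hm1] at h5; exact h5
    rcases hb.lt_or_eq with hb | rfl
    · -- a vertex of the block on the boundary of the component
      obtain ⟨w, hwb, hwi⟩ : ∃ w, C b w ∧ Bd adj (C i) w := by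
        by_contra! hno
        exact hsi.2 q ((h.conn hb).subset hub hui (F := Bd adj (C i)) (fun _ hw => hw)
          (fun w hw => hno w hw) q hqb) hqR
      obtain ⟨-, z, hz, hzw⟩ := hKm w hwi
      by_cases hzb : C b z
      · exact hmb z hz hzb
      · exact hmc.1.2 z hz (hK z ⟨hzb, w, hwb, h.symm hzw⟩)
    · obtain ⟨z, hz, -⟩ := hmc.2.1
      exact hmb z hz (h.univ (h.lt hz))
  -- the cells that precede a vertex
  have hpq : ∀ {u}, Q R u → ∀ k, Precedes n adj Q C b R u k ↔ C b k ∧ Q R k ∧ k < u := by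
    intro u hu k
    unfold Precedes
    tauto
  have hpc : ∀ {u l}, ¬ Q R u → compOf n adj Q C R u = l + 1 → ∀ k,
      Precedes n adj Q C b R u k ↔
        C b k ∧ (Q R k ∨ Before n adj C (compOf n adj Q C R k - 1) l) := by
    intro u l hu hl k
    unfold Precedes
    rw [hl]
    simp only [Nat.add_sub_cancel]
    tauto
  have hirr : ∀ l, ¬ Before n adj C l l := fun l hl => by
    rcases hl with hl | hl <;> omega
  have htr : ∀ i j k, Before n adj C i j → Before n adj C j k → Before n adj C i k := by
    intro i j k h1 h2
    unfold Before at *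
    omega
  have htot : ∀ i j, i ≠ j → Before n adj C i j ∨ Before n adj C j i := by
    intro i j hij
    unfold Before
    omega
  set ρ := fun u => RP (compOf n adj Q C R u) u + cnt n (Precedes n adj Q C b R u) with hρ
  have hρq : ∀ {u}, Q R u → ρ u = cnt n fun k => C b k ∧ Q R k ∧ k < u := by
    intro u hu
    simp only [hρ, hQ0 u hu, h0, zero_add]
    exact cnt_congr fun k _ => hpq hu k
  have hρc : ∀ {u l}, ¬ Q R u → compOf n adj Q C R u = l + 1 → ρ u = RP (l + 1) u +
      cnt n fun k => C b k ∧ (Q R k ∨ Before n adj C (compOf n adj Q C R k - 1) l) := by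
    intro u l hu hl
    simp only [hρ, hl]
    congr 1
    exact cnt_congr fun k _ => hpc hu hl k
  -- the next three facts say that the order is lexicographic
  have hqq : ∀ {u v}, C b u → Q R u → Q R v → u < v → ρ u < ρ v := by
    intro u v hu hqu hqv huv
    rw [hρq hqu, hρq hqv]
    exact cnt_lt (fun k _ hk => ⟨hk.1, hk.2.1, by omega⟩) (h.lt hu) ⟨hu, hqu, huv⟩ (by simp)
  have hqc : ∀ {u v}, C b u → Q R u → C b v → ¬ Q R v → ρ u < ρ v := by
    intro u v hu hqu hv hqv
    obtain ⟨l, hl, -⟩ := hcomp v hv hqv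
    rw [hρq hqu, hρc hqv hl]
    refine lt_of_lt_of_le (cnt_lt (fun k _ hk => ⟨hk.1, .inl hk.2.1⟩) (h.lt hu) ⟨hu, .inl hqu⟩
      (by simp)) (Nat.le_add_left _ _)
  have hcc : ∀ {u v i l}, C b u → ¬ Q R u → ¬ Q R v → compOf n adj Q C R u = i + 1 →
      compOf n adj Q C R v = l + 1 → Before n adj C i l → ρ u < ρ v := by
    intro u v i l hu hqu hqv hi hl hil
    obtain ⟨i', hi', h1, h2, h3, h4, -⟩ := hcomp u hu hqu
    obtain rfl : i = i' := by omega
    rw [hρc hqu hi, hρc hqv hl]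
    have hlt := (hRP i h1 h4).lt u h3
    have hle : cnt n (C i) + cnt n (fun k => C b k ∧ (Q R k ∨
        Before n adj C (compOf n adj Q C R k - 1) i)) ≤ cnt n fun k => C b k ∧ (Q R k ∨
          Before n adj C (compOf n adj Q C R k - 1) l) := by
      refine cnt_add_le (fun k _ hk => ⟨hsub h1 h2 h3 hu k hk, .inr ?_⟩)
        (fun k _ hk => ⟨hk.1, hk.2.imp id fun hk' => htr _ _ _ hk' hil⟩) (fun k _ hk hk' => ?_)
      · rw [h.compOf_eq hi hk]; exact hil
      · rcases hk'.2 with hk'' | hk''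
        · exact h2.2 k hk hk''
        · rw [h.compOf_eq hi hk] at hk''
          exact hirr _ hk''
    omega
  have hsame : ∀ {u v i}, ¬ Q R u → ¬ Q R v → compOf n adj Q C R u = i + 1 →
      compOf n adj Q C R v = i + 1 → (ρ u ≤ ρ v ↔ RP (i + 1) u ≤ RP (i + 1) v) := by
    intro u v i hqu hqv hi hl
    rw [hρc hqu hi, hρc hqv hl]
    omega
  refine ⟨fun u hu => ?_, fun u v hu hv huv => ?_, ?_⟩
  · by_cases hqu : Q R u
    · rw [hρq hqu]
      exact cnt_lt (fun k _ hk => hk.1) (h.lt hu) hu (by simp)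
    · obtain ⟨i, hi, h1, h2, h3, h4, -⟩ := hcomp u hu hqu
      rw [hρc hqu hi]
      have hlt := (hRP i h1 h4).lt u h3
      have hle : cnt n (C i) + cnt n (fun k => C b k ∧ (Q R k ∨
          Before n adj C (compOf n adj Q C R k - 1) i)) ≤ cnt n (C b) := by
        refine cnt_add_le (fun k _ hk => hsub h1 h2 h3 hu k hk) (fun k _ hk => hk.1)
          (fun k _ hk hk' => ?_)
        rcases hk'.2 with hk'' | hk''
        · exact h2.2 k hk hk''
        · rw [h.compOf_eq hi hk] at hk''
          exact hirr _ hk''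
      omega
  · by_contra hne
    by_cases hqu : Q R u <;> by_cases hqv : Q R v
    · rcases lt_or_gt_of_ne hne with h1 | h1
      · have := hqq hu hqu hqv h1; omega
      · have := hqq hv hqv hqu h1; omega
    · have := hqc hu hqu hv hqv; omega
    · have := hqc hv hqv hu hqu; omega
    · obtain ⟨i, hi, h1, h2, h3, h4, -⟩ := hcomp u hu hqu
      obtain ⟨l, hl, h1', h2', h3', h4', -⟩ := hcomp v hv hqv
      by_cases hil : i = l
      · subst hil
        refine hne ((hRP i h1 h4).inj u v h3 h3' (le_antisymm ?_ ?_))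
        · exact (hsame hqu hqv hi hl).1 huv.le
        · exact (hsame hqv hqu hl hi).1 huv.ge
      · rcases htot i l hil with h5 | h5
        · have := hcc hu hqu hqv hi hl h5; omega
        · have := hcc hv hqv hqu hl hi h5; omega
  · intro u x w l hu hx hux hw hl hxw hxl hwu
    -- a vertex not after `u` is in the clique if `u` is
    have early : ∀ z, (Bd adj (C b) z ∨ (C b z ∧ ρ z ≤ ρ u)) → ¬ Q R z → C b z ∧ ¬ Q R u := by
      intro z hz hqz
      rcases hz with hz | hz
      · exact absurd (hK z hz) hqz
      · refine ⟨hz.1, fun hqu => ?_⟩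
        have := hqc hu hqu hz.1 hqz
        omega
    by_cases hqu : Q R u
    · by_cases hql : Q R l
      · exact h.clique hql hqu
      · exact absurd hqu (early l hl hql).2
    have hqx : ¬ Q R x := fun hqx => by
      have := hqc hx hqx hu hqu
      omega
    obtain ⟨i, hi, h1, h2, h3, h4, -⟩ := hcomp u hu hqu
    obtain ⟨j, hj, h1', h2', h3', h4', -⟩ := hcomp x hx hqx
    -- neighbours of `x` outside of the clique belong to its component
    have hnb : ∀ z, adj x z → ¬ Q R z → C j z := fun z hxz hqz => by
      rcases splits_closed h2' h3' hxz with h5 | h5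
      · exact h5
      · exact absurd h5 hqz
    by_cases hij : i = j
    · subst hij
      have conv : ∀ z, adj x z → (Bd adj (C b) z ∨ (C b z ∧ ρ z ≤ ρ u)) →
          (Bd adj (C i) z ∨ (C i z ∧ RP (i + 1) z ≤ RP (i + 1) u)) := by
        intro z hxz hz
        by_cases hqz : Q R z
        · exact .inl ⟨fun hz' => h2.2 z hz' hqz, x, h3', hxz⟩
        · have h5 := hnb z hxz hqz
          rcases hz with hz | hz
          · exact absurd (hK z hz) hqz
          · exact .inr ⟨h5, (hsame hqz hqu (h.compOf_eq hi h5) hi).1 hz.2⟩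
      refine (hRP i h1 h4).order u x w l h3 h3' ?_ (conv w hxw hw) (conv l hxl hl) hxw hxl hwu
      by_contra hno
      have := (hsame hqx hqu hj hi).2 (by omega)
      omega
    · have hbij : Before n adj C i j := by
        rcases htot i j hij with h5 | h5
        · exact h5
        · have := hcc hx hqx hqu hj hi h5
          omega
      -- the two neighbours of `x` are on the boundary of its component
      have conv : ∀ z, adj x z → (Bd adj (C b) z ∨ (C b z ∧ ρ z ≤ ρ u)) → Bd adj (C j) z := by
        intro z hxz hz
        by_cases hqz : Q R z
        · exact ⟨fun hz' => h2'.2 z hz' hqz, x, h3', hxz⟩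
        · have h5 := hnb z hxz hqz
          rcases hz with hz | hz
          · exact absurd (hK z hz) hqz
          · have := hcc hu hqu hqz hi (h.compOf_eq hj h5) hbij
            omega
      have huj : ¬ C j u := fun huj => by
        have := h.compOf_eq hj huj
        omega
      have hun := h.not_mixed_of_before h2 h2' hbij (hnc h1 h1' h2 h2' h3 hu hx hj hqx huj)
      have hwj := conv w hxw hw
      have hwu' : adj u w := by
        rcases hwu with rfl | h5
        · exact absurd (h2'.1 w hwj) hqu
        · exact h.symm h5
      right
      by_contra hlu
      exact hun ⟨u, h3, ⟨w, hwj, hwu'⟩, ⟨l, conv l hxl hl, fun h5 => hlu (h.symm h5)⟩⟩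

end Blocks

/-! ### The tree accepts its own nodes -/

namespace RootedModel

variable {n : ℕ} {adj Q C : ℕ → ℕ → Prop} (M : RootedModel n adj)

/-- The node `y` is a possible top node of block `b`. -/
structure TopNode (C : ℕ → ℕ → Prop) (y : M.N) (b : ℕ) : Prop where
  le : b ≤ 2 * n
  meets : ∃ v, C b v ∧ M.mem y v
  below : ∀ v x, C b v → M.mem x v → M.anc y x
  bd_mem : ∀ w, Bd adj (C b) w → M.mem y w
  mem_bd : ∀ w, M.mem y w → Bd adj (C b) w ∨ C b w

include M

/-- Components below a common node have no conflict. -/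
theorem not_mixed_both (h : Blocks n adj Q C) {R i l : ℕ} {y : M.N} (hy : ∀ u, M.mem y u ↔ Q R u)
    (hi : i < 2 * n) (hl : l < 2 * n) (hsi : Splits adj Q C R i) (hsl : Splits adj Q C R l)
    (hd : ¬ ∃ x, C i x ∧ C l x) {yi yl : M.N} (hyi : M.TopNode C yi i) (hyl : M.TopNode C yl l)
    (hai : M.anc y yi) (hal : M.anc y yl) : ¬ (Mixed adj C l i ∧ Mixed adj C i l) := by
  -- the boundary of the lower component is uniform on the upper one
  have key : ∀ {i l yi yl}, i < 2 * n → Splits adj Q C R i → Splits adj Q C R l →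
      (¬ ∃ x, C i x ∧ C l x) → M.TopNode C yi i → M.TopNode C yl l → M.anc y yi → M.anc yi yl →
      ¬ Mixed adj C l i := by
    rintro i l yi yl hi hsi hsl hd hyi hyl hai hil ⟨u, hu, ⟨k, hk, huk⟩, ⟨k', hk', huk'⟩⟩
    obtain ⟨hne, x, hxu, hxk⟩ := M.adj_iff.1 huk
    have hix := hyi.below u x hu hxu
    rcases M.total hxk (hyl.bd_mem k hk) with h1 | h1
    · have h2 : M.mem x k' := M.convex ((hy k').2 (hsl.1 k' hk')) (hyl.bd_mem k' hk')
        (M.trans hai hix) h1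
      rcases M.eq_or_adj hxu h2 with h3 | h3
      · subst h3; exact hsi.2 u hu (hsl.1 u hk')
      · exact huk' h3
    · obtain ⟨v, hv, hyv⟩ := hyi.meets
      obtain ⟨w, hw, hyw⟩ := M.meets_between (h.conn hi) hil h1 hv hu hyv hxu
      rcases hyl.mem_bd w hyw with h2 | h2
      · exact hsi.2 w hw (hsl.1 w h2)
      · exact hd ⟨w, hw, h2⟩
  rintro ⟨hm1, hm2⟩
  obtain ⟨u, hu, ⟨k, hk, huk⟩, -⟩ := id hm1
  have hki : Bd adj (C i) k := ⟨fun hk' => hsi.2 k hk' (hsl.1 k hk), u, hu, huk⟩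
  rcases M.total (hyi.bd_mem k hki) (hyl.bd_mem k hk) with h1 | h1
  · exact key hi hsi hsl hd hyi hyl hai h1 hm1
  · exact key hl hsl hsi (fun ⟨x, h2, h3⟩ => hd ⟨x, h3, h2⟩) hyl hyi hal h1 hm2

/-- The boundaries of components that are not below the separating node are nested. -/
theorem bd_nested {R k k' : ℕ} {y : M.N} (hy : ∀ u, M.mem y u ↔ Q R u)
    (hs : Splits adj Q C R k) (hs' : Splits adj Q C R k')
    (hk : ∀ v x, C k v → M.mem x v → ¬ M.anc y x)
    (hk' : ∀ v x, C k' v → M.mem x v → ¬ M.anc y x) :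
    (∀ w, Bd adj (C k) w → Bd adj (C k') w) ∨ ∀ w, Bd adj (C k') w → Bd adj (C k) w := by
  by_contra! hno
  obtain ⟨⟨w, hw, hw'⟩, ⟨v, hv, hv'⟩⟩ := hno
  have up : ∀ {k w}, Splits adj Q C R k → (∀ v x, C k v → M.mem x v → ¬ M.anc y x) →
      Bd adj (C k) w → M.mem y w ∧ ∃ u x, C k u ∧ M.mem x u ∧ M.mem x w ∧ M.anc x y := by
    intro k w hs hk hw
    have hwy := (hy w).2 (hs.1 w hw)
    obtain ⟨-, u, hu, huw⟩ := hw
    obtain ⟨-, x, h1, h2⟩ := M.adj_iff.1 huw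
    refine ⟨hwy, u, x, hu, h1, h2, ?_⟩
    rcases M.total h2 hwy with h3 | h3
    · exact h3
    · exact absurd h3 (hk u x hu h1)
  have put : ∀ {k w u x}, Splits adj Q C R k → M.mem y w → C k u → M.mem x u → M.mem x w →
      Bd adj (C k) w := by
    intro k w u x hs hwy hu hxu hxw
    refine ⟨fun hw => hs.2 w hw ((hy w).1 hwy), u, hu, ?_⟩
    rcases M.eq_or_adj hxu hxw with h1 | h1
    · subst h1; exact absurd ((hy u).1 hwy) (hs.2 u hu)
    · exact h1
  obtain ⟨hwy, u, x, hu, hxu, hxw, hxy⟩ := up hs hk hw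
  obtain ⟨hvy, u', x', hu', hxu', hxv, hxy'⟩ := up hs' hk' hv
  rcases M.chain hxy hxy' with h1 | h1
  · exact hw' (put hs' hwy hu' hxu' (M.convex hxw hwy h1 hxy'))
  · exact hv' (put hs hvy hu hxu (M.convex hxv hvy h1 hxy))

/-- A clique that is a top node of block `b` is accepted as soon as all smaller blocks that have a
top node have been dealt with. -/
theorem exists_accept (h : Blocks n adj Q C) (hn : ∀ y : M.N, ∃ R < n, ∀ u, M.mem y u ↔ Q R u)
    (hcov : ∀ (y : M.N) (D : ℕ → Prop), Conn adj D → (∀ v, D v → v < n) → (∃ v, D v) →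
      (∀ v, D v → ¬ M.mem y v) → (∀ w, Bd adj D w → M.mem y w) → ∃ l < 2 * n, D = C l)
    {b : ℕ} {y : M.N} (hy : M.TopNode C y b) {top : ℕ → ℕ}
    (htop : ∀ l < 2 * n, ∀ y', M.TopNode C y' l → cnt n (C l) < cnt n (C b) → top l ≠ 0) :
    ∃ R < n, Accept n adj Q C top b R := by
  obtain ⟨R, hR, hyR⟩ := hn y
  obtain ⟨q, hqb, hqy⟩ := hy.meets
  refine ⟨R, hR, fun x hx => (hyR x).1 (hy.bd_mem x hx), fun x hx => hy.mem_bd x ((hyR x).2 hx),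
    ⟨q, (hyR q).1 hqy, hqb⟩, fun u hu hqu => ?_⟩
  -- the component of `u` is a block
  have huy : ¬ M.mem y u := fun h' => hqu ((hyR u).1 h')
  obtain ⟨l₀, hl₀, hs₀, hul₀⟩ : ∃ l < 2 * n, Splits adj Q C R l ∧ C l u := by
    have hDK : ∀ v, Reach adj (fun v => ¬ M.mem y v) u v → ¬ M.mem y v := fun v hv =>
      Reach.closed (C := fun v => ¬ M.mem y v) hv huy fun _ _ _ _ h' => h'
    have hcl : ∀ v w, Reach adj (fun v => ¬ M.mem y v) u v → adj v w → ¬ M.mem y w →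
      Reach adj (fun v => ¬ M.mem y v) u w := fun v w hv hvw hw =>
      Relation.ReflTransGen.tail hv ⟨hvw, hw⟩
    have hlt : ∀ v, Reach adj (fun v => ¬ M.mem y v) u v → v < n := fun v hv =>
      Reach.closed (C := fun v => v < n) hv (h.lt hu) fun _ _ _ h' _ => h.adj_lt h'
    have hbd : ∀ w, Bd adj (Reach adj (fun v => ¬ M.mem y v) u) w → M.mem y w := by
      intro w hw
      by_contra hw'
      obtain ⟨z, hz, hzw⟩ := hw.2
      exact hw.1 (hcl z w hz hzw hw')
    obtain ⟨l, hl, he⟩ := hcov y _ (Reach.conn h.symm) hlt ⟨u, .refl⟩ hDK hbd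
    refine ⟨l, hl, ⟨fun x hx => (hyR x).1 (hbd x ?_), fun x hx hx' => ?_⟩, he ▸ .refl⟩
    · rw [he]; exact hx
    · rw [← he] at hx
      exact hDK x hx ((hyR x).2 hx')
  have hc0 : compOf n adj Q C R u ≠ 0 := fun h0 => lastOf_eq_zero.1 h0 l₀ hl₀ ⟨hs₀, hul₀⟩
  obtain ⟨l, hl⟩ := Nat.exists_eq_succ_of_ne_zero hc0
  obtain ⟨hl2, hsl, hul⟩ := Blocks.compOf_spec hl
  -- components below `y` have top nodes below `y`
  have htn : ∀ {i}, i < 2 * n → Splits adj Q C R i → ∀ {v x}, C i v → M.mem x v → M.anc y x →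
      ∃ yi, M.TopNode C yi i ∧ M.anc y yi := by
    intro i hi hsi v x hv hxv hyx
    obtain ⟨t, ⟨v', hv', htv'⟩, hm⟩ := M.exists_top (h.conn hi) (fun _ => h.lt) ⟨v, hv⟩
    have hb := fun {v' x'} (h1 : C i v') (h2 : M.mem x' v') =>
      M.below_iff (h.conn hi) (fun w hw h' => hsi.2 w hw ((hyR w).1 h')) hv h1 hxv h2 hyx
    refine ⟨t, ⟨by omega, ⟨v', hv', htv'⟩, hm, fun w hw => ?_, fun w hw => ?_⟩, hb hv' htv'⟩
    · have hwy := (hyR w).2 (hsi.1 w hw)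
      obtain ⟨-, z, hz, hzw⟩ := hw
      obtain ⟨-, x', h1, h2⟩ := M.adj_iff.1 hzw
      exact M.convex hwy h2 (hb hv' htv') (hm z x' hz h1)
    · by_cases hw' : C i w
      · exact .inr hw'
      · refine .inl ⟨hw', v', hv', ?_⟩
        rcases M.eq_or_adj htv' hw with rfl | h1
        · exact absurd hv' hw'
        · exact h1
  obtain ⟨x₀, hx₀⟩ := M.nonempty (h.lt hu)
  obtain ⟨yl, hyl, hayl⟩ := htn hl2 hsl hul hx₀ (hy.below u x₀ hu hx₀)
  have hsub := h.splits_subset hl2 hsl (D := C b) (fun w hw => (hyR w).1 (hy.bd_mem w hw)) hul hu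
  have hlt : cnt n (C l) < cnt n (C b) :=
    cnt_lt (fun k _ hk => hsub k hk) (h.lt hqb) hqb fun h' => hsl.2 q h' ((hyR q).1 hqy)
  -- partners in a conflict are not below `y`
  have hup : ∀ {k}, k < 2 * n → Conflict adj Q C R l k →
      ∀ v x, C k v → M.mem x v → ¬ M.anc y x := by
    intro k hk hc v x hv hx hyx
    obtain ⟨yk, hyk, hayk⟩ := htn hk hc.1 hv hx hyx
    exact M.not_mixed_both h hyR hk hl2 hc.1 hsl hc.2.2.2 hyk hyl hayk hayl ⟨hc.2.1, hc.2.2.1⟩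
  rw [hl]
  rintro (h0 | h0 | ⟨k, hk, hc, x, hx, hx'⟩ | ⟨hp, x, hx, hxb⟩)
  · omega
  · exact htop l hl2 yl hyl hlt h0
  · rcases argMin_spec (Conflict adj Q C R l) (blockKey n adj C) (2 * n) with
      ⟨-, h4⟩ | ⟨m, hm, hm', hmc, hmin⟩
    · exact h4 k hk hc
    have hm1 : partner n adj Q C R l = m + 1 := hm'
    rw [Nat.succ_sub_one, hm1, Nat.add_sub_cancel] at hx'
    have hkey := hmin k hk hc
    rcases M.bd_nested hyR hc.1 hmc.1 (hup hk hc) (hup hm hmc) with h5 | h5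
    · exact hx' (h5 x hx)
    · have hb1 : ∀ p : Prop, ind p ≤ 1 := fun p => by unfold ind; split_ifs <;> omega
      unfold blockKey at hkey
      have h1 := hb1 (Mixed adj C k k)
      exact eq_of_cnt_le (φ := fun j => ¬ Bd adj (C k) j) (ψ := fun j => ¬ Bd adj (C m) j)
        (fun j _ hj hj' => hj (h5 j hj')) (by omega) (h.bd_lt hx) hx' hx
  · rw [Nat.succ_sub_one] at hp hx
    rcases argMin_spec (Conflict adj Q C R l) (blockKey n adj C) (2 * n) with
      ⟨h4, -⟩ | ⟨m, hm, hm', hmc, hmin⟩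
    · exact hp h4
    have hm1 : partner n adj Q C R l = m + 1 := hm'
    rw [hm1, Nat.add_sub_cancel] at hx
    obtain ⟨x', hx'⟩ := M.nonempty (h.lt hx)
    exact hup hm hmc x x' hx hx' (hy.below x x' hxb hx')

end RootedModel

/-! ### Counting subsets by state -/

open Classical in
/-- The number of sets `S ⊆ W` with `V S` and state `φ S = p`. -/
noncomputable def cntSets (W : Finset ℕ) (V : Finset ℕ → Prop) (φ : Finset ℕ → ℕ) (p : ℕ) : ℕ :=
  (W.powerset.filter fun S => V S ∧ φ S = p).card

theorem cntSets_congr {W W' : Finset ℕ} {V V' : Finset ℕ → Prop} {φ φ' : Finset ℕ → ℕ} {p p' : ℕ}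
    (hW : W = W') (h : ∀ S ⊆ W, (V S ∧ φ S = p) ↔ (V' S ∧ φ' S = p')) :
    cntSets W V φ p = cntSets W' V' φ' p' := by
  subst hW
  unfold cntSets
  congr 1
  ext S
  simp only [Finset.mem_filter, Finset.mem_powerset]
  exact and_congr_right fun hS => h S hS

open Classical in
theorem cntSets_eq_zero {W : Finset ℕ} {V : Finset ℕ → Prop} {φ : Finset ℕ → ℕ} {p : ℕ}
    (h : ∀ S ⊆ W, ¬ (V S ∧ φ S = p)) : cntSets W V φ p = 0 := by
  unfold cntSets
  rw [Finset.card_eq_zero, Finset.filter_eq_empty_iff]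
  intro S hS
  rw [Finset.mem_powerset] at hS
  exact h S hS

open Classical in
theorem cntSets_le (W : Finset ℕ) (V : Finset ℕ → Prop) (φ : Finset ℕ → ℕ) (p : ℕ) :
    cntSets W V φ p ≤ 2 ^ W.card := by
  unfold cntSets
  exact (Finset.card_filter_le _ _).trans (by rw [Finset.card_powerset])

open Classical in
/-- The partial sums of the numbers by state count the sets with a smaller state. -/
theorem sum_cntSets (W : Finset ℕ) (V : Finset ℕ → Prop) (φ : Finset ℕ → ℕ) (N : ℕ) :
    ∑ q ∈ Finset.range N, cntSets W V φ q = (W.powerset.filter fun S => V S ∧ φ S < N).card := by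
  rw [Finset.card_eq_sum_card_fiberwise (f := φ) (t := Finset.range N)]
  · refine Finset.sum_congr rfl fun q hq => ?_
    unfold cntSets
    congr 1
    ext S
    simp only [Finset.mem_filter, Finset.mem_range] at *
    constructor
    · rintro ⟨h1, h2, rfl⟩; exact ⟨⟨h1, h2, hq⟩, rfl⟩
    · rintro ⟨⟨h1, h2, _⟩, rfl⟩; exact ⟨h1, h2, rfl⟩
  · intro S hS
    simp only [Finset.coe_filter, Set.mem_ofPred_eq] at hS
    simpa using hS.2.2

theorem sum_cntSets_le (W : Finset ℕ) (V : Finset ℕ → Prop) (φ : Finset ℕ → ℕ) (N : ℕ) :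
    ∑ q ∈ Finset.range N, cntSets W V φ q ≤ 2 ^ W.card := by
  classical
  rw [sum_cntSets]
  exact (Finset.card_filter_le _ _).trans (by rw [Finset.card_powerset])

open Classical in
/-- If the state of a union is the maximum of the states of the parts, then the numbers of sets
with a given state are combined in this way. -/
theorem cntSets_union {W₁ W₂ : Finset ℕ} (hd : Disjoint W₁ W₂) {V V₁ V₂ : Finset ℕ → Prop}
    {φ φ₁ φ₂ : Finset ℕ → ℕ}
    (hV : ∀ S₁ ⊆ W₁, ∀ S₂ ⊆ W₂, V (S₁ ∪ S₂) ↔ V₁ S₁ ∧ V₂ S₂)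
    (hφ : ∀ S₁ ⊆ W₁, ∀ S₂ ⊆ W₂, φ (S₁ ∪ S₂) = max (φ₁ S₁) (φ₂ S₂)) (p : ℕ) :
    cntSets (W₁ ∪ W₂) V φ p = cntSets W₁ V₁ φ₁ p * ∑ q ∈ Finset.range (p + 1), cntSets W₂ V₂ φ₂ q +
      (∑ q ∈ Finset.range p, cntSets W₁ V₁ φ₁ q) * cntSets W₂ V₂ φ₂ p := by
  rw [sum_cntSets, sum_cntSets]
  unfold cntSets
  rw [← Finset.card_product, ← Finset.card_product, ← Finset.card_union_of_disjoint]
  · have hsplit : ∀ S₁ ⊆ W₁, ∀ S₂ ⊆ W₂, (S₁ ∪ S₂) ∩ W₁ = S₁ ∧ (S₁ ∪ S₂) ∩ W₂ = S₂ := by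
      intro S₁ h1 S₂ h2
      rw [Finset.disjoint_left] at hd
      constructor <;> ext x <;> simp only [Finset.mem_inter, Finset.mem_union]
      · exact ⟨fun h => h.1.elim id fun h' => absurd (h2 h') (hd h.2), fun h => ⟨.inl h, h1 h⟩⟩
      · exact ⟨fun h => h.1.elim (fun h' => absurd h.2 (hd (h1 h'))) id, fun h => ⟨.inr h, h2 h⟩⟩
    refine Finset.card_bij' (fun S _ => (S ∩ W₁, S ∩ W₂)) (fun P _ => P.1 ∪ P.2) ?_ ?_ ?_ ?_
    · intro S hS
      simp only [Finset.mem_filter, Finset.mem_powerset] at hS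
      have e : (S ∩ W₁) ∪ (S ∩ W₂) = S := by
        rw [← Finset.inter_union_distrib_left]
        exact Finset.inter_eq_left.2 hS.1
      have h1 := hV (S ∩ W₁) Finset.inter_subset_right (S ∩ W₂) Finset.inter_subset_right
      have h2 := hφ (S ∩ W₁) Finset.inter_subset_right (S ∩ W₂) Finset.inter_subset_right
      rw [e] at h1 h2
      have h3 := h1.1 hS.2.1
      simp only [Finset.mem_union, Finset.mem_product, Finset.mem_filter, Finset.mem_powerset,
        Finset.inter_subset_right, true_and, h3.1, h3.2]
      have := hS.2.2
      omega
    · rintro ⟨S₁, S₂⟩ hS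
      simp only [Finset.mem_union, Finset.mem_product, Finset.mem_filter,
        Finset.mem_powerset] at hS ⊢
      have h1 : S₁ ⊆ W₁ := by tauto
      have h2 : S₂ ⊆ W₂ := by tauto
      refine ⟨Finset.union_subset_union h1 h2, (hV _ h1 _ h2).2 (by tauto), ?_⟩
      rw [hφ _ h1 _ h2]
      omega
    · intro S hS
      simp only [Finset.mem_filter, Finset.mem_powerset] at hS
      rw [← Finset.inter_union_distrib_left]
      exact Finset.inter_eq_left.2 hS.1
    · rintro ⟨S₁, S₂⟩ hS
      simp only [Finset.mem_union, Finset.mem_product, Finset.mem_filter,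
        Finset.mem_powerset] at hS
      have h1 : S₁ ⊆ W₁ := by tauto
      have h2 : S₂ ⊆ W₂ := by tauto
      have := hsplit _ h1 _ h2
      simp [this.1, this.2]
  · rw [Finset.disjoint_left]
    rintro ⟨S₁, S₂⟩ h1 h2
    simp only [Finset.mem_product, Finset.mem_filter] at h1 h2
    omega

/-! ### The elimination forest of a tree order -/

/-- A graph on `1, …, n` whose natural order is a tree order; `par` is the parent function of the
forest in which the largest `j < x` that is equal or adjacent to a neighbour of `x` not above `j` is
the parent of `x` (or `0` if there is none), and `e w` is the largest element of the closed
neighbourhood of `w`. -/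
structure ElimForest (n : ℕ) (a : ℕ → ℕ → Prop) (par e : ℕ → ℕ) : Prop where
  symm : ∀ {u v}, a u v → a v u
  irrefl : ∀ {u}, ¬ a u u
  pos : ∀ {u v}, a u v → 1 ≤ v
  le : ∀ {u v}, a u v → v ≤ n
  order : ∀ {u x w l}, u < x → w ≤ u → l ≤ u → a x w → a x l → (w = u ∨ a w u) → l = u ∨ a l u
  par_zero : ∀ {x}, 1 ≤ x → x ≤ n → par x = 0 ∨
    (par x < x ∧ ∃ w ≤ par x, a x w ∧ (w = par x ∨ a w (par x)))
  le_par : ∀ {j x w}, j < x → w ≤ j → a x w → (w = j ∨ a w j) → j ≤ par x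
  e_eq : ∀ {w}, 1 ≤ w → w ≤ n → e w = w ∨ a w (e w)
  le_e : ∀ {w v}, 1 ≤ w → w ≤ n → (v = w ∨ a w v) → v ≤ e w

/-- The first ancestor of `v` that is at most `n - k`, with the numbers `n, n - 1, …` replaced by
their parents one after the other. -/
def climb (n : ℕ) (par : ℕ → ℕ) : ℕ → ℕ → ℕ
  | 0, v => v
  | k + 1, v => if climb n par k v = n - k then par (n - k) else climb n par k v

/-- `v` is in `S` or has a neighbour in `S`. -/
def Dominated (a : ℕ → ℕ → Prop) (S : Finset ℕ) (v : ℕ) : Prop := v ∈ S ∨ ∃ u ∈ S, a v u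

open Classical in
/-- The contribution of the vertex `w` to the state of `S`: the code `2n + 1 - w` of a chosen vertex,
the code `w` of a vertex that is not dominated, and `0` otherwise. -/
noncomputable def code (n : ℕ) (a : ℕ → ℕ → Prop) (S : Finset ℕ) (w : ℕ) : ℕ :=
  if w ∈ S then 2 * n + 1 - w else if Dominated a S w then 0 else w

/-- The state of `S` as seen by the vertices below `x`: the chosen vertex in `W` nearest to the root
if there is one, or else the undominated vertex in `W` farthest from the root. As the codes of chosen
vertices exceed those of undominated ones, both cases are given by a maximum. The maximum carries
enough information because `x` is adjacent to all vertices below `x` in its row, once it has its turn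
(`ElimForest.adj_of_climb`): `x` is undominated only if the state is the code `x`, and if `x` is the
first chosen vertex, then all vertices below `x` in the row are dominated. -/
noncomputable def state (n : ℕ) (a : ℕ → ℕ → Prop) (W : Finset ℕ) (x : ℕ) (S : Finset ℕ) : ℕ :=
  (W.filter (· < x)).sup (code n a S)

/-- The vertices whose last neighbour has been moved to row `y` after `k` steps. -/
def rowSet (n : ℕ) (par e : ℕ → ℕ) (k y : ℕ) : Finset ℕ :=
  (Finset.Icc 1 n).filter fun w => climb n par k (e w) = y

/-- The processed vertices of row `y` are dominated. -/
def RowValid (n : ℕ) (a : ℕ → ℕ → Prop) (par : ℕ → ℕ) (k y : ℕ) (S : Finset ℕ) : Prop :=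
  ∀ v, n - k < v → v ≤ n → climb n par k v = y → Dominated a S v

/-- The entry `p` of row `y` of the table after `k` steps. -/
noncomputable def rowCount (n : ℕ) (a : ℕ → ℕ → Prop) (par e : ℕ → ℕ) (k y p : ℕ) : ℕ :=
  cntSets (rowSet n par e k y) (RowValid n a par k y)
    (state n a (rowSet n par e k y) (n + 1 - k)) p

theorem code_mono {n : ℕ} {a : ℕ → ℕ → Prop} {S T : Finset ℕ} (hST : S ⊆ T) {w : ℕ}
    (hw : w ∈ T → w ∈ S) : code n a T w ≤ code n a S w := by
  unfold code Dominated
  by_cases h1 : w ∈ S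
  · simp [h1, hST h1]
  · have h2 : w ∉ T := fun h => h1 (hw h)
    simp only [h1, h2, if_false, false_or]
    by_cases h3 : ∃ u ∈ T, a w u
    · rw [if_pos (.inr h3)]; omega
    · rw [if_neg (not_or.2 ⟨h2, h3⟩), if_neg]
      rintro (h4 | ⟨u, hu, hu'⟩)
      · exact h1 h4
      · exact h3 ⟨u, hST hu, hu'⟩

theorem code_cases (n : ℕ) (a : ℕ → ℕ → Prop) (S : Finset ℕ) (w : ℕ) :
    (w ∈ S ∧ code n a S w = 2 * n + 1 - w) ∨ (w ∉ S ∧ Dominated a S w ∧ code n a S w = 0) ∨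
      (w ∉ S ∧ ¬ Dominated a S w ∧ code n a S w = w) := by
  unfold code
  by_cases h1 : w ∈ S <;> by_cases h2 : Dominated a S w <;> simp [h1, h2]

theorem state_cases (n : ℕ) (a : ℕ → ℕ → Prop) (W : Finset ℕ) (x : ℕ) (S : Finset ℕ) :
    state n a W x S = 0 ∨ ∃ w ∈ W, w < x ∧ state n a W x S = code n a S w := by
  unfold state
  rcases (W.filter (· < x)).eq_empty_or_nonempty with h | h
  · left; rw [h]; rfl
  · obtain ⟨w, hw, h'⟩ := Finset.exists_mem_eq_sup _ h (code n a S)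
    rw [Finset.mem_filter] at hw
    exact .inr ⟨w, hw.1, hw.2, h'⟩

theorem code_le_state {n : ℕ} {a : ℕ → ℕ → Prop} {W : Finset ℕ} {x : ℕ} {S : Finset ℕ} {w : ℕ}
    (hw : w ∈ W) (hx : w < x) : code n a S w ≤ state n a W x S :=
  Finset.le_sup (f := code n a S) (Finset.mem_filter.2 ⟨hw, hx⟩)

/-- The state of a union is the maximum of the states, provided that the vertices below `x` of one
part are dominated by the other part only through vertices below `x`. -/
theorem state_union {n : ℕ} {a : ℕ → ℕ → Prop} {W₁ W₂ S₁ S₂ : Finset ℕ} {x : ℕ}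
    (hd : Disjoint W₁ W₂) (h₁ : S₁ ⊆ W₁) (h₂ : S₂ ⊆ W₂) (hn : ∀ w ∈ W₁ ∪ W₂, w ≤ n)
    (h₁₂ : ∀ w ∈ W₁, w < x → ∀ u ∈ W₂, x ≤ u → ¬ a w u)
    (h₂₁ : ∀ w ∈ W₂, w < x → ∀ u ∈ W₁, x ≤ u → ¬ a w u) :
    state n a (W₁ ∪ W₂) x (S₁ ∪ S₂) = max (state n a W₁ x S₁) (state n a W₂ x S₂) := by
  rw [Finset.disjoint_left] at hd
  have m1 : ∀ w ∈ W₁, w ∈ S₁ ∪ S₂ → w ∈ S₁ := fun w hw h =>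
    (Finset.mem_union.1 h).elim id fun h => absurd (h₂ h) (hd hw)
  have m2 : ∀ w ∈ W₂, w ∈ S₁ ∪ S₂ → w ∈ S₂ := fun w hw h =>
    (Finset.mem_union.1 h).elim (fun h => absurd hw (hd (h₁ h))) id
  refine le_antisymm ?_ ?_
  · refine Finset.sup_le fun w hw => ?_
    rw [Finset.mem_filter, Finset.mem_union] at hw
    rcases hw.1 with h | h
    · exact (code_mono Finset.subset_union_left (m1 w h)).trans
        ((code_le_state h hw.2).trans (le_max_left _ _))
    · exact (code_mono Finset.subset_union_right (m2 w h)).trans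
        ((code_le_state h hw.2).trans (le_max_right _ _))
  · -- a chosen vertex keeps its code, so that it suffices to consider states without one
    have chosen : ∀ s ∈ S₁ ∪ S₂, s < x → n < state n a (W₁ ∪ W₂) x (S₁ ∪ S₂) := by
      intro s hs hsx
      have hsW : s ∈ W₁ ∪ W₂ := Finset.union_subset_union h₁ h₂ hs
      have h3 := code_le_state (n := n) (a := a) (S := S₁ ∪ S₂) hsW hsx
      have h4 := hn s hsW
      unfold code at h3
      rw [if_pos hs] at h3
      omega
    have part : ∀ {W S W' S' : Finset ℕ}, W ⊆ W₁ ∪ W₂ → S ⊆ S₁ ∪ S₂ → S₁ ∪ S₂ ⊆ S ∪ S' →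
        S' ⊆ W' → (∀ w ∈ W, w ∈ S₁ ∪ S₂ → w ∈ S) → (∀ w ∈ W, w < x → ∀ u ∈ W', x ≤ u → ¬ a w u) →
        state n a W x S ≤ state n a (W₁ ∪ W₂) x (S₁ ∪ S₂) := by
      intro W S W' S' hW hS hS' hW' hm ha
      rcases state_cases n a W x S with h | ⟨w, hw, hwx, h⟩
      · omega
      rw [h]
      have hle := code_le_state (n := n) (a := a) (S := S₁ ∪ S₂) (hW hw) hwx
      rcases code_cases n a S w with ⟨h1, h2⟩ | ⟨-, -, h2⟩ | ⟨h1, h1', h2⟩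
      · rw [code, if_pos (hS h1)] at hle
        omega
      · omega
      rw [h2]
      have hwU : w ∉ S₁ ∪ S₂ := fun h' => h1 (hm w hw h')
      by_cases hD : Dominated a (S₁ ∪ S₂) w
      · rcases hD with hD | ⟨u, hu, hwu⟩
        · exact absurd hD hwU
        rcases Finset.mem_union.1 (hS' hu) with h3 | h3
        · exact absurd (.inr ⟨u, h3, hwu⟩) h1'
        · have h4 : u < x := by
            by_contra h4
            exact ha w hw hwx u (hW' h3) (by omega) hwu
          have := chosen u hu h4
          have := hn w (hW hw)
          omega
      · rw [code, if_neg hwU, if_neg hD] at hle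
        exact hle
    refine max_le (part (W' := W₂) Finset.subset_union_left Finset.subset_union_left
        le_rfl h₂ m1 h₁₂)
      (part (W' := W₁) Finset.subset_union_right Finset.subset_union_right
        (Finset.union_comm S₁ S₂).le h₁ m2 h₂₁)

namespace ElimForest

variable {n : ℕ} {a : ℕ → ℕ → Prop} {par e : ℕ → ℕ} (h : ElimForest n a par e)

include h

theorem par_lt {x : ℕ} (h1 : 1 ≤ x) (h2 : x ≤ n) : par x < x := by
  rcases h.par_zero h1 h2 with h3 | h3
  · omega
  · exact h3.1

theorem w_le_e {w : ℕ} (h1 : 1 ≤ w) (h2 : w ≤ n) : w ≤ e w := h.le_e h1 h2 (.inl rfl)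

theorem e_le {w : ℕ} (h1 : 1 ≤ w) (h2 : w ≤ n) : e w ≤ n := by
  rcases h.e_eq h1 h2 with h3 | h3
  · omega
  · exact h.le h3

omit h in
theorem climb_of_le {k v : ℕ} (hk : k ≤ n) (hv : v ≤ n - k) : climb n par k v = v := by
  induction k with
  | zero => rfl
  | succ k ih =>
    rw [climb, ih (by omega) (by omega), if_neg (by omega)]

theorem climb_le {k v : ℕ} (hk : k ≤ n) (hv : v ≤ n) : climb n par k v ≤ n - k := by
  induction k with
  | zero => simpa [climb] using hv
  | succ k ih =>
    rw [climb]
    have := ih (by omega)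
    split_ifs with h1
    · have := h.par_lt (x := n - k) (by omega) (by omega)
      omega
    · omega

/-- A processed vertex and its parent have been moved to the same row. -/
theorem climb_par {k v : ℕ} (hk : k ≤ n) (h1 : n - k < v) (h2 : v ≤ n) :
    climb n par k v = climb n par k (par v) := by
  induction k with
  | zero => omega
  | succ k ih =>
    rw [climb, climb]
    rcases (show n - k ≤ v by omega).eq_or_lt with e | e
    · have h3 := h.par_lt (x := v) (by omega) h2
      rw [climb_of_le (k := k) (v := v) (by omega) (by omega),
          climb_of_le (k := k) (v := par v) (by omega) (by omega)]
      rw [if_pos e.symm, if_neg (by omega), e]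
    · rw [ih (by omega) e]

/-- The neighbours of `w` above `w` lie on one branch. -/
theorem climb_nbr {k w v v' : ℕ} (hk : k ≤ n) (hw : 1 ≤ w) (hv : w = v ∨ a v w)
    (hv' : w = v' ∨ a v' w)
    (h1 : w ≤ v) (h2 : v ≤ v') (hn : v' ≤ n) (h3 : n - k ≤ v) :
    climb n par k v' = climb n par k v := by
  induction hd : v' using Nat.strong_induction_on generalizing v' with
  | _ m ih =>
    subst hd
    rcases h2.eq_or_lt with e | e
    · rw [e]
    have haw : a v' w := hv'.resolve_left (by omega)
    have hvw : w = v ∨ a w v := hv.imp id h.symm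
    have hle := h.le_par e h1 haw hvw
    have hlt := h.par_lt (x := v') (by omega) hn
    rw [h.climb_par hk (by omega) hn]
    refine ih _ hlt ?_ hle (by omega) rfl
    rcases h.par_zero (x := v') (by omega) hn with h4 | ⟨-, w', hw', h5, h6⟩
    · omega
    · exact (h.order hlt hw' (by omega) h5 haw h6).imp id h.symm

/-- All neighbours of a processed vertex are stored in its row. -/
theorem climb_e {k v w : ℕ} (hk : k ≤ n) (hw : 1 ≤ w) (hwn : w ≤ n) (hv : w = v ∨ a v w)
    (h1 : 1 ≤ v)
    (h3 : n - k ≤ v) : climb n par k (e w) = climb n par k v := by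
  have hself : ∀ {w}, 1 ≤ w → w ≤ n → w = e w ∨ a (e w) w := fun h1 h2 =>
    (h.e_eq h1 h2).imp Eq.symm h.symm
  rcases le_total w v with h4 | h4
  · refine h.climb_nbr hk hw hv (hself hw hwn) h4 (h.le_e hw hwn ?_) (h.e_le hw hwn) h3
    exact hv.imp Eq.symm h.symm
  · rw [h.climb_nbr hk hw (.inl rfl) (hself hw hwn) le_rfl (h.w_le_e hw hwn) (h.e_le hw hwn)
      (by omega)]
    exact h.climb_nbr hk h1 (.inl rfl) (hv.imp Eq.symm h.symm) le_rfl h4 hwn h3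

/-- The vertices below `x` that are stored in the row of `x` when `x` is processed are neighbours
of `x`. -/
theorem adj_of_climb {k w v : ℕ} (hk : k < n) (hw : 1 ≤ w) (hwx : w < n - k) (hv : w = v ∨ a v w)
    (hwv : w ≤ v) (hn : v ≤ n) (hc : climb n par k v = n - k) : a w (n - k) := by
  induction hd : v using Nat.strong_induction_on generalizing v with
  | _ m ih =>
    subst hd
    rcases le_or_gt v (n - k) with h1 | h1
    · rw [climb_of_le hk.le h1] at hc
      subst hc
      exact h.symm (hv.resolve_left (by omega))
    have haw : a v w := hv.resolve_left (by omega)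
    have hlt := h.par_lt (x := v) (by omega) hn
    have hle := h.le_par (j := w) (x := v) (by omega) le_rfl haw (.inl rfl)
    rw [h.climb_par hk.le h1 hn] at hc
    refine ih _ hlt ?_ hle (by omega) hc rfl
    rcases h.par_zero (x := v) (by omega) hn with h4 | ⟨-, w', hw', h5, h6⟩
    · omega
    · exact (h.order hlt hw' hle h5 haw h6).imp id h.symm

/-! ### The steps of the dynamic program -/

omit h in
theorem mem_rowSet {k y w : ℕ} :
    w ∈ rowSet n par e k y ↔ (1 ≤ w ∧ w ≤ n) ∧ climb n par k (e w) = y := by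
  simp [rowSet]

omit h in
theorem rowSet_disjoint {k y y' : ℕ} (hy : y ≠ y') :
    Disjoint (rowSet n par e k y) (rowSet n par e k y') := by
  rw [Finset.disjoint_left]
  intro w h1 h2
  rw [mem_rowSet] at h1 h2
  exact hy (h1.2.symm.trans h2.2)

omit h in
/-- Step `k` moves the contents of row `n - k` to the row of the parent of `n - k`. -/
theorem rowSet_succ {k y : ℕ} (hy : y ≠ n - k) : rowSet n par e (k + 1) y =
    if y = par (n - k) then rowSet n par e k (n - k) ∪ rowSet n par e k y
    else rowSet n par e k y := by
  ext w
  rw [mem_rowSet, climb]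
  split_ifs with h1 h2 h2
  · simp only [Finset.mem_union, mem_rowSet]
    subst h2
    tauto
  · rw [mem_rowSet, h1]
    exact and_congr_right fun _ => ⟨fun h3 => absurd h3.symm h2, fun h3 => absurd h3.symm hy⟩
  · simp only [Finset.mem_union, mem_rowSet]
    tauto
  · rw [mem_rowSet]

/-- Whether a processed vertex is dominated only depends on its row. -/
theorem dominated_inter {k v y : ℕ} (hk : k ≤ n) (h1 : 1 ≤ v) (hn : v ≤ n) (h3 : n - k ≤ v)
    (hy : climb n par k v = y) {S T : Finset ℕ} (hST : T ⊆ S)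
    (hT : ∀ w ∈ S, w ∈ rowSet n par e k y → w ∈ T) : Dominated a S v ↔ Dominated a T v := by
  have key : ∀ w ∈ S, (w = v ∨ a v w) → w ∈ T := by
    intro w hw hv
    have h4 : 1 ≤ w ∧ w ≤ n := by
      rcases hv with rfl | hv
      · exact ⟨h1, hn⟩
      · exact ⟨h.pos hv, h.le hv⟩
    exact hT w hw (mem_rowSet.2 ⟨h4, (h.climb_e hk h4.1 h4.2 hv h1 h3).trans hy⟩)
  constructor
  · rintro (h4 | ⟨u, hu, h4⟩)
    · exact .inl (key v h4 (.inl rfl))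
    · exact .inr ⟨u, key u hu (.inr h4), h4⟩
  · rintro (h4 | ⟨u, hu, h4⟩)
    · exact .inl (hST h4)
    · exact .inr ⟨u, hST hu, h4⟩

/-- Closing row `x = n - k`: the state code of `x` itself tells whether `x` is dominated. -/
theorem close_iff {k : ℕ} (hk : k < n) (S : Finset ℕ) (p : ℕ) :
    (Dominated a S (n - k) ∧ state n a (rowSet n par e k (n - k)) (n - k) S = p) ↔
      (p = 0 ∧ (state n a (rowSet n par e k (n - k)) (n + 1 - k) S = 0 ∨
        state n a (rowSet n par e k (n - k)) (n + 1 - k) S = 2 * n + 1 - (n - k))) ∨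
      (p ≠ 0 ∧ p ≠ n - k ∧ p ≠ 2 * n + 1 - (n - k) ∧
        state n a (rowSet n par e k (n - k)) (n + 1 - k) S = p) := by
  set x := n - k with hx
  set W := rowSet n par e k x with hW
  have hxW : x ∈ W := by
    rw [hW, mem_rowSet, h.climb_e hk.le (v := x) (by omega) (by omega) (.inl rfl) (by omega)
      (by omega), climb_of_le hk.le (by omega)]
    exact ⟨by omega, rfl⟩
  have hadj : ∀ w ∈ W, w < x → a w x := by
    intro w hw hwx
    rw [mem_rowSet] at hw
    exact h.adj_of_climb hk hw.1.1 hwx ((h.e_eq hw.1.1 hw.1.2).imp Eq.symm h.symm)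
      (h.w_le_e hw.1.1 hw.1.2) (h.e_le hw.1.1 hw.1.2) hw.2
  have hmax : state n a W (n + 1 - k) S = max (code n a S x) (state n a W x S) := by
    have : W.filter (· < n + 1 - k) = insert x (W.filter (· < x)) := by
      ext w
      simp only [Finset.mem_filter, Finset.mem_insert]
      constructor
      · intro hw
        by_cases h1 : w = x
        · exact .inl h1
        · exact .inr ⟨hw.1, by omega⟩
      · rintro (rfl | hw)
        · exact ⟨hxW, by omega⟩
        · exact ⟨hw.1, by omega⟩
    rw [state, this, Finset.sup_insert]
    rfl
  have hval : state n a W x S = 0 ∨ (state n a W x S < x ∧ 0 < state n a W x S) ∨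
      (2 * n + 1 - x < state n a W x S ∧ ∃ w ∈ S, w ∈ W ∧ w < x) := by
    rcases state_cases n a W x S with h1 | ⟨w, hw, hwx, h1⟩
    · exact .inl h1
    · have := (mem_rowSet.1 hw).1
      rcases code_cases n a S w with ⟨h2, h3⟩ | ⟨-, -, h3⟩ | ⟨-, -, h3⟩
      · exact .inr (.inr ⟨by omega, w, h2, hw, hwx⟩)
      · exact .inl (by omega)
      · exact .inr (.inl (by omega))
  rw [hmax]
  rcases code_cases n a S x with ⟨h1, h2⟩ | ⟨h1, h1', h2⟩ | ⟨h1, h1', h2⟩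
  · have hD : Dominated a S x := .inl h1
    have hz : state n a W x S = 0 ∨ 2 * n + 1 - x < state n a W x S := by
      rcases state_cases n a W x S with h3 | ⟨w, hw, hwx, h3⟩
      · exact .inl h3
      · have := (mem_rowSet.1 hw).1
        rcases code_cases n a S w with ⟨h4, h5⟩ | ⟨-, -, h5⟩ | ⟨-, h4, -⟩
        · exact .inr (by omega)
        · exact .inl (by omega)
        · exact absurd (.inr ⟨x, h1, hadj w hw hwx⟩) h4
    simp only [hD, true_and, h2]
    clear hval
    omega
  · have hz : state n a W x S = 0 ∨ (state n a W x S < x ∧ 0 < state n a W x S) ∨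
        2 * n + 1 - x < state n a W x S := hval.imp id (Or.imp id And.left)
    clear hval
    simp only [h1', true_and, h2]
    omega
  · have hz : state n a W x S < x := by
      rcases hval with h3 | h3 | ⟨-, w, hwS, hw, hwx⟩
      · omega
      · exact h3.1
      · exact absurd (.inr ⟨w, hwS, h.symm (hadj w hw hwx)⟩) h1'
    clear hval
    simp only [h1', false_and, h2, false_iff]
    omega

open Classical in
/-- The entries of row `x = n - k` after it has been closed. -/
theorem cntSets_close {k : ℕ} (hk : k < n) (p : ℕ) :
    cntSets (rowSet n par e k (n - k))
      (fun S => RowValid n a par k (n - k) S ∧ Dominated a S (n - k))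
      (state n a (rowSet n par e k (n - k)) (n - k)) p =
    if p = 0 then rowCount n a par e k (n - k) 0 +
        rowCount n a par e k (n - k) (2 * n + 1 - (n - k))
      else if p = n - k ∨ p = 2 * n + 1 - (n - k) then 0
      else rowCount n a par e k (n - k) p := by
  split_ifs with h1 h2
  · subst h1
    unfold rowCount cntSets
    rw [← Finset.card_union_of_disjoint]
    · congr 1
      ext S
      simp only [Finset.mem_filter, Finset.mem_union, Finset.mem_powerset]
      rw [← and_or_left]
      refine and_congr_right fun hS => ?_
      have := h.close_iff hk S 0
      tauto
    · rw [Finset.disjoint_left]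
      simp only [Finset.mem_filter]
      intro S h3 h4
      omega
  · refine cntSets_eq_zero fun S _ hS' => ?_
    have := (h.close_iff hk S p).1 ⟨hS'.1.2, hS'.2⟩
    omega
  · refine cntSets_congr rfl fun S hS => ?_
    have := h.close_iff hk S p
    push Not at h2
    constructor
    · rintro ⟨⟨h3, h4⟩, h5⟩
      have := this.1 ⟨h4, h5⟩
      exact ⟨h3, by tauto⟩
    · rintro ⟨h3, h5⟩
      have := this.2 (.inr ⟨h1, h2.1, h2.2, h5⟩)
      exact ⟨⟨h3, this.1⟩, this.2⟩

/-- In a row other than that of `x = n - k`, the state does not depend on whether `x` itself is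
seen: `x` is not stored in that row. -/
theorem state_succ {k y : ℕ} (hk : k < n) (hy : y ≠ n - k) (S : Finset ℕ) :
    state n a (rowSet n par e k y) (n + 1 - k) S = state n a (rowSet n par e k y) (n - k) S := by
  unfold state
  congr 1
  refine Finset.filter_congr fun w hw => ?_
  rw [mem_rowSet] at hw
  constructor
  · intro h1
    refine lt_of_le_of_ne (by omega) fun h2 => hy ?_
    rw [← hw.2, h.climb_e hk.le hw.1.1 hw.1.2 (.inl h2) (by omega) (by omega),
      climb_of_le hk.le le_rfl]
  · intro h1; omega

/-- Rows other than that of the parent do not change. -/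
theorem rowCount_succ_of_ne {k y : ℕ} (hk : k < n) (hy : y ≠ n - k)
    (hy' : y ≠ par (n - k)) (p : ℕ) :
    rowCount n a par e (k + 1) y p = rowCount n a par e k y p := by
  unfold rowCount
  refine cntSets_congr (by rw [rowSet_succ hy, if_neg hy']) fun S hS => ?_
  rw [rowSet_succ hy, if_neg hy', h.state_succ hk hy, Nat.succ_sub_succ_eq_sub]
  refine and_congr_left fun _ => ?_
  constructor
  · intro h1 v h2 h3 h4
    refine h1 v (by omega) h3 ?_
    rw [climb, if_neg (by omega), h4]
  · intro h1 v h2 h3 h4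
    rw [climb] at h4
    split_ifs at h4 with h5
    · exact absurd h4.symm hy'
    · refine h1 v ?_ h3 h4
      refine lt_of_le_of_ne (by omega) fun h6 => h5 ?_
      rw [← h6, climb_of_le hk.le le_rfl]

/-- The closed row of `x = n - k` is merged into the row of the parent of `x`. -/
theorem rowCount_succ {k : ℕ} (hk : k < n) (p : ℕ) {X : ℕ → ℕ}
    (hX : ∀ q, X q = cntSets (rowSet n par e k (n - k))
      (fun S => RowValid n a par k (n - k) S ∧ Dominated a S (n - k))
      (state n a (rowSet n par e k (n - k)) (n - k)) q) :
    rowCount n a par e (k + 1) (par (n - k)) p =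
      X p * ∑ q ∈ Finset.range (p + 1), rowCount n a par e k (par (n - k)) q +
      (∑ q ∈ Finset.range p, X q) * rowCount n a par e k (par (n - k)) p := by
  have hpl := h.par_lt (x := n - k) (by omega) (by omega)
  have hy : par (n - k) ≠ n - k := by omega
  simp only [hX]
  have hd := rowSet_disjoint (n := n) (par := par) (e := e) (k := k) hy.symm
  have hW := rowSet_succ (par := par) (e := e) hy
  rw [if_pos rfl] at hW
  unfold rowCount
  rw [hW]
  have hcross : ∀ {y y'}, y ≠ y' → ∀ w ∈ rowSet n par e k y, w < n - k →
      ∀ u ∈ rowSet n par e k y', n - k ≤ u → ¬ a w u := by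
    intro y y' hyy w hw hwx u hu hxu hwu
    rw [mem_rowSet] at hw hu
    refine hyy ?_
    rw [← hw.2, ← hu.2, h.climb_e hk.le hw.1.1 hw.1.2 (.inr (h.symm hwu)) hu.1.1 hxu,
      h.climb_e hk.le hu.1.1 hu.1.2 (.inl rfl) hu.1.1 hxu]
  refine cntSets_union hd (fun S₁ h1 S₂ h2 => ?_) (fun S₁ h1 S₂ h2 => ?_) p
  · have hd' := Finset.disjoint_left.1 hd
    have e1 : ∀ {v}, n - k ≤ v → v ≤ n → climb n par k v = n - k →
        (Dominated a (S₁ ∪ S₂) v ↔ Dominated a S₁ v) := fun h3 h4 h5 =>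
      h.dominated_inter hk.le (by omega) h4 h3 h5 Finset.subset_union_left fun w hw hw' =>
        (Finset.mem_union.1 hw).elim id fun h6 => absurd (h2 h6) (hd' hw')
    have e2 : ∀ {v}, n - k ≤ v → v ≤ n → climb n par k v = par (n - k) →
        (Dominated a (S₁ ∪ S₂) v ↔ Dominated a S₂ v) := fun h3 h4 h5 =>
      h.dominated_inter hk.le (by omega) h4 h3 h5 Finset.subset_union_right fun w hw hw' =>
        (Finset.mem_union.1 hw).elim (fun h6 => absurd hw' (hd' (h1 h6))) id
    have hx : climb n par k (n - k) = n - k := climb_of_le hk.le le_rfl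
    constructor
    · intro hv
      refine ⟨⟨fun v h3 h4 h5 => ?_, ?_⟩, fun v h3 h4 h5 => ?_⟩
      · rw [← e1 h3.le h4 h5]
        exact hv v (by omega) h4 (by rw [climb, if_pos h5])
      · rw [← e1 le_rfl (by omega) hx]
        exact hv _ (by omega) (by omega) (by rw [climb, if_pos hx])
      · rw [← e2 h3.le h4 h5]
        exact hv v (by omega) h4 (by rw [climb, if_neg (by omega), h5])
    · rintro ⟨⟨h3, h4⟩, h5⟩ v h6 h7 h8
      rw [climb] at h8
      split_ifs at h8 with h9
      · rw [e1 (by omega) h7 h9]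
        rcases (show n - k ≤ v by omega).eq_or_lt with h10 | h10
        · rwa [← h10]
        · exact h3 v h10 h7 h9
      · rw [e2 (by omega) h7 h8]
        refine h5 v (lt_of_le_of_ne (by omega) fun h10 => h9 ?_) h7 h8
        rw [← h10, hx]
  · rw [h.state_succ hk hy, Nat.succ_sub_succ_eq_sub]
    refine state_union hd h1 h2 (fun w hw => ?_) (hcross hy.symm) (hcross hy)
    rw [Finset.mem_union, mem_rowSet, mem_rowSet] at hw
    tauto

omit h in
/-- Before the first step, the vertices are added to their rows one by one. -/
theorem cntSets_insert {W : Finset ℕ} (hW : ∀ w ∈ W, w ≤ n) {w : ℕ} (hw : w ∉ W) (h1 : 1 ≤ w)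
    (hn : w ≤ n) {X : ℕ → ℕ} (hX : ∀ p, X p = if p = w ∨ p = 2 * n + 1 - w then 1 else 0) (p : ℕ) :
    cntSets ({w} ∪ W) (fun _ => True) (state n a ({w} ∪ W) (n + 1)) p =
      X p * ∑ q ∈ Finset.range (p + 1), cntSets W (fun _ => True) (state n a W (n + 1)) q +
      (∑ q ∈ Finset.range p, X q) * cntSets W (fun _ => True) (state n a W (n + 1)) p := by
  classical
  have hX' : ∀ p, X p = cntSets {w} (fun _ => True) (state n a {w} (n + 1)) p := by
    intro p
    have e0 : state n a {w} (n + 1) ∅ = w := by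
      simp [state, Finset.filter_singleton, hn, code, Dominated]
    have e1 : state n a {w} (n + 1) {w} = 2 * n + 1 - w := by
      simp [state, Finset.filter_singleton, hn, code]
    rw [hX, cntSets]
    have : ({w} : Finset ℕ).powerset = {∅, {w}} := by
      ext S; simp [Finset.subset_singleton_iff]
    rw [this, Finset.filter_insert, Finset.filter_singleton, e0, e1]
    by_cases h2 : w = p
    · have h3 : ¬ (2 * n + 1 - w = p) := by omega
      simp [h2, show ¬ (2 * n + 1 - p = p) by omega]
    · by_cases h3 : 2 * n + 1 - w = p
      · simp [h2, h3]
      · simp [h2, h3, Ne.symm h2, Ne.symm h3]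
  simp only [hX']
  refine cntSets_union (by simpa using hw) (by simp) (fun S₁ h1 S₂ h2 => ?_) p
  refine state_union (by simpa using hw) h1 h2 ?_ ?_ ?_
  · intro v hv
    rcases Finset.mem_union.1 hv with hv | hv
    · rw [Finset.mem_singleton] at hv; omega
    · exact hW v hv
  · intro v _ hv u hu huv
    have := hW u hu
    omega
  · intro v _ hv u hu huv
    rw [Finset.mem_singleton] at hu
    omega

omit h in
theorem rowCount_zero (y p : ℕ) : rowCount n a par e 0 y p =
    cntSets ((Finset.Icc 1 n).filter fun w => e w = y) (fun _ => True)
      (state n a ((Finset.Icc 1 n).filter fun w => e w = y) (n + 1)) p := by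
  refine cntSets_congr rfl fun S _ => and_congr_left fun _ => ?_
  simp only [iff_true]
  intro v h1 h2
  omega

/-- After the last step row `0` counts the dominating sets. -/
theorem rowCount_final : rowCount n a par e n 0 0 =
    cntSets (Finset.Icc 1 n) (fun S => ∀ v ∈ Finset.Icc 1 n, Dominated a S v) (fun _ => 0) 0 := by
  have hW : rowSet n par e n 0 = Finset.Icc 1 n := by
    ext w
    rw [mem_rowSet, Finset.mem_Icc, and_iff_left_iff_imp]
    intro hw
    have := h.climb_le (k := n) le_rfl (h.e_le hw.1 hw.2)
    omega
  refine cntSets_congr hW fun S _ => ?_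
  have : state n a (rowSet n par e n 0) (n + 1 - n) S = 0 := by
    rcases state_cases n a (rowSet n par e n 0) (n + 1 - n) S with h1 | ⟨w, hw, hwx, -⟩
    · exact h1
    · have := (mem_rowSet.1 hw).1
      omega
  rw [this]
  refine and_congr_left fun _ => ⟨fun h1 v hv => ?_, fun h1 v h2 h3 _ => ?_⟩
  · rw [Finset.mem_Icc] at hv
    have := h.climb_le (k := n) le_rfl hv.2
    exact h1 v (by omega) hv.2 (by omega)
  · exact h1 v (Finset.mem_Icc.2 ⟨by omega, h3⟩)

end ElimForest

/-! ### From a tree order to the number of dominating sets -/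

theorem le_lastOf {φ : ℕ → Prop} {k K : ℕ} (hk : k < K) (h : φ k) : k + 1 ≤ lastOf φ K := by
  induction K with
  | zero => omega
  | succ K ih =>
    rw [lastOf]
    split_ifs with h1
    · omega
    · rcases Nat.lt_succ_iff_lt_or_eq.1 hk with h2 | rfl
      · exact ih h2
      · exact absurd h h1

/-- The parent of position `p`, as a label in `1, …, n`, or `0`. -/
noncomputable def parentOf (n : ℕ) (B : ℕ → ℕ → Prop) (p : ℕ) : ℕ :=
  lastOf (fun q => q < p ∧ ∃ w < n, w ≤ q ∧ B p w ∧ (w = q ∨ B w q)) n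

/-- The label of the last position in the closed neighbourhood of position `p`. -/
noncomputable def lastNbr (n : ℕ) (B : ℕ → ℕ → Prop) (p : ℕ) : ℕ :=
  lastOf (fun v => v = p ∨ B p v) n

/-- The graph `B` on the positions `0, …, n - 1`, with the positions relabelled by `1, …, n`. -/
def labelAdj (B : ℕ → ℕ → Prop) (x w : ℕ) : Prop := 1 ≤ x ∧ 1 ≤ w ∧ B (x - 1) (w - 1)

/-- If the natural order of the positions is a tree order, then the parents and last neighbours
read off from the graph make it an elimination forest. -/
theorem elimForest_of_order {n : ℕ} {B : ℕ → ℕ → Prop} (symm : ∀ {u v}, B u v → B v u)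
    (irrefl : ∀ {u}, ¬ B u u) (lt : ∀ {u v}, B u v → v < n)
    (order : ∀ {u x w l}, u < x → w ≤ u → l ≤ u → B x w → B x l → (w = u ∨ B w u) →
      l = u ∨ B l u) :
    ElimForest n (labelAdj B) (fun x => parentOf n B (x - 1)) (fun w => lastNbr n B (w - 1)) where
  symm := fun ⟨h1, h2, h3⟩ => ⟨h2, h1, symm h3⟩
  irrefl := fun ⟨_, _, h⟩ => irrefl h
  pos := fun h => h.2.1
  le := fun ⟨_, h2, h3⟩ => by have := lt h3; omega
  order := by
    rintro u x w l hux hwu hlu ⟨h1, h2, h3⟩ ⟨h1', h2', h3'⟩ h4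
    have := order (u := u - 1) (x := x - 1) (w := w - 1) (l := l - 1) (by omega) (by omega)
      (by omega) h3 h3' (h4.imp (by omega) fun h => h.2.2)
    exact this.imp (by omega) fun h => ⟨h2', by omega, h⟩
  par_zero := by
    intro x h1 h2
    rcases Nat.eq_zero_or_eq_succ_pred (parentOf n B (x - 1)) with h | h
    · exact .inl h
    right
    obtain ⟨-, h3, w, -, h4, h5, h6⟩ := lastOf_eq_succ h
    set q := (parentOf n B (x - 1)).pred
    refine ⟨by omega, w + 1, by omega, ⟨h1, by omega, h5⟩, ?_⟩
    rw [h]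
    exact h6.imp (by omega) fun h => ⟨by omega, by omega, h⟩
  le_par := by
    rintro j x w hjx hwj ⟨h1, h2, h3⟩ h4
    have hx := lt (symm h3)
    have := le_lastOf (φ := fun q => q < x - 1 ∧ ∃ w < n, w ≤ q ∧ B (x - 1) w ∧ (w = q ∨ B w q))
      (k := j - 1) (K := n) (by omega) ⟨by omega, w - 1, by omega, by omega, h3,
        h4.imp (by omega) fun h => h.2.2⟩
    unfold parentOf
    omega
  e_eq := by
    intro w h1 h2
    have h3 := le_lastOf (φ := fun v => v = w - 1 ∨ B (w - 1) v) (k := w - 1) (K := n) (by omega)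
      (.inl rfl)
    obtain ⟨v, hv⟩ : ∃ v, lastNbr n B (w - 1) = v + 1 := ⟨lastNbr n B (w - 1) - 1, by
      unfold lastNbr; omega⟩
    obtain ⟨-, h4⟩ := lastOf_eq_succ hv
    rw [hv]
    exact h4.imp (by omega) fun h => ⟨h1, by omega, h⟩
  le_e := by
    rintro w v h1 h2 (rfl | ⟨-, h3, h4⟩)
    · have := le_lastOf (φ := fun u => u = v - 1 ∨ B (v - 1) u) (k := v - 1) (K := n) (by omega)
        (.inl rfl)
      unfold lastNbr
      omega
    · have := le_lastOf (φ := fun u => u = w - 1 ∨ B (w - 1) u) (k := v - 1) (K := n) (lt h4)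
        (.inr h4)
      unfold lastNbr
      omega

theorem natAdj_iff {n : ℕ} {G : SimpleGraph (Fin n)} {u v : Fin n} :
    natAdj G u v ↔ G.Adj u v := by simp [natAdj]

/-- Dominating sets can be counted after relabelling. -/
theorem numDominatingSets_eq {n : ℕ} (G : SimpleGraph (Fin n)) {a : ℕ → ℕ → Prop} {f : ℕ → ℕ}
    (hf : ∀ u < n, 1 ≤ f u ∧ f u ≤ n) (hinj : ∀ u < n, ∀ v < n, f u = f v → u = v)
    (ha : ∀ u < n, ∀ v < n, a (f u) (f v) ↔ natAdj G u v) :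
    numDominatingSets G =
      cntSets (Finset.Icc 1 n) (fun S => ∀ v ∈ Finset.Icc 1 n, Dominated a S v) (fun _ => 0) 0 := by
  classical
  have hi : Function.Injective fun v : Fin n => f v := fun u v h =>
    Fin.ext (hinj u u.2 v v.2 h)
  have hu : (Finset.univ : Finset (Fin n)).image (fun v : Fin n => f v) = Finset.Icc 1 n := by
    refine Finset.eq_of_subset_of_card_le (fun x => ?_) ?_
    · simp only [Finset.mem_image, Finset.mem_univ, true_and, Finset.mem_Icc]
      rintro ⟨v, rfl⟩
      exact hf v v.2
    · rw [Finset.card_image_of_injective _ hi]; simp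
  have hdom : ∀ (S : Finset (Fin n)) (v : Fin n),
      Dominated a (S.image fun v : Fin n => f v) (f v) ↔ v ∈ S ∨ ∃ u ∈ S, G.Adj v u := by
    intro S v
    unfold Dominated
    refine or_congr ⟨fun h => ?_, fun h => Finset.mem_image_of_mem _ h⟩ ?_
    · obtain ⟨u, hu, h⟩ := Finset.mem_image.1 h
      rwa [← hi h]
    · simp only [Finset.mem_image, exists_exists_and_eq_and]
      exact exists_congr fun u => and_congr_right fun _ => by
        rw [ha _ v.2 _ u.2, natAdj_iff]
  unfold numDominatingSets cntSets
  rw [Nat.card_eq_fintype_card, Fintype.card_subtype,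
    ← Finset.card_image_of_injective _ (Finset.image_injective hi)]
  congr 1
  ext S
  simp only [Finset.mem_image, Finset.mem_filter, Finset.mem_univ, true_and, Finset.mem_powerset,
    and_true]
  constructor
  · rintro ⟨T, hT, rfl⟩
    refine ⟨hu ▸ Finset.image_subset_image (Finset.subset_univ _), fun x hx => ?_⟩
    rw [← hu] at hx
    obtain ⟨v, -, rfl⟩ := Finset.mem_image.1 hx
    rw [hdom]
    by_cases hv : v ∈ T
    · exact .inl hv
    · exact .inr (hT v hv)
  · rintro ⟨hS, h⟩
    rw [← hu] at hS
    obtain ⟨T, -, rfl⟩ := Finset.subset_image_iff.1 hS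
    refine ⟨T, fun v hv => ?_, rfl⟩
    have := (hdom T v).1 (h _ (by rw [← hu]; exact Finset.mem_image_of_mem _ (Finset.mem_univ v)))
    exact this.resolve_left hv

/-! ### Symbolic states -/

/-- The state `s` agrees with `S` up to the variables that `Prog.fill` and `Prog.scatter` use. -/
structure St (S s : Store) : Prop where
  var : ∀ y, y ∉ [10, 11, 12, 13] → s.var y = S.var y
  arr : s.arr = S.arr
  num : s.num = S.num

theorem St.refl (s : Store) : St s s := ⟨fun _ _ => rfl, rfl, rfl⟩

/-- Replace the entries `(i, j)` with `i < R` and `j < M` of the array `a` by `G i j`. -/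
def Store.putTab (s : Store) (a R M : ℕ) (G : ℕ → ℕ → ℕ) : Store :=
  { s with arr := fun b i j => if b = a ∧ i < R ∧ j < M then G i j else s.arr b i j }

theorem St.loc_var {S s : Store} (h : St S s) (i j k r : ℕ) :
    (s.loc i j k r).var = (S.loc i j k r).var := by
  funext y
  simp only [Store.loc]
  split_ifs with h1 h2 h3 h4 <;> try rfl
  exact h.var y (by simp [h1, h2, h3, h4])

open Classical in
/-- The entries computed by `Prog.fill` do not depend on the variables that it uses itself. -/
theorem St.fillVal_eq {S s : Store} (h : St S s) (init : WExp) (t : Test) (e : WExp) (i j k : ℕ) :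
    fillVal s init t e i j k = fillVal S init t e i j k := by
  have hl : ∀ i j k r, s.loc i j k r = { S.loc i j k r with num := s.num } := by
    intro i j k r
    have h1 := h.loc_var i j k r
    have h2 : (s.loc i j k r).arr = (S.loc i j k r).arr := h.arr
    cases hs : s.loc i j k r
    rw [hs] at h1 h2
    simp only at h1 h2
    have h3 : (s.loc i j k r).num = s.num := rfl
    rw [hs] at h3
    simp only at h3
    subst h1 h2 h3
    rfl
  have he : ∀ (e : WExp) i j k r, e.eval (s.loc i j k r) = e.eval (S.loc i j k r) := by
    intro e i j k r
    rw [hl]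
    induction e with
    | lit | var => rfl
    | arr a i j h1 h2 => simp only [WExp.eval, h1, h2]
    | succ e ih | pred e ih => simp only [WExp.eval, ih]
  have ht : ∀ (t : Test) i j k r, t.holds (s.loc i j k r) ↔ t.holds (S.loc i j k r) := by
    intro t i j k r
    induction t with
    | eq | lt => simp only [Test.holds, he]
    | not b h1 => simp only [Test.holds, h1]
    | and b c h1 h2 | or b c h1 h2 => simp only [Test.holds, h1, h2]
  induction k with
  | zero => simp only [fillVal, he]
  | succ k ih =>
    rw [fillVal, fillVal, ih, he]
    exact if_congr (ht _ _ _ _ _) rfl rfl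

section

variable {α : Type*} {sz : α → ℕ} {d : ℕ} {good : α → Prop} {S : α → Store}

/-- The rule for `Prog.fill` with abstract states: `S x` is the state before, `good x` what is
known about it, and `G x` the table to be computed. The cost is cubic for three loops of linear
length, and quadratic if one of them has at most one round. -/
theorem Spec.fillSt (a L₁ L₂ L₃ : ℕ) (init : WExp) (t : Test) (e : WExp) (R M K : α → ℕ)
    (G : α → ℕ → ℕ → ℕ)
    (h₁ : (decide (L₁ ∉ [10, 11, 12, 13]) && decide (L₂ ∉ [10, 11, 12, 13]) &&
      decide (L₃ ∉ [10, 11, 12, 13]) && init.avoids a && t.avoids a && e.avoids a) = true)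
    (hS : ∀ x, good x → (S x).var 0 = sz x ∧ (S x).var L₁ = R x ∧ (S x).var L₂ = M x ∧
      (S x).var L₃ = K x)
    (hc : ∀ x, good x → (R x ≤ 2 * sz x + 1 ∧ M x ≤ 2 * sz x + 1 ∧ K x ≤ 2 * sz x + 1) ∧
      (d = 3 ∨ (d = 2 ∧ (R x ≤ 1 ∨ M x ≤ 1 ∨ K x ≤ 1))))
    (hG : ∀ x, good x → ∀ i < R x, ∀ j < M x, fillVal (S x) init t e i j (K x) = G x i j) :
    Spec sz d (.fill a L₁ L₂ L₃ init t e) (fun x s => good x ∧ St (S x) s)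
      (fun x s => good x ∧ St ((S x).putTab a (R x) (M x) (G x)) s) := by
  simp only [Bool.and_eq_true, decide_eq_true_eq] at h₁
  refine (Spec.fill 8 a L₁ L₂ L₃ init t e h₁.1.1.1.1.1 h₁.1.1.1.1.2 h₁.1.1.1.2 h₁.1.1.2 h₁.1.2
    h₁.2).conseq le_rfl ?_
  rintro x s ⟨hx, hs⟩
  obtain ⟨g0, g1, g2, g3⟩ := hS x hx
  have e0 := (hs.var 0 (by simp)).trans g0
  have e1 := (hs.var L₁ h₁.1.1.1.1.1).trans g1
  have e2 := (hs.var L₂ h₁.1.1.1.1.2).trans g2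
  have e3 := (hs.var L₃ h₁.1.1.1.2).trans g3
  refine ⟨s, e0, ⟨rfl, ?_⟩, ?_⟩
  · rw [e0, e1, e2, e3]
    obtain ⟨⟨c1, c2, c3⟩, c4⟩ := hc x hx
    have d1 : R x + 1 ≤ 2 * (sz x + 1) := by omega
    have d2 : M x + 1 ≤ 2 * (sz x + 1) := by omega
    have d3 : K x + 1 ≤ 2 * (sz x + 1) := by omega
    rcases c4 with rfl | ⟨rfl, c4⟩
    · calc _ ≤ (2 * (sz x + 1)) * (2 * (sz x + 1)) * (2 * (sz x + 1)) :=
            Nat.mul_le_mul (Nat.mul_le_mul d3 d2) d1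
        _ = _ := by ring
    · rcases c4 with c4 | c4 | c4
      · calc _ ≤ (2 * (sz x + 1)) * (2 * (sz x + 1)) * 2 :=
              Nat.mul_le_mul (Nat.mul_le_mul d3 d2) (by omega)
          _ = _ := by ring
      · calc _ ≤ (2 * (sz x + 1)) * 2 * (2 * (sz x + 1)) :=
              Nat.mul_le_mul (Nat.mul_le_mul d3 (by omega)) d1
          _ = _ := by ring
      · calc _ ≤ 2 * (2 * (sz x + 1)) * (2 * (sz x + 1)) :=
              Nat.mul_le_mul (Nat.mul_le_mul (by omega) d2) d1
          _ = _ := by ring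
  · rintro s' ⟨hA, hT⟩
    refine ⟨hx, fun y hy => ?_, ?_, ?_⟩
    · rw [hA.2.1 y hy, hs.var y hy]; rfl
    · funext b i j
      simp only [Store.putTab]
      by_cases hb : b = a
      · subst hb
        rw [hT, e1, e2, e3]
        simp only [true_and]
        split_ifs with hij
        · rw [hs.fillVal_eq, hG x hx i hij.1 j hij.2]
        · rw [hs.arr]
      · rw [hA.2.2 b hb, hs.arr]
        simp [hb]
    · rw [hA.1, hs.num]; rfl

/-- Assignment to a variable in terms of abstract states. -/
theorem Spec.setVarSt (y : ℕ) (e : WExp) (v : α → ℕ)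
    (he : ∀ x s, good x → St (S x) s → e.eval s = v x) :
    Spec sz d (.setVar y e) (fun x s => good x ∧ St (S x) s)
      (fun x s => good x ∧ St ((S x).setVar y (v x)) s) := by
  refine Spec.setVar fun x s ⟨hx, hs⟩ => ⟨hx, fun z hz => ?_, hs.arr, hs.num⟩
  simp only [Store.setVar, he x s hx hs, hs.var z hz]

/-- Assignment to an array cell in terms of abstract states. -/
theorem Spec.setArrSt (a : ℕ) (i j e : WExp) (vi vj v : α → ℕ)
    (he : ∀ x s, good x → St (S x) s → i.eval s = vi x ∧ j.eval s = vj x ∧ e.eval s = v x) :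
    Spec sz d (.setArr a i j e) (fun x s => good x ∧ St (S x) s)
      (fun x s => good x ∧ St ((S x).setArr a (vi x) (vj x) (v x)) s) := by
  refine Spec.setArr fun x s ⟨hx, hs⟩ => ⟨hx, hs.var, ?_, hs.num⟩
  obtain ⟨h1, h2, h3⟩ := he x s hx hs
  simp only [Store.setArr, h1, h2, h3, hs.arr]

end

open Classical in
/-- With one round of the inner loop, `Prog.fill` tabulates a conditional expression. -/
theorem fillVal_ite {s : Store} {t : Test} {i j : ℕ} {e init : WExp} {φ : Prop} [Decidable φ]
    {u v : ℕ} (hv : init.eval (s.loc i j 0 0) = v) (h : t.holds (s.loc i j 0 v) ↔ φ)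
    (hu : e.eval (s.loc i j 0 v) = u) :
    fillVal s init t e i j 1 = if φ then u else v := by
  rw [fillVal, fillVal, hv, hu]
  exact if_congr h rfl rfl

open Classical in
/-- With one round of the inner loop, `Prog.fill` tabulates a test. -/
theorem fillVal_one {s : Store} {t : Test} {i j : ℕ} {φ : Prop}
    (h : ∀ r, t.holds (s.loc i j 0 r) ↔ φ) : fillVal s (.lit 0) t (.lit 1) i j 1 = ind φ := by
  rw [fillVal, fillVal]
  exact if_congr (h _) rfl rfl

open Classical in
/-- Storing the counter, increased by one, finds the last index for which the test holds. -/
theorem fillVal_last {s : Store} {t : Test} {i j K : ℕ} {φ : ℕ → Prop}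
    (h : ∀ k < K, ∀ r, t.holds (s.loc i j k r) ↔ φ k) :
    fillVal s (.lit 0) t (.succ (.var 12)) i j K = lastOf φ K := by
  induction K with
  | zero => simp [fillVal, WExp.eval, lastOf]
  | succ K ih =>
    rw [fillVal, lastOf, ih fun k hk => h k (by omega)]
    exact if_congr (h K (by omega) _) (by simp [WExp.eval, Store.loc]) rfl

open Classical in
/-- Storing the counter where its key is smaller than the key of the stored one finds a minimum. -/
theorem fillVal_argMin {s : Store} {t : Test} {i j K : ℕ} {φ : ℕ → Prop} {key : ℕ → ℕ}
    (h : ∀ k < K, ∀ r ≤ K, t.holds (s.loc i j k r) ↔ φ k ∧ (r = 0 ∨ key k < key (r - 1))) :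
    fillVal s (.lit 0) t (.succ (.var 12)) i j K = argMin φ key K := by
  have hle : ∀ K, argMin φ key K ≤ K := by
    intro K
    induction K with
    | zero => simp [argMin]
    | succ K ih => rw [argMin]; split_ifs <;> omega
  have : ∀ K' ≤ K, fillVal s (.lit 0) t (.succ (.var 12)) i j K' = argMin φ key K' := by
    intro K' hK'
    induction K' with
    | zero => simp [fillVal, WExp.eval, argMin]
    | succ K' ih =>
      rw [fillVal, argMin, ih (by omega)]
      exact if_congr (h K' (by omega) _ ((hle K').trans (by omega)))
        (by simp [WExp.eval, Store.loc]) rfl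
  exact this K le_rfl

/-! ### Tests on Boolean tables -/

/-- The entry `(i, j)` of the table `a` is `1`. -/
@[reducible] def Test.on (a : ℕ) (i j : WExp) : Test := .eq (.arr a i j) (.lit 1)

/-- The entry `(i, j)` of the table `a` is `0`. -/
@[reducible] def Test.off (a : ℕ) (i j : WExp) : Test := .eq (.arr a i j) (.lit 0)

/-- The variable for the row that `Prog.fill` is working on. -/
@[reducible] def WExp.row : WExp := .var 10

/-- The variable for the column that `Prog.fill` is working on. -/
@[reducible] def WExp.col : WExp := .var 11

/-- The counter of the inner loop of `Prog.fill`. -/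
@[reducible] def WExp.idx : WExp := .var 12

/-- The accumulator of `Prog.fill`. -/
@[reducible] def WExp.acc : WExp := .var 13

open WExp

/-! ### Computing a perfect elimination order -/

/-- The table of the numbers of neighbours of `i` that are not in the closed neighbourhood of `j`. -/
def missProg : Prog :=
  .fill 3 0 0 0 (.lit 0) (.and (.on 0 row idx) (.and (.off 0 col idx) (.not (.eq idx col))))
      (.succ acc)

/-- Remove a simplicial vertex. The array `1` holds the positions of the removed vertices, which are
marked in array `2`; array `3` counts the obstacles among the remaining vertices. -/
def peoRound : Prog :=
  .seq (.fill 4 1 0 0 (.lit 0)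
    (.and (.off 2 (.lit 0) idx) (.and (.on 0 col idx) (.not (.off 3 col idx)))) (.lit 1))
  (.seq (.fill 5 1 1 0 (.lit 0) (.and (.off 2 (.lit 0) idx) (.off 4 (.lit 0) idx)) (.succ idx))
  (.seq (.setVar 21 (.pred (.arr 5 (.lit 0) (.lit 0))))
  (.seq (.setArr 1 (.lit 0) (.var 21) (.var 20))
  (.seq (.setArr 2 (.lit 0) (.var 21) (.lit 1))
  (.seq (.fill 6 0 0 1 (.arr 3 row col)
    (.and (.on 0 row (.var 21)) (.and (.off 0 col (.var 21)) (.not (.eq col (.var 21)))))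
        (.pred acc))
  (.fill 3 0 0 1 (.arr 6 row col) (.eq (.lit 0) (.lit 1)) (.lit 0)))))))

/-- The variables that hold the size `n` and numbers derived from it. -/
structure Sizes (n : ℕ) (S : Store) : Prop where
  v0 : S.var 0 = n
  v1 : S.var 1 = 1
  v2 : S.var 2 = 2 * n
  v3 : S.var 3 = 2 * n + 1
  v4 : S.var 4 = n + 1

/-- The state of the computation of the elimination order after `k` rounds. -/
structure PeoInv (n : ℕ) (adj : ℕ → ℕ → Prop) (k : ℕ) (S : Store) : Prop extends Sizes n S where
  model : Nonempty (RootedModel n adj)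
  adj_eq : ∀ i j, S.arr 0 i j = ind (adj i j)
  zero : ∀ a, 7 ≤ a → S.arr a = fun _ _ => 0
  num : S.num = fun _ _ _ => 0
  miss : ∀ i < n, ∀ j < n, S.arr 3 i j =
    cnt n fun y => S.arr 2 0 y = 0 ∧ adj i y ∧ ¬ adj j y ∧ y ≠ j
  left : cnt n (fun v => S.arr 2 0 v = 0) = n - k
  pos_lt : ∀ v < n, S.arr 2 0 v ≠ 0 → S.arr 1 0 v < k
  inj : ∀ u < n, ∀ v < n, S.arr 2 0 u ≠ 0 → S.arr 2 0 v ≠ 0 → S.arr 1 0 u = S.arr 1 0 v → u = v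
  peo : ∀ v < n, S.arr 2 0 v ≠ 0 → ∀ u w, adj v u → adj v w →
    (S.arr 2 0 u = 0 ∨ S.arr 1 0 v < S.arr 1 0 u) → (S.arr 2 0 w = 0 ∨ S.arr 1 0 v < S.arr 1 0 w) →
    u = w ∨ adj u w

/-- The data of a round of `peoRound`. -/
structure RoundCtx where
  /-- the number of vertices -/
  n : ℕ
  /-- the graph -/
  adj : ℕ → ℕ → Prop
  /-- the number of the round -/
  k : ℕ
  /-- the state before the round -/
  S : Store

/-- The vertex, increased by one, that is removed in the next round. -/
noncomputable def peoPick (n : ℕ) (adj : ℕ → ℕ → Prop) (S : Store) : ℕ :=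
  lastOf (fun v => S.arr 2 0 v = 0 ∧
    ¬ ∃ y < n, S.arr 2 0 y = 0 ∧ adj v y ∧ S.arr 3 v y ≠ 0) n

open Classical in
/-- Removing a simplicial vertex `p` preserves the invariant. Such a vertex exists among the
remaining vertices because of the clique tree; `p` is simplicial if and only if no entry `(p, y)`
of the table of obstacles with a remaining neighbour `y` of `p` is positive, and the removal of `p`
decreases the entries that count `p`. -/
theorem PeoInv.round {n : ℕ} {adj : ℕ → ℕ → Prop} {k : ℕ} {S : Store} (h : PeoInv n adj k S)
    (hk : k < n) {p : ℕ} (hp : peoPick n adj S - 1 = p) {S' : Store}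
    (hS' : Sizes n S') (h0 : S'.arr 0 = S.arr 0) (h7 : ∀ a, 7 ≤ a → S'.arr a = S.arr a)
    (hn : S'.num = S.num)
    (h1 : ∀ v, S'.arr 1 0 v = if v = p then k else S.arr 1 0 v)
    (h2 : ∀ v, S'.arr 2 0 v = if v = p then 1 else S.arr 2 0 v)
    (h3 : ∀ i < n, ∀ j < n, S'.arr 3 i j =
      if adj i p ∧ ¬ adj j p ∧ j ≠ p then S.arr 3 i j - 1 else S.arr 3 i j) :
    PeoInv n adj (k + 1) S' := by
  obtain ⟨M⟩ := h.model
  have hsimp : ∀ v < n,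
      S.arr 2 0 v = 0 → ((¬ ∃ y < n, S.arr 2 0 y = 0 ∧ adj v y ∧ S.arr 3 v y ≠ 0) ↔
      ∀ u w, S.arr 2 0 u = 0 → S.arr 2 0 w = 0 → adj v u → adj v w → u = w ∨ adj u w) := by
    intro v hv hv0
    constructor
    · intro hno u w hu hw hvu hvw
      by_contra hne
      push Not at hne
      refine hno ⟨u, M.adj_lt hvu, hu, hvu, ?_⟩
      rw [h.miss v hv u (M.adj_lt hvu)]
      exact fun h0 => cnt_eq_zero.1 h0 w (M.adj_lt hvw) ⟨hw, hvw, hne.2, Ne.symm hne.1⟩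
    · rintro hall ⟨y, hy, hy0, hvy, hm⟩
      rw [h.miss v hv y hy] at hm
      refine hm (cnt_eq_zero.2 fun z _ hz => ?_)
      rcases hall y z hy0 hz.1 hvy hz.2.1 with e | e
      · exact hz.2.2.2 e.symm
      · exact hz.2.2.1 e
  have hne : ∃ v, v < n ∧ S.arr 2 0 v = 0 := by
    by_contra! hno
    have h4 : cnt n (fun v => S.arr 2 0 v = 0) = 0 := cnt_eq_zero.2 hno
    have := h.left
    omega
  obtain ⟨v₀, ⟨hv₀n, hv₀⟩, hv₀s⟩ := M.exists_simplicial (H := fun v => v < n ∧ S.arr 2 0 v = 0)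
    (fun v hv => hv.1) hne
  have hpick := le_lastOf (φ := fun v => S.arr 2 0 v = 0 ∧
    ¬ ∃ y < n, S.arr 2 0 y = 0 ∧ adj v y ∧ S.arr 3 v y ≠ 0) hv₀n ⟨hv₀, (hsimp v₀ hv₀n hv₀).2
      fun u w hu hw h4 h5 => hv₀s u w ⟨M.adj_lt h4, hu⟩ ⟨M.adj_lt h5, hw⟩ h4 h5⟩
  obtain ⟨hpn, hp0, hps⟩ := lastOf_eq_succ (show lastOf (fun v => S.arr 2 0 v = 0 ∧
    ¬ ∃ y < n, S.arr 2 0 y = 0 ∧ adj v y ∧ S.arr 3 v y ≠ 0) n = p + 1 by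
      unfold peoPick at hp; omega)
  rw [hsimp p hpn hp0] at hps
  have h2' : ∀ v, S'.arr 2 0 v = 0 ↔ S.arr 2 0 v = 0 ∧ v ≠ p := by
    intro v
    rw [h2]
    split_ifs with hv <;> simp [hv]
  refine ⟨hS', ⟨M⟩, by rw [h0]; exact h.adj_eq, fun a ha => by rw [h7 a ha, h.zero a ha],
    hn.trans h.num, ?_, ?_, ?_, ?_, ?_⟩
  · intro i hi j hj
    rw [h3 i hi j hj, h.miss i hi j hj]
    simp only [h2']
    split_ifs with h4
    · refine (cnt_erase (φ := fun y => S.arr 2 0 y = 0 ∧ adj i y ∧ ¬ adj j y ∧ y ≠ j) hpn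
        ⟨hp0, h4.1, h4.2.1, Ne.symm h4.2.2⟩ fun y _ => ?_).symm
      tauto
    · refine cnt_congr fun y _ => ?_
      constructor
      · rintro ⟨h5, h6, h7, h8⟩
        refine ⟨⟨h5, ?_⟩, h6, h7, h8⟩
        rintro rfl
        exact h4 ⟨h6, h7, Ne.symm h8⟩
      · rintro ⟨⟨h5, -⟩, h6⟩
        exact ⟨h5, h6⟩
  · simp only [h2']
    rw [cnt_erase hpn hp0 fun _ _ => Iff.rfl, h.left]
    omega
  · intro v hv hv2
    rw [h1]
    split_ifs with hvp
    · omega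
    · rw [Ne, h2'] at hv2
      have := h.pos_lt v hv (by tauto)
      omega
  · intro u hu v hv hu2 hv2 he
    rw [h1, h1] at he
    rw [Ne, h2'] at hu2 hv2
    split_ifs at he with h4 h5 h5
    · rw [h4, h5]
    · have := h.pos_lt v hv (by tauto)
      omega
    · have := h.pos_lt u hu (by tauto)
      omega
    · exact h.inj u hu v hv (by tauto) (by tauto) he
  · intro v hv hv2 u w hvu hvw hu hw
    rw [Ne, h2'] at hv2
    rw [h2', h1, h1] at hu hw
    by_cases hvp : v = p
    · subst hvp
      -- every later vertex is still present
      have late : ∀ z, adj v z → ((S.arr 2 0 z = 0 ∧ z ≠ v) ∨ (if v = v then k else S.arr 1 0 v) <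
          if z = v then k else S.arr 1 0 z) → S.arr 2 0 z = 0 := by
        intro z hvz hz
        rcases hz with hz | hz
        · exact hz.1
        · by_contra hz2
          have := h.pos_lt z (M.adj_lt hvz) hz2
          rw [if_pos rfl] at hz
          split_ifs at hz <;> omega
      exact hps u w (late u hvu hu) (late w hvw hw) hvu hvw
    · have hv3 : S.arr 2 0 v ≠ 0 := by tauto
      have conv : ∀ z, ((S.arr 2 0 z = 0 ∧ z ≠ p) ∨ (if v = p then k else S.arr 1 0 v) <
          if z = p then k else S.arr 1 0 z) → S.arr 2 0 z = 0 ∨ S.arr 1 0 v < S.arr 1 0 z := by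
        intro z hz
        rw [if_neg hvp] at hz
        rcases hz with hz | hz
        · exact .inl hz.1
        · split_ifs at hz with hzp
          · subst hzp; exact .inl hp0
          · exact .inr hz
      exact h.peo v hv hv3 u w hvu hvw (conv u hu) (conv w hw)

theorem Spec.peoRound : Spec (α := RoundCtx) (fun x => x.n) 2 peoRound
    (fun x s => (x.k < x.n ∧ PeoInv x.n x.adj x.k x.S ∧ x.S.var 20 = x.k) ∧ St x.S s)
    (fun x s => ∃ S', (S'.var 20 = x.k ∧ PeoInv x.n x.adj (x.k + 1) S') ∧ St S' s) := by
  refine Spec.conseq (α := RoundCtx) (sz := fun x => x.n) (Spec.seq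
    (Spec.fillSt (good := fun x : RoundCtx => x.k < x.n ∧ PeoInv x.n x.adj x.k x.S ∧
        x.S.var 20 = x.k)
      (S := RoundCtx.S) 4 1 0 0 _ _ _ (fun _ => 1) RoundCtx.n RoundCtx.n (fun x _ j =>
      ind (∃ y < x.n, x.S.arr 2 0 y = 0 ∧ x.adj j y ∧ x.S.arr 3 j y ≠ 0)) (by decide) ?_ ?_ ?_) <|
    Spec.seq (Spec.fillSt 5 1 1 0 _ _ _ (fun _ => 1) (fun _ => 1) RoundCtx.n
      (fun x _ _ => peoPick x.n x.adj x.S) (by decide) ?_ ?_ ?_) <|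
    Spec.seq (Spec.setVarSt 21 _ (fun x => peoPick x.n x.adj x.S - 1) ?_) <|
    Spec.seq (Spec.setArrSt 1 _ _ _ (fun _ => 0) (fun x => peoPick x.n x.adj x.S - 1)
        RoundCtx.k ?_) <|
    Spec.seq (Spec.setArrSt 2 _ _ _ (fun _ => 0) (fun x => peoPick x.n x.adj x.S - 1)
        (fun _ => 1) ?_) <|
    Spec.seq (Spec.fillSt 6 0 0 1 _ _ _ RoundCtx.n RoundCtx.n (fun _ => 1) (fun x i j =>
      open Classical in if x.adj i (peoPick x.n x.adj x.S - 1) ∧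
        ¬ x.adj j (peoPick x.n x.adj x.S - 1) ∧ j ≠ peoPick x.n x.adj x.S - 1 then x.S.arr 3 i j - 1
        else x.S.arr 3 i j) (by decide) ?_ ?_ ?_) <|
    Spec.fillSt 3 0 0 1 _ _ _ RoundCtx.n RoundCtx.n (fun _ => 1) (fun x i j =>
      open Classical in if x.adj i (peoPick x.n x.adj x.S - 1) ∧
        ¬ x.adj j (peoPick x.n x.adj x.S - 1) ∧ j ≠ peoPick x.n x.adj x.S - 1 then x.S.arr 3 i j - 1
        else x.S.arr 3 i j) (by decide) ?_ ?_ ?_) le_rfl ?_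
  · intro x h
    simp [h.2.1.v0, h.2.1.v1]
  · intro x h
    omega
  · intro x h i hi j hj
    refine fillVal_ex fun k hk r => ?_
    simp [Test.holds, WExp.eval, Store.loc, h.2.1.adj_eq]
  · intro x h
    simp [h.2.1.v0, h.2.1.v1, Store.putTab]
  · intro x h
    omega
  · intro x h i hi j hj
    refine fillVal_last fun k hk r => ?_
    simp [Test.holds, WExp.eval, Store.loc, Store.putTab, hk]
  · intro x s h hs
    simp [WExp.eval, hs.arr, Store.putTab]
  · intro x s h hs
    simp [WExp.eval, hs.var, Store.setVar, h.2.2, Store.putTab]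
  · intro x s h hs
    simp [WExp.eval, hs.var, Store.setVar, Store.putTab, Store.setArr]
  · intro x h
    simp [h.2.1.v0, h.2.1.v1, Store.putTab, Store.setVar, Store.setArr]
  · intro x h
    omega
  · intro x h i hi j hj
    classical
    refine fillVal_ite ?_ ?_ ?_
    · simp [WExp.eval, Store.loc, Store.putTab, Store.setVar, Store.setArr]
    · simp [Test.holds, WExp.eval, Store.loc, Store.putTab, Store.setVar, Store.setArr,
          h.2.1.adj_eq]
    · simp [WExp.eval, Store.loc]
  · intro x h
    simp [h.2.1.v0, h.2.1.v1, Store.putTab, Store.setVar, Store.setArr]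
  · intro x h
    omega
  · intro x h i hi j hj
    rw [fillVal_ite (φ := False) (u := 0) (v := _) rfl (by simp [Test.holds, WExp.eval])
        rfl, if_neg id]
    simp [WExp.eval, Store.loc, Store.putTab, hi, hj]
  · rintro x s ⟨h, hs⟩
    refine ⟨x, rfl, ⟨h, hs⟩, fun s' ⟨_, hs'⟩ => ⟨_, ⟨?_, ?_⟩, hs'⟩⟩
    · simp [Store.putTab, Store.setVar, Store.setArr, h.2.2]
    · refine h.2.1.round h.1 rfl ?_ ?_ ?_ ?_ ?_ ?_ ?_
      · have := h.2.1.toSizes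
        constructor <;> simp [Store.putTab, Store.setVar, Store.setArr, this.v0, this.v1, this.v2,
          this.v3, this.v4]
      · simp [Store.putTab, Store.setVar, Store.setArr]
      · intro a ha
        have : a ≠ 1 ∧ a ≠ 2 ∧ a ≠ 3 ∧ a ≠ 4 ∧ a ≠ 5 ∧ a ≠ 6 := by omega
        simp [Store.putTab, Store.setVar, Store.setArr, this]
      · simp [Store.putTab, Store.setVar, Store.setArr]
      · simp [Store.putTab, Store.setVar, Store.setArr]
      · simp [Store.putTab, Store.setVar, Store.setArr]
      · intro i hi j hj
        simp [Store.putTab, Store.setVar, Store.setArr, hi, hj]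

theorem St.setVar {S s : Store} (h : St S s) (y v : ℕ) : St (S.setVar y v) (s.setVar y v) := by
  refine ⟨fun z hz => ?_, h.arr, h.num⟩
  simp only [Store.setVar, h.var z hz]

theorem Sizes.setVar {n : ℕ} {S : Store} (h : Sizes n S) {y : ℕ} (hy : 5 ≤ y) (v : ℕ) :
    Sizes n (S.setVar y v) := by
  have : y ≠ 0 ∧ y ≠ 1 ∧ y ≠ 2 ∧ y ≠ 3 ∧ y ≠ 4 := by omega
  constructor <;> simp [Store.setVar, this.1.symm, this.2.1.symm, this.2.2.1.symm,
      this.2.2.2.1.symm,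
    this.2.2.2.2.symm, h.v0, h.v1, h.v2, h.v3, h.v4]

theorem PeoInv.setVar {n : ℕ} {adj : ℕ → ℕ → Prop} {k : ℕ} {S : Store} (h : PeoInv n adj k S)
    {y : ℕ} (hy : 5 ≤ y) (v : ℕ) : PeoInv n adj k (S.setVar y v) :=
  { h with toSizes := h.toSizes.setVar hy v }

/-- The initial state for the graph `adj`. -/
structure IsInput (n : ℕ) (adj : ℕ → ℕ → Prop) (s : Store) : Prop where
  model : Nonempty (RootedModel n adj)
  v0 : s.var 0 = n
  var : ∀ y, y ≠ 0 → s.var y = 0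
  adj_eq : ∀ i j, s.arr 0 i j = ind (adj i j)
  zero : ∀ a, a ≠ 0 → s.arr a = fun _ _ => 0
  num : s.num = fun _ _ _ => 0

/-- A perfect elimination order is stored in the array `1`, and the arrays from `7` on are empty. -/
structure IsOrdered (n : ℕ) (adj : ℕ → ℕ → Prop) (S : Store) : Prop extends Sizes n S where
  model : Nonempty (RootedModel n adj)
  adj_eq : ∀ i j, S.arr 0 i j = ind (adj i j)
  zero : ∀ a, 7 ≤ a → S.arr a = fun _ _ => 0
  num : S.num = fun _ _ _ => 0
  peo : PEO n adj (S.arr 1 0)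

theorem PeoInv.isOrdered {n : ℕ} {adj : ℕ → ℕ → Prop} {S : Store} (h : PeoInv n adj n S) :
    IsOrdered n adj S := by
  obtain ⟨M⟩ := h.model
  have hr : ∀ v < n, S.arr 2 0 v ≠ 0 := cnt_eq_zero.1 (h.left.trans (Nat.sub_self n))
  refine ⟨h.toSizes, h.model, h.adj_eq, h.zero, h.num, ?_⟩
  exact { symm := M.adj_symm, irrefl := M.adj_irrefl, lt := M.adj_lt
          inj := fun {u v} hu hv => h.inj u hu v hv (hr u hu) (hr v hv)
          pos_lt := fun {v} hv => h.pos_lt v hv (hr v hv)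
          clique := fun {v u w} hu hw h1 h2 =>
            have hv := M.adj_lt (M.adj_symm hu)
            h.peo v hv (hr v hv) u w hu hw (.inr h1) (.inr h2) }

/-- Set the variables that hold the sizes. -/
def sizesProg : Prog :=
  .seq (.setVar 1 (.lit 1)) (.seq (.for 10 0 (.setVar 2 (.succ (.succ (.var 2)))))
    (.seq (.setVar 3 (.succ (.var 2))) (.setVar 4 (.succ (.var 0)))))

/-- Compute a perfect elimination order. -/
def peoProg : Prog := .seq sizesProg (.seq missProg (.for 20 0 peoRound))

theorem Spec.sizesProg : Spec (α := ℕ × (ℕ → ℕ → Prop)) (fun x => x.1) 1 sizesProg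
    (fun x s => IsInput x.1 x.2 s)
    (fun x s => ∃ S, (Sizes x.1 S ∧ ∃ s₀, IsInput x.1 x.2 s₀ ∧ S.arr = s₀.arr ∧ S.num = s₀.num) ∧
      St S s) := by
  refine Spec.seq (Mid := fun x s => s.var 0 = x.1 ∧ s.var 1 = 1 ∧ s.var 2 = 0 ∧
      ∃ s₀, IsInput x.1 x.2 s₀ ∧ s.arr = s₀.arr ∧ s.num = s₀.num) (Spec.setVar ?_) <|
    Spec.seq (Mid := fun x s => s.var 0 = x.1 ∧ s.var 1 = 1 ∧ s.var 2 = 2 * x.1 ∧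
      ∃ s₀, IsInput x.1 x.2 s₀ ∧ s.arr = s₀.arr ∧ s.num = s₀.num)
      (Spec.for (d := 0) (fun x => x.1)
          (fun x k s => s.var 0 = x.1 ∧ s.var 1 = 1 ∧ s.var 2 = 2 * k ∧
        ∃ s₀, IsInput x.1 x.2 s₀ ∧ s.arr = s₀.arr ∧ s.num = s₀.num) (by decide)
        (fun x => by omega) ?_ (Spec.setVar ?_) ?_) <|
    Spec.seq (Mid := fun x s => s.var 0 = x.1 ∧ s.var 1 = 1 ∧ s.var 2 = 2 * x.1 ∧
      s.var 3 = 2 * x.1 + 1 ∧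
      ∃ s₀, IsInput x.1 x.2 s₀ ∧ s.arr = s₀.arr ∧ s.num = s₀.num) (Spec.setVar ?_) (Spec.setVar ?_)
  · intro x s h
    simp only [Store.setVar, WExp.eval]
    exact ⟨by simpa using h.v0, by simp, by simpa using h.var 2 (by simp), s, h, rfl, rfl⟩
  · intro x s h
    refine ⟨h.1, ?_⟩
    simpa [Store.setVar] using h
  · rintro ⟨x, k⟩ s ⟨h1, h2, h3, h4, h5, h6, h7⟩
    simp only [Store.setVar, WExp.eval]
    simp only at h2 h3 h4 h5 h6
    simp [h2, h3, h5, h6]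
    exact ⟨by omega, h7⟩
  · intro x s h; exact h
  · rintro x s ⟨h1, h2, h3, h4⟩
    simp only [Store.setVar, WExp.eval]
    simp [h1, h2, h3]
    exact h4
  · rintro x s ⟨h1, h2, h3, h4, h5⟩
    refine ⟨s.setVar 4 _, ⟨?_, h5⟩, St.refl _⟩
    constructor <;> simp [Store.setVar, WExp.eval, h1, h2, h3, h4]

/-- This is the only cubic part of the computation of the elimination order. -/
theorem Spec.missProg : Spec (α := ℕ × (ℕ → ℕ → Prop)) (fun x => x.1) 3 missProg
    (fun x s => ∃ S, (Sizes x.1 S ∧ ∃ s₀, IsInput x.1 x.2 s₀ ∧ S.arr = s₀.arr ∧ S.num = s₀.num) ∧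
      St S s)
    (fun x s => ∃ S, PeoInv x.1 x.2 0 S ∧ St S s) := by
  refine Spec.conseq (α := RoundCtx) (sz := fun x => x.n) (Spec.fillSt (good := fun x : RoundCtx =>
    Sizes x.n x.S ∧ ∃ s₀, IsInput x.n x.adj s₀ ∧ x.S.arr = s₀.arr ∧ x.S.num = s₀.num)
        (S := RoundCtx.S)
    3 0 0 0 _ _ _ RoundCtx.n RoundCtx.n RoundCtx.n (fun x i j =>
      cnt x.n fun y => x.adj i y ∧ ¬ x.adj j y ∧ y ≠ j) (by decide) ?_ ?_ ?_) le_rfl ?_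
  · intro x h
    simp [h.1.v0]
  · intro x h
    omega
  · rintro x ⟨h, s₀, h0, h1, h2⟩ i hi j hj
    rw [fillVal_count (φ := fun y => x.adj i y ∧ ¬ x.adj j y ∧ y ≠ j)]
    · simp [WExp.eval, cnt]
    · intro k hk r
      simp [Test.holds, WExp.eval, Store.loc, h1, h0.adj_eq]
  · rintro ⟨n, adj⟩ s ⟨S, ⟨hS, s₀, h0, h1, h2⟩, hs⟩
    refine ⟨⟨n, adj, 0, S⟩, rfl, ⟨⟨hS, s₀, h0, h1, h2⟩, hs⟩, fun s' hs' => ⟨_, ?_, hs'.2⟩⟩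
    have e2 : ∀ i j, S.arr 2 i j = 0 := fun i j => by rw [h1, h0.zero 2 (by simp)]
    refine ⟨?_, h0.model, ?_, ?_, ?_, ?_, ?_, ?_, ?_, ?_⟩
    · constructor <;> simp [Store.putTab, hS.v0, hS.v1, hS.v2, hS.v3, hS.v4]
    · simp [Store.putTab, h1, h0.adj_eq]
    · intro a ha
      have e3 : a ≠ 3 ∧ a ≠ 0 := by omega
      simp [Store.putTab, e3.1, h1, h0.zero a e3.2]
    · simp [Store.putTab, h2, h0.num]
    · intro i hi j hj
      simp [Store.putTab, hi, hj, e2]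
    · simp [Store.putTab, e2, cnt]
    all_goals simp [Store.putTab, e2]

/-- Each of the `n` rounds costs `O(n²)`. -/
theorem Spec.peoProg : Spec (α := ℕ × (ℕ → ℕ → Prop)) (fun x => x.1) 3 peoProg
    (fun x s => IsInput x.1 x.2 s) (fun x s => ∃ S, IsOrdered x.1 x.2 S ∧ St S s) := by
  refine Spec.seq (Spec.conseq Spec.sizesProg (by omega) fun x s h => ⟨x, rfl, h, fun _ h => h⟩) <|
    Spec.seq Spec.missProg (Spec.for (d := 2) (fun x => x.1)
      (fun x k s => ∃ S, PeoInv x.1 x.2 k S ∧ St S s) (by decide) (fun x => by omega) ?_ ?_ ?_)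
  · rintro x s ⟨S, h, hs⟩
    refine ⟨(hs.var 0 (by simp)).trans h.v0, _, h.setVar (by omega) 0, hs.setVar 20 0⟩
  · refine Spec.conseq Spec.peoRound le_rfl ?_
    rintro ⟨⟨n, adj⟩, k⟩ s ⟨hk, h1, h2, S, h, hs⟩
    refine ⟨⟨n, adj, k, S⟩, rfl, ⟨⟨hk, h, (hs.var 20 (by simp)).symm.trans h1⟩, hs⟩, ?_⟩
    rintro s' ⟨S', ⟨h3, h4⟩, hs'⟩
    exact ⟨(hs'.var 20 (by simp)).trans h3, (hs'.var 0 (by simp)).trans h4.v0,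
      _, h4.setVar (by omega) (k + 1), hs'.setVar 20 (k + 1)⟩
  · rintro x s ⟨S, h, hs⟩
    exact ⟨S, h.isOrdered, hs⟩

/-! ### Sequences of tables -/

/-- The arrays `a < k` hold the tables `tab a`, with `rows a` rows and `cols a` columns; the arrays
from `k` on and the arrays of numbers are empty. -/
structure Known (n : ℕ) (rows cols : ℕ → ℕ) (tab : ℕ → ℕ → ℕ → ℕ) (k : ℕ) (S : Store) : Prop
    extends Sizes n S where
  get : ∀ a < k, ∀ i < rows a, ∀ j < cols a, S.arr a i j = tab a i j
  zero : ∀ a, k ≤ a → S.arr a = fun _ _ => 0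
  num : S.num = fun _ _ _ => 0

theorem Sizes.putTab {n : ℕ} {S : Store} (h : Sizes n S) (a R M : ℕ) (G : ℕ → ℕ → ℕ) :
    Sizes n (S.putTab a R M G) := ⟨h.v0, h.v1, h.v2, h.v3, h.v4⟩

section

variable {α : Type*} {good : α → Prop} {n : α → ℕ} {rows cols : α → ℕ → ℕ}
  {tab : α → ℕ → ℕ → ℕ → ℕ}

/-- One more table: if the entries computed from the tables `a < k` are those of table `k`, then
filling the array `k` leads from `k` known tables to `k + 1` known tables. -/
theorem Spec.table (k L₁ L₂ L₃ : ℕ) (init : WExp) (t : Test) (e : WExp) (K : α → ℕ)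
    (h₁ : (decide (L₁ ∉ [10, 11, 12, 13]) && decide (L₂ ∉ [10, 11, 12, 13]) &&
      decide (L₃ ∉ [10, 11, 12, 13]) && init.avoids k && t.avoids k && e.avoids k) = true)
    (hd : ∀ x S, Sizes (n x) S → (S.var L₁ = rows x k ∧ S.var L₂ = cols x k ∧ S.var L₃ = K x) ∧
      (rows x k ≤ 2 * n x + 1 ∧ cols x k ≤ 2 * n x + 1 ∧ K x ≤ 2 * n x + 1))
    (hG : ∀ x S, good x → Known (n x) (rows x) (cols x) (tab x) k S →
      ∀ i < rows x k, ∀ j < cols x k, fillVal S init t e i j (K x) = tab x k i j) :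
    Spec n 3 (.fill k L₁ L₂ L₃ init t e)
      (fun x s => good x ∧ ∃ S, Known (n x) (rows x) (cols x) (tab x) k S ∧ St S s)
      (fun x s => good x ∧ ∃ S, Known (n x) (rows x) (cols x) (tab x) (k + 1) S ∧ St S s) := by
  refine Spec.conseq (α := α × Store) (sz := fun x => n x.1) (Spec.fillSt
    (good := fun x => good x.1 ∧ Known (n x.1) (rows x.1) (cols x.1) (tab x.1) k x.2)
        (S := Prod.snd)
    k L₁ L₂ L₃ init t e (fun x => rows x.1 k) (fun x => cols x.1 k) (fun x => K x.1)
    (fun x => tab x.1 k) h₁ (fun x h => ⟨h.2.v0, (hd x.1 x.2 h.2.toSizes).1⟩)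
    (fun x h => ⟨(hd x.1 x.2 h.2.toSizes).2, .inl rfl⟩) fun x h => hG x.1 x.2 h.1 h.2) le_rfl ?_
  rintro x s ⟨hx, S, hS, hs⟩
  refine ⟨(x, S), rfl, ⟨⟨hx, hS⟩, hs⟩,
      fun s' hs' => ⟨hx, _, ⟨hS.toSizes.putTab _ _ _ _, ?_, ?_, ?_⟩,
    hs'.2⟩⟩
  · intro a ha i hi j hj
    simp only [Store.putTab]
    rcases Nat.lt_succ_iff_lt_or_eq.1 ha with ha | rfl
    · rw [if_neg (by omega), hS.get a ha i hi j hj]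
    · rw [if_pos ⟨rfl, hi, hj⟩]
  · intro a ha
    funext i j
    simp only [Store.putTab]
    rw [if_neg (by omega), hS.zero a (by omega)]
  · exact hS.num

end

/-- The update of a state by `Prog.scatter`. -/
theorem Spec.scatterSt {α : Type*} {sz : α → ℕ} {good : α → Prop} {S : α → Store} (a L : ℕ)
    (e₁ e₂ e₃ : WExp) (N : α → ℕ) (F : α → ℕ → ℕ → ℕ) (f g : α → ℕ → ℕ)
    (h₁ : (decide (L ∉ [10, 11, 12, 13]) && e₁.avoids a && e₂.avoids a && e₃.avoids a) = true)
    (hS : ∀ x, good x → (S x).var 0 = sz x ∧ (S x).var L = N x ∧ N x ≤ 2 * sz x + 1)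
    (he : ∀ x s k, good x → St (S x) s → k < N x → e₁.eval (s.at k) = f x k ∧
      e₂.eval (s.at k) = g x k ∧ e₃.eval (s.at k) = F x (f x k) (g x k))
    (hfg : ∀ x i j, good x → i < N x → j < N x → f x i = f x j → g x i = g x j → i = j)
    (hF : ∀ x i j, good x → (∀ k < N x, ¬ (f x k = i ∧ g x k = j)) → F x i j = (S x).arr a i j) :
    Spec sz 1 (.scatter a L e₁ e₂ e₃) (fun x s => good x ∧ St (S x) s)
      (fun x s => good x ∧ St
          { S x with arr := fun b => if b = a then F x else (S x).arr b } s) := by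
  simp only [Bool.and_eq_true, decide_eq_true_eq] at h₁
  refine (Spec.scatter a L e₁ e₂ e₃ h₁.1.1.1 h₁.1.1.2 h₁.1.2 h₁.2).conseq le_rfl ?_
  rintro x s ⟨hx, hs⟩
  obtain ⟨g0, g1, g2⟩ := hS x hx
  have e0 := (hs.var 0 (by simp)).trans g0
  have e1 := (hs.var L h₁.1.1.1).trans g1
  refine ⟨s, e0, ⟨rfl, by omega, ?_⟩, ?_⟩
  · intro i hi j hj h2 h3
    rw [e1] at hi hj
    obtain ⟨a1, a2, -⟩ := he x s i hx hs hi
    obtain ⟨b1, b2, -⟩ := he x s j hx hs hj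
    exact hfg x i j hx hi hj (by omega) (by omega)
  · rintro s' ⟨hA, hT, hO⟩
    refine ⟨hx, fun y hy => ?_, ?_, ?_⟩
    · rw [hA.2.1 y hy, hs.var y hy]
    · funext b
      by_cases hb : b = a
      · subst hb
        simp only [if_pos]
        funext i j
        by_cases hij : ∃ k < N x, f x k = i ∧ g x k = j
        · obtain ⟨k, hk, rfl, rfl⟩ := hij
          obtain ⟨a1, a2, a3⟩ := he x s k hx hs hk
          have := hT k (by omega)
          rw [a1, a2, a3] at this
          exact this
        · push Not at hij
          rw [hF x i j hx fun k hk h => hij k hk h.1 h.2, hO i j, hs.arr]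
          intro k hk h
          rw [e1] at hk
          obtain ⟨a1, a2, -⟩ := he x s k hx hs hk
          exact hij k hk (by omega) (by omega)
      · simp only [if_neg hb]
        rw [hA.2.2 b hb, hs.arr]
    · rw [hA.1, hs.num]

/-! ### Tables for the blocks -/

/-- A graph with a perfect elimination order. -/
structure OrderCtx where
  /-- the number of vertices -/
  n : ℕ
  /-- the graph -/
  adj : ℕ → ℕ → Prop
  /-- the positions of the vertices -/
  pos : ℕ → ℕ

/-- The graph is a rooted directed path graph, and the positions are a perfect elimination order. -/
structure OrderCtx.Good (x : OrderCtx) : Prop where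
  model : Nonempty (RootedModel x.n x.adj)
  peo : PEO x.n x.adj x.pos

/-- The cliques of the elimination order. -/
def OrderCtx.Q (x : OrderCtx) : ℕ → ℕ → Prop := Clq x.adj x.pos

/-- The blocks. -/
def OrderCtx.C (x : OrderCtx) : ℕ → ℕ → Prop := Block x.n x.adj x.pos

/-- The boundaries of the blocks. -/
def OrderCtx.K (x : OrderCtx) (b : ℕ) : ℕ → Prop := Bd x.adj (x.C b)

/-- The seeds of the blocks, including block `2n`. -/
def OrderCtx.seed (x : OrderCtx) (b j : ℕ) : Prop :=
  (b < 2 * x.n ∧ _root_.seed x.n x.adj x.pos b j) ∨ b = 2 * x.n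

open Classical in
/-- The size of a block. -/
noncomputable def OrderCtx.size (x : OrderCtx) (b : ℕ) : ℕ := cnt x.n (x.C b)

/-- The number of blocks that come before `b` when blocks are sorted by their size. -/
noncomputable def OrderCtx.rank (x : OrderCtx) (b : ℕ) : ℕ :=
  cnt (2 * x.n + 1) fun k => x.size k < x.size b ∨ (x.size k = x.size b ∧ k < b)

/-- The number of rows of the tables. -/
def OrderCtx.rows (x : OrderCtx) : ℕ → ℕ
  | 0 | 7 | 8 | 9 | 22 | 23 | 24 | 25 => x.n
  | 1 | 10 | 11 | 21 | 26 | 27 | 28 => 1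
  | 12 | 15 | 16 | 17 | 18 | 19 | 20 | 29 | 30 => 2 * x.n + 1
  | _ => 0

/-- The number of columns of the tables. -/
def OrderCtx.cols (x : OrderCtx) : ℕ → ℕ
  | 0 | 1 | 7 | 8 | 9 | 10 | 12 | 15 | 16 | 17 | 23 | 29 | 30 => x.n
  | 11 | 22 | 24 | 25 => 2 * x.n
  | 18 | 19 | 20 | 21 | 26 | 27 | 28 => 2 * x.n + 1
  | _ => 0

/-- The last `k < K` with `f k = p`, or `0`. -/
noncomputable def inverse (f : ℕ → ℕ) (K p : ℕ) : ℕ := lastOf (fun k => f k = p) K - 1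

/-- The tables. Table `12` holds the blocks once they have been completed; the array `13` is a
buffer, and `14` is not used. The arrays `2, …, 6` belong to the computation of the elimination
order. -/
noncomputable def OrderCtx.tab (x : OrderCtx) : ℕ → ℕ → ℕ → ℕ
  | 0, i, j => ind (x.adj i j)
  | 1, _, j => x.pos j
  | 7, v, u => ind (x.Q v u)
  | 8, v, u => ind (Later x.adj x.pos v u)
  | 9, e, f => ind (∃ k < x.n, Later x.adj x.pos e k ∧ ¬ x.Q f k)
  | 10, _, p => inverse x.pos x.n p
  | 11, _, b => blockBase x.n b
  | 12, b, u => ind (x.C b u)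
  | 15, b, w => ind (x.K b w)
  | 16, b, u => ind (∃ w < x.n, x.K b w ∧ x.adj u w)
  | 17, b, u => ind (∃ w < x.n, x.K b w ∧ ¬ x.adj u w)
  | 18, l, i => ind (Mixed x.adj x.C l i)
  | 19, i, b => ind (∃ u < x.n, x.C i u ∧ x.C b u)
  | 20, i, l => ind (∃ w < x.n, x.K i w ∧ ¬ x.K l w)
  | 21, _, b => blockKey x.n x.adj x.C b
  | 22, R, l => ind (¬ Splits x.adj x.Q x.C R l)
  | 23, R, u => compOf x.n x.adj x.Q x.C R u
  | 24, R, l => partner x.n x.adj x.Q x.C R l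
  | 25, R, l => ind (Dead x.n x.adj x.Q x.C R l)
  | 26, _, b => x.size b
  | 27, _, b => x.rank b
  | 28, _, p => inverse x.rank (2 * x.n + 1) p
  | 29, b, R => ind (∃ w < x.n, (x.K b w ∧ ¬ x.Q R w) ∨ (x.Q R w ∧ ¬ x.K b w ∧ ¬ x.C b w))
  | 30, b, R => ind (∃ w < x.n, x.Q R w ∧ x.C b w)
  | _, _, _ => 0

/-- Storing the counter computes an inverse function. -/
theorem fillVal_inverse {s : Store} {t : Test} {i j K : ℕ} {f : ℕ → ℕ} {p : ℕ}
    (h : ∀ k < K, ∀ r, t.holds (s.loc i j k r) ↔ f k = p) :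
    fillVal s (.lit 0) t idx i j K = inverse f K p := by
  induction K with
  | zero => simp [fillVal, WExp.eval, inverse, lastOf]
  | succ K ih =>
    rw [fillVal, inverse, lastOf, ih fun k hk => h k (by omega)]
    simp only [propext (h K (by omega) _)]
    split_ifs <;> simp [WExp.eval, Store.loc, inverse]

/-- For injective `f`, `inverse f K` is the inverse function of `f` on `0, …, K - 1`. -/
theorem inverse_eq {f : ℕ → ℕ} {K : ℕ} (hf : ∀ i < K, ∀ j < K, f i = f j → i = j) {k : ℕ}
    (hk : k < K) : inverse f K (f k) = k := by
  have h1 := le_lastOf (φ := fun i => f i = f k) hk rfl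
  obtain ⟨l, hl⟩ : ∃ l,
      lastOf (fun i => f i = f k) K = l + 1 := ⟨lastOf (fun i => f i = f k) K - 1, by omega⟩
  obtain ⟨h2, h3⟩ := lastOf_eq_succ hl
  rw [inverse, hl, Nat.add_sub_cancel]
  exact hf l h2 k hk h3

/-- An injective function from `0, …, K - 1` to itself is onto. -/
theorem exists_of_inj {f : ℕ → ℕ} {K : ℕ} (hf : ∀ i < K, ∀ j < K, f i = f j → i = j)
    (hK : ∀ i < K, f i < K) {p : ℕ} (hp : p < K) : ∃ i < K, f i = p := by
  have h1 : Function.Injective fun i : Fin K => (⟨f i, hK i i.2⟩ : Fin K) := fun i j h =>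
    Fin.ext (hf i i.2 j j.2 (by simpa using h))
  obtain ⟨i, hi⟩ := (Finite.injective_iff_surjective.1 h1) ⟨p, hp⟩
  exact ⟨i, i.2, by simpa using hi⟩

theorem cnt_succ_of {φ : ℕ → Prop} {K : ℕ} (h : φ K) : cnt (K + 1) φ = cnt K φ + 1 := by
  classical
  rw [cnt, cnt, Finset.range_add_one, Finset.filter_insert, if_pos h, Finset.card_insert_of_notMem]
  simp

theorem cnt_succ_of_not {φ : ℕ → Prop} {K : ℕ} (h : ¬ φ K) : cnt (K + 1) φ = cnt K φ := by
  classical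
  rw [cnt, cnt, Finset.range_add_one, Finset.filter_insert, if_neg h]

open Classical in
/-- Decrementing the accumulator where the test holds subtracts a cardinality. Sums and differences
of words are computed in this way. -/
theorem fillVal_pred {s : Store} {t : Test} {i j K : ℕ} {init : WExp} {φ : ℕ → Prop}
    (h : ∀ k < K, ∀ r, t.holds (s.loc i j k r) ↔ φ k) :
    fillVal s init t (.pred acc) i j K = init.eval (s.loc i j 0 0) - cnt K φ := by
  induction K with
  | zero => simp [fillVal, cnt]
  | succ K ih =>
    rw [fillVal, ih fun k hk => h k (by omega)]
    by_cases hK : φ K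
    · rw [if_pos ((h K (by omega) _).2 hK), cnt_succ_of hK]
      simp [WExp.eval, Store.loc]
      omega
    · rw [if_neg (fun h' => hK ((h K (by omega) _).1 h')), cnt_succ_of_not hK]

/-- The tables that are needed for finding the blocks. -/
def blockProg₁ : Prog :=
  .seq (.fill 7 0 0 1 (.lit 0) (.or (.eq col row)
    (.and (.on 0 row col) (.lt (.arr 1 (.lit 0) row) (.arr 1 (.lit 0) col)))) (.lit 1)) <|
  .seq (.fill 8 0 0 1 (.lit 0)
    (.and (.on 0 row col) (.lt (.arr 1 (.lit 0) row) (.arr 1 (.lit 0) col))) (.lit 1)) <|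
  .seq (.fill 9 0 0 0 (.lit 0) (.and (.on 8 row idx) (.off 7 col idx)) (.lit 1)) <|
  .seq (.fill 10 1 0 0 (.lit 0) (.eq (.arr 1 (.lit 0) idx) col) idx) <|
  .fill 11 1 2 0 col (.not (.lt col (.var 0))) (.pred acc)

theorem Spec.blockProg₁ : Spec OrderCtx.n 3 blockProg₁
    (fun x s => x.Good ∧ ∃ S, Known x.n x.rows x.cols x.tab 7 S ∧ St S s)
    (fun x s => x.Good ∧ ∃ S, Known x.n x.rows x.cols x.tab 12 S ∧ St S s) := by
  refine Spec.seq (Spec.table 7 0 0 1 _ _ _ (fun _ => 1) (by decide) ?_ ?_) <|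
    Spec.seq (Spec.table 8 0 0 1 _ _ _ (fun _ => 1) (by decide) ?_ ?_) <|
    Spec.seq (Spec.table 9 0 0 0 _ _ _ OrderCtx.n (by decide) ?_ ?_) <|
    Spec.seq (Spec.table 10 1 0 0 _ _ _ OrderCtx.n (by decide) ?_ ?_) <|
    Spec.table 11 1 2 0 _ _ _ OrderCtx.n (by decide) ?_ ?_
  · intro x S h
    simp [h.v0, h.v1, OrderCtx.rows, OrderCtx.cols]; omega
  · intro x S hx h i hi j hj
    have h0 : ∀ i < x.n, ∀ j < x.n, S.arr 0 i j = ind (x.adj i j) := h.get 0 (by omega)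
    have h1 : ∀ i < 1, ∀ j < x.n, S.arr 1 i j = x.pos j := h.get 1 (by omega)
    change i < x.n at hi
    change j < x.n at hj
    refine fillVal_one fun r => ?_
    simp [Test.holds, WExp.eval, Store.loc, h0 i hi j hj, h1 0 (by omega) i hi,
        h1 0 (by omega) j hj,
      OrderCtx.Q, Clq, Later]
  · intro x S h
    simp [h.v0, h.v1, OrderCtx.rows, OrderCtx.cols]; omega
  · intro x S hx h i hi j hj
    have h0 : ∀ i < x.n, ∀ j < x.n, S.arr 0 i j = ind (x.adj i j) := h.get 0 (by omega)
    have h1 : ∀ i < 1, ∀ j < x.n, S.arr 1 i j = x.pos j := h.get 1 (by omega)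
    change i < x.n at hi
    change j < x.n at hj
    refine fillVal_one fun r => ?_
    simp [Test.holds, WExp.eval, Store.loc, h0 i hi j hj, h1 0 (by omega) i hi,
        h1 0 (by omega) j hj,
      Later]
  · intro x S h
    simp [h.v0, h.v1, OrderCtx.rows, OrderCtx.cols]; omega
  · intro x S hx h i hi j hj
    have h7 : ∀ i < x.n, ∀ j < x.n, S.arr 7 i j = ind (x.Q i j) := h.get 7 (by omega)
    have h8 : ∀ i < x.n, ∀ j < x.n, S.arr 8 i j = ind (Later x.adj x.pos i j) := h.get 8 (by omega)
    change i < x.n at hi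
    change j < x.n at hj
    refine fillVal_ex fun k hk r => ?_
    simp [Test.holds, WExp.eval, Store.loc, h8 i hi k hk, h7 j hj k hk]
  · intro x S h
    simp [h.v0, h.v1, OrderCtx.rows, OrderCtx.cols]; omega
  · intro x S hx h i hi j hj
    have h1 : ∀ i < 1, ∀ j < x.n, S.arr 1 i j = x.pos j := h.get 1 (by omega)
    refine fillVal_inverse fun k hk r => ?_
    simp [Test.holds, WExp.eval, Store.loc, h1 0 (by omega) k hk]
  · intro x S h
    simp [h.v0, h.v1, h.v2, OrderCtx.rows, OrderCtx.cols]; omega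
  · intro x S hx h i hi j hj
    rw [fillVal_pred (φ := fun _ => ¬ j < x.n)]
    · change _ = blockBase x.n j
      unfold blockBase
      split_ifs with hjn
      · simp [hjn, cnt, WExp.eval, Store.loc]
      · simp [hjn, cnt, WExp.eval, Store.loc]
    · intro k hk r
      simp [Test.holds, WExp.eval, Store.loc, h.v0]

/-! ### Computing the blocks -/

/-- Change the values of some tables without changing the first ones. -/
theorem Known.congr {n : ℕ} {rows cols : ℕ → ℕ} {tab tab' : ℕ → ℕ → ℕ → ℕ} {k k' : ℕ} {S : Store}
    (h : Known n rows cols tab k S) (hk : k ≤ k')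
    (ht : ∀ a < k', ∀ i < rows a, ∀ j < cols a, a < k ∧ tab' a i j = tab a i j) :
    Known n rows cols tab' k' S :=
  ⟨h.toSizes, fun a ha i hi j hj => by
    rw [(ht a ha i hi j hj).2, h.get a (ht a ha i hi j hj).1 i hi j hj],
    fun a ha => h.zero a (hk.trans ha), h.num⟩

theorem Known.setVar {n : ℕ} {rows cols : ℕ → ℕ} {tab : ℕ → ℕ → ℕ → ℕ} {k : ℕ} {S : Store}
    (h : Known n rows cols tab k S) {y : ℕ} (hy : 5 ≤ y) (v : ℕ) :
    Known n rows cols tab k (S.setVar y v) :=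
  ⟨h.toSizes.setVar hy v, h.get, h.zero, h.num⟩

/-- The tables while the blocks are being completed, with `cur` in place of the blocks. -/
noncomputable def OrderCtx.tabCur (x : OrderCtx) (cur : ℕ → ℕ → Prop) (a i j : ℕ) : ℕ :=
  if a = 12 then ind (cur i j) else x.tab a i j

/-- The table of the seeds. -/
def seedProg : Prog :=
  .fill 12 3 0 0 (.lit 0)
      (.or (.not (.lt row (.var 2))) (.or (.and (.lt row (.var 0)) (.eq col row))
    (.and (.not (.lt row (.var 0))) (.and (.on 8 (.arr 11 (.lit 0) row) idx)
      (.and (.off 9 (.arr 11 (.lit 0) row) idx) (.and (.on 8 idx col)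
        (.off 8 (.arr 11 (.lit 0) row) col))))))) (.lit 1)

theorem Spec.seedProg : Spec OrderCtx.n 3 seedProg
    (fun x s => x.Good ∧ ∃ S, Known x.n x.rows x.cols x.tab 12 S ∧ St S s)
    (fun x s => x.Good ∧ ∃ S, Known x.n x.rows x.cols (x.tabCur x.seed) 13 S ∧ St S s) := by
  refine Spec.conseq (Spec.table (good := OrderCtx.Good) (n := OrderCtx.n) (rows := OrderCtx.rows)
    (cols := OrderCtx.cols) (tab := fun x => x.tabCur x.seed) 12 3 0 0 _ _ _ OrderCtx.n
    (by decide) ?_ ?_) le_rfl ?_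
  · intro x S h
    simp [h.v0, h.v3, OrderCtx.rows, OrderCtx.cols]; omega
  · intro x S hx h i hi j hj
    obtain ⟨M⟩ := hx.model
    have h8 : ∀ i < x.n, ∀ j < x.n, S.arr 8 i j = ind (Later x.adj x.pos i j) := h.get 8 (by omega)
    have h9 : ∀ i < x.n, ∀ j < x.n, S.arr 9 i j =
      ind (∃ k < x.n, Later x.adj x.pos i k ∧ ¬ x.Q j k) := h.get 9 (by omega)
    have h11 : ∀ i < 1, ∀ j < 2 * x.n, S.arr 11 i j = blockBase x.n j := h.get 11 (by omega)
    change i < 2 * x.n + 1 at hi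
    change j < x.n at hj
    change _ = ind (x.seed i j)
    rw [fillVal_ex (φ := fun k => i = 2 * x.n ∨ (i < x.n ∧ j = i) ∨ (x.n ≤ i ∧ i < 2 * x.n ∧
      Later x.adj x.pos (i - x.n) k ∧ (∀ l, Later x.adj x.pos (i - x.n) l → x.Q k l) ∧
      Later x.adj x.pos k j ∧ ¬ Later x.adj x.pos (i - x.n) j))]
    · congr 1
      apply propext
      unfold OrderCtx.seed _root_.seed
      constructor
      · rintro ⟨k, hk, e | e | ⟨h1, h2, h3, h4, h5⟩⟩
        · exact .inr e
        · exact .inl ⟨by omega, by rw [if_pos e.1]; exact e.2⟩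
        · exact .inl ⟨by omega, by rw [if_neg (by omega)]; exact ⟨k, h3, h4, h5⟩⟩
      · rintro (⟨h1, h2⟩ | h1)
        · split_ifs at h2 with h3
          · exact ⟨j, hj, .inr (.inl ⟨h3, h2⟩)⟩
          · obtain ⟨f, h4, h5, h6⟩ := h2
            exact ⟨f, M.adj_lt h4.1, .inr (.inr ⟨by omega, h1, h4, h5, h6⟩)⟩
        · exact ⟨j, hj, .inl h1⟩
    · intro k hk r
      by_cases h1 : i < x.n
      · have h2 : ¬ i = 2 * x.n := by omega
        have h3 : i < 2 * x.n := by omega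
        simp [Test.holds, WExp.eval, Store.loc, h.v0, h.v2, h1, h2, h3]
      · by_cases h2 : i = 2 * x.n
        · simp [Test.holds, WExp.eval, Store.loc, h.v0, h.v2, h2]
        · have h3 : i < 2 * x.n := by omega
          have h4 : blockBase x.n i = i - x.n := if_neg h1
          have h5 : x.n ≤ i := by omega
          have h6 : i - x.n < x.n := by omega
          have h7 : (∀ l < x.n, Later x.adj x.pos (i - x.n) l → x.Q k l) ↔
              ∀ l, Later x.adj x.pos (i - x.n) l → x.Q k l :=
            ⟨fun h l hl => h l (M.adj_lt hl.1) hl, fun h l _ => h l⟩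
          simp [Test.holds, WExp.eval, Store.loc, h.v0, h.v2, h1, h2, h3, h11 0 (by omega) i h3, h4,
            h5, h8 _ h6 k hk, h9 _ h6 k hk, h8 k hk j hj, h8 _ h6 j hj, h7]
  · rintro x s ⟨hx, S, hS, hs⟩
    refine ⟨x, rfl, ⟨hx, S, hS.congr le_rfl fun a ha i _ j _ => ⟨ha, if_neg (by omega)⟩, hs⟩,
      fun _ h => h⟩

/-- Add the vertex in variable `21` to the blocks that contain a neighbour of it, unless it is
deleted. -/
def sweepStep : Prog :=
  .seq (.fill 13 1 2 0 (.lit 0) (.or (.on 12 col (.var 21)) (.and (.on 12 col idx)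
    (.and (.on 0 (.var 21) idx) (.off 8 (.arr 11 (.lit 0) col) (.var 21))))) (.lit 1))
  (.scatter 12 2 (.var 10) (.var 21) (.arr 13 (.lit 0) (.var 10)))

/-- The effect of `sweepStep`. -/
def OrderCtx.grow (x : OrderCtx) (cur : ℕ → ℕ → Prop) (u b v : ℕ) : Prop :=
  cur b v ∨ (b < 2 * x.n ∧ v = u ∧
    ∃ k < x.n, cur b k ∧ x.adj u k ∧ ¬ Later x.adj x.pos (blockBase x.n b) u)

/-- The data of a step: the graph, the current sets, the vertex and the state. -/
structure SweepCtx where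
  /-- the graph and the elimination order -/
  x : OrderCtx
  /-- the current subsets of the blocks -/
  cur : ℕ → ℕ → Prop
  /-- the vertex -/
  u : ℕ
  /-- the state before the step -/
  S : Store

/-- All blocks are treated at once, in `O(n²)` steps: the new column of the table of the blocks is
computed in the array `13` and then copied. -/
theorem Spec.sweepStep : Spec (fun c : SweepCtx => c.x.n) 2 sweepStep
    (fun c s => (c.S.var 21 = c.u ∧ c.u < c.x.n ∧
      Known c.x.n c.x.rows c.x.cols (c.x.tabCur c.cur) 14 c.S) ∧ St c.S s)
    (fun c s => ∃ S', S'.var = c.S.var ∧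
      Known c.x.n c.x.rows c.x.cols (c.x.tabCur (c.x.grow c.cur c.u)) 14 S' ∧ St S' s) := by
  refine Spec.conseq (α := SweepCtx) (sz := fun c => c.x.n) (Spec.seq
    (Spec.fillSt (good := fun c : SweepCtx => c.S.var 21 = c.u ∧ c.u < c.x.n ∧
        Known c.x.n c.x.rows c.x.cols (c.x.tabCur c.cur) 14 c.S)
      (S := SweepCtx.S) 13 1 2 0 _ _ _ (fun _ => 1) (fun c => 2 * c.x.n) (fun c => c.x.n)
      (fun c _ b => ind (c.x.grow c.cur c.u b c.u)) (by decide) ?_ ?_ ?_)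
    ((Spec.scatterSt 12 2 _ _ _ (fun c => 2 * c.x.n) (fun c b u => open Classical in
      if b < 2 * c.x.n ∧ u = c.u then ind (c.x.grow c.cur c.u b c.u) else c.S.arr 12 b u)
      (fun _ k => k) (fun c _ => c.u) (by decide) ?_ ?_ ?_ ?_).conseq (d' := 2) (by omega)
      fun y s h => ⟨y, rfl, h, fun _ h => h⟩)) le_rfl ?_
  · intro c h
    simp [h.2.2.v0, h.2.2.v1, h.2.2.v2]
  · intro c h
    omega
  · rintro c ⟨h1, h2, h⟩ i hi j hj
    have h0 : ∀ i < c.x.n, ∀ j < c.x.n, c.S.arr 0 i j = ind (c.x.adj i j) := h.get 0 (by omega)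
    have h8 : ∀ i < c.x.n, ∀ j < c.x.n, c.S.arr 8 i j = ind (Later c.x.adj c.x.pos i j) :=
      h.get 8 (by omega)
    have h11 : ∀ i < 1, ∀ j < 2 * c.x.n, c.S.arr 11 i j = blockBase c.x.n j := h.get 11 (by omega)
    have h12 : ∀ i < 2 * c.x.n + 1, ∀ j < c.x.n, c.S.arr 12 i j = ind (c.cur i j) :=
      h.get 12 (by omega)
    have hb : blockBase c.x.n j < c.x.n := by unfold blockBase; split_ifs <;> omega
    rw [fillVal_ex (φ := fun k => c.cur j c.u ∨ (c.cur j k ∧ c.x.adj c.u k ∧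
      ¬ Later c.x.adj c.x.pos (blockBase c.x.n j) c.u))]
    · congr 1
      apply propext
      constructor
      · rintro ⟨k, hk, e | e⟩
        · exact .inl e
        · exact .inr ⟨hj, rfl, k, hk, e⟩
      · rintro (e | ⟨-, -, k, hk, e⟩)
        · exact ⟨c.u, h2, .inl e⟩
        · exact ⟨k, hk, .inr e⟩
    · intro k hk r
      simp [Test.holds, WExp.eval, Store.loc, h1, h0 _ h2 k hk, h11 0 (by omega) j hj, h8 _ hb _ h2,
        h12 j (by omega) _ h2, h12 j (by omega) k hk]
  · rintro c ⟨h1, h2, h⟩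
    refine ⟨h.v0, h.v2, by omega⟩
  · rintro c s k ⟨h1, h2, h⟩ hs hk
    simp [WExp.eval, Store.at, Store.setVar, hs.var, hs.arr, Store.putTab, h1, hk]
  · intro c i j h hi hj he _
    exact he
  · rintro c i j h hne
    rw [if_neg]
    · simp [Store.putTab]
    · rintro ⟨h1, h2⟩
      exact hne i h1 ⟨rfl, h2.symm⟩
  · rintro c s ⟨⟨h1, h2, h⟩, hs⟩
    refine ⟨c, rfl, ⟨⟨h1, h2, h⟩, hs⟩, fun s' hs' => ⟨_, ?_, ?_, hs'.2⟩⟩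
    · rfl
    refine ⟨⟨h.v0, h.v1, h.v2, h.v3, h.v4⟩, ?_, ?_, h.num⟩
    · intro a ha i hi j hj
      have hg := h.get a ha i hi j hj
      by_cases ha12 : a = 12
      · subst ha12
        simp only [OrderCtx.tabCur, if_true] at hg ⊢
        split_ifs with hc
        · rw [hc.2]
        · rw [hg]
          congr 1
          apply propext
          refine ⟨.inl, ?_⟩
          rintro (e | e)
          · exact e
          · exact absurd ⟨e.1, e.2.1⟩ hc
      · by_cases ha13 : a = 13
        · subst ha13
          exact absurd hi (by simp [OrderCtx.rows])
        · simp only [OrderCtx.tabCur, ha12, if_false] at hg ⊢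
          simp [Store.putTab, ha13, hg]
    · intro a ha
      funext i j
      have : a ≠ 12 ∧ a ≠ 13 := by omega
      simp [Store.putTab, this, h.zero a ha]

/-- The invariant of the sweep in the order of the positions. -/
structure OrderCtx.Ascending (x : OrderCtx) (cur : ℕ → ℕ → Prop) (k : ℕ) : Prop where
  seed : ∀ b u, x.seed b u → cur b u
  sub : ∀ b < 2 * x.n, ∀ u, cur b u → x.C b u
  up : ∀ b < 2 * x.n, ∀ u v,
      x.C b u → x.pos u < k → x.adj u v → x.pos v < x.pos u → cur b v → cur b u

/-- The invariant of the sweep in the reverse order of the positions. -/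
structure OrderCtx.Descending (x : OrderCtx) (cur : ℕ → ℕ → Prop) (k : ℕ) : Prop where
  seed : ∀ b u, x.seed b u → cur b u
  sub : ∀ b < 2 * x.n, ∀ u, cur b u → x.C b u
  last : ∀ b < 2 * x.n, ∀ u, x.C b u → (∀ v, x.C b v → x.pos v ≤ x.pos u) → cur b u
  late : ∀ b < 2 * x.n, ∀ u, x.C b u → x.n ≤ x.pos u + k → cur b u

/-- A block contains the neighbours of its vertices, unless they are deleted. -/
theorem OrderCtx.Good.grow_sub {x : OrderCtx} (hx : x.Good) {cur : ℕ → ℕ → Prop} {u : ℕ}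
    (h : ∀ b < 2 * x.n, ∀ u, cur b u → x.C b u) :
    ∀ b < 2 * x.n, ∀ v, x.grow cur u b v → x.C b v := by
  rintro b hb v (e | ⟨-, rfl, k, -, h1, h2, h3⟩)
  · exact h b hb v e
  · exact PEO.block_closed hb (h b hb k h1) (hx.peo.symm h2) h3

/-- The vertex at position `k` is added to each block in which an earlier neighbour of it has been
found. -/
theorem OrderCtx.Ascending.step {x : OrderCtx} (hx : x.Good) {cur : ℕ → ℕ → Prop} {k : ℕ}
    (h : x.Ascending cur k) {u : ℕ} (hu : u < x.n) (huk : x.pos u = k) :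
    x.Ascending (x.grow cur u) (k + 1) := by
  refine ⟨fun b v hv => .inl (h.seed b v hv), hx.grow_sub h.sub, ?_⟩
  intro b hb w v hw hwk hwv hvw hv
  have hwn := hx.peo.block_lt hw
  have hv' : cur b v := by
    rcases hv with e | ⟨-, rfl, -⟩
    · exact e
    · omega
  rcases Nat.lt_succ_iff_lt_or_eq.1 hwk with h1 | h1
  · exact .inl (h.up b hb w v hw h1 hwv hvw hv')
  · obtain rfl := hx.peo.inj hwn hu (h1.trans huk.symm)
    exact .inr ⟨hb, rfl, v, hx.peo.lt hwv, hv', hwv, hx.peo.block_not_later hb hw⟩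

/-- After the ascending sweep the last vertex of each block has been found: in a connected set each
other vertex has a later neighbour in the set. -/
theorem OrderCtx.Ascending.descending {x : OrderCtx} (hx : x.Good) {cur : ℕ → ℕ → Prop}
    (h : x.Ascending cur x.n) : x.Descending cur 0 := by
  refine ⟨h.seed, h.sub, ?_, ?_⟩
  · intro b hb d hd hmax
    have hs : ∃ s, cur b s := by
      have hd' := hd
      unfold OrderCtx.C Block at hd'
      rw [if_pos hb] at hd'
      obtain ⟨s, hs, -⟩ := hd'
      exact ⟨s, h.seed b s (.inl ⟨hb, hs⟩)⟩
    obtain ⟨c, hc, hcm⟩ := exists_pos_max (n := x.n) x.pos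
      (fun v hv => hx.peo.block_lt (h.sub b hb v hv)) hs
    have hcC := h.sub b hb c hc
    have hcn := hx.peo.block_lt hcC
    rcases (hmax c hcC).eq_or_lt with e | e
    · rwa [← hx.peo.inj hcn (hx.peo.block_lt hd) e]
    · obtain ⟨c', h1, h2, h3⟩ := hx.peo.exists_later (fun v hv => hx.peo.block_lt hv)
        (hx.peo.block_conn hb) hcC hd e
      have h4 := h.up b hb c' c h1 (hx.peo.pos_lt (hx.peo.block_lt h1)) (hx.peo.symm h2) h3 hc
      exact absurd (hcm c' h4) (by omega)
  · intro b hb u hu hun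
    exact absurd (hx.peo.pos_lt (hx.peo.block_lt hu)) (by omega)

/-- A vertex of a block that is not the last one has a later neighbour in the block, which has been
found before. -/
theorem OrderCtx.Descending.step {x : OrderCtx} (hx : x.Good) {cur : ℕ → ℕ → Prop} {k : ℕ}
    (h : x.Descending cur k) {u : ℕ} (hu : u < x.n) (huk : x.pos u + k + 1 = x.n) :
    x.Descending (x.grow cur u) (k + 1) := by
  refine ⟨fun b v hv => .inl (h.seed b v hv), hx.grow_sub h.sub,
    fun b hb v hv hm => .inl (h.last b hb v hv hm), ?_⟩
  intro b hb v hv hvk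
  by_cases h1 : x.n ≤ x.pos v + k
  · exact .inl (h.late b hb v hv h1)
  obtain rfl := hx.peo.inj (hx.peo.block_lt hv) hu (by omega)
  by_cases h2 : ∀ w, x.C b w → x.pos w ≤ x.pos v
  · exact .inl (h.last b hb v hv h2)
  push Not at h2
  obtain ⟨d, hd, hvd⟩ := h2
  obtain ⟨c, h3, h4, h5⟩ := hx.peo.exists_later (fun v hv => hx.peo.block_lt hv)
    (hx.peo.block_conn hb) hv hd hvd
  exact .inr ⟨hb, rfl, c, hx.peo.lt h4, h.late b hb c h3 (by omega), h4,
    hx.peo.block_not_later hb hv⟩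

/-- After both sweeps the blocks are complete. -/
theorem OrderCtx.Descending.eq {x : OrderCtx} {cur : ℕ → ℕ → Prop}
    (h : x.Descending cur x.n) {b u : ℕ} (hb : b < 2 * x.n + 1) (hu : u < x.n) :
    cur b u ↔ x.C b u := by
  rcases Nat.lt_succ_iff_lt_or_eq.1 hb with h1 | rfl
  · exact ⟨h.sub b h1 u, fun hu => h.late b h1 u hu (by omega)⟩
  · refine ⟨fun _ => ?_, fun _ => h.seed _ _ (.inr rfl)⟩
    unfold OrderCtx.C Block
    rwa [if_neg (by omega)]

/-- The table `10` lists the vertices by their positions. -/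
theorem OrderCtx.Good.ordr {x : OrderCtx} (hx : x.Good) {p : ℕ} (hp : p < x.n) :
    inverse x.pos x.n p < x.n ∧ x.pos (inverse x.pos x.n p) = p := by
  have hinj : ∀ i < x.n, ∀ j < x.n, x.pos i = x.pos j → i = j := fun i hi j hj => hx.peo.inj hi hj
  obtain ⟨u, hu, rfl⟩ := exists_of_inj hinj (fun i hi => hx.peo.pos_lt hi) hp
  rw [inverse_eq hinj hu]
  exact ⟨hu, rfl⟩

/-- Compute the blocks from the seeds. -/
def sweepProg : Prog :=
  .seq (.for 20 0 (.seq (.setVar 21 (.arr 10 (.lit 0) (.var 20))) sweepStep)) <|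
  .seq (.setVar 22 (.var 0)) <|
  .for 20 0 (.seq (.setVar 22 (.pred (.var 22)))
    (.seq (.setVar 21 (.arr 10 (.lit 0) (.var 22))) sweepStep))

theorem Spec.sweepProg : Spec OrderCtx.n 3 sweepProg
    (fun x s => x.Good ∧ ∃ S, Known x.n x.rows x.cols (x.tabCur x.seed) 13 S ∧ St S s)
    (fun x s => x.Good ∧ ∃ S, Known x.n x.rows x.cols x.tab 15 S ∧ St S s) := by
  refine Spec.seq (Mid := fun x s => x.Good ∧ ∃ cur S, x.Ascending cur x.n ∧
      Known x.n x.rows x.cols (x.tabCur cur) 14 S ∧ St S s)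
    (Spec.for (d := 2) OrderCtx.n (fun x k s => x.Good ∧ ∃ cur S, x.Ascending cur k ∧
      Known x.n x.rows x.cols (x.tabCur cur) 14 S ∧ St S s) (by decide) (fun x => by omega)
      ?_ ?_ fun x s h => h) <|
    Spec.seq (Mid := fun x s => x.Good ∧ ∃ cur S, x.Descending cur 0 ∧ S.var 22 = x.n ∧
      Known x.n x.rows x.cols (x.tabCur cur) 14 S ∧ St S s) (Spec.setVar ?_)
    (Spec.for (d := 2) OrderCtx.n (fun x k s => x.Good ∧ ∃ cur S, x.Descending cur k ∧
      S.var 22 = x.n - k ∧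
      Known x.n x.rows x.cols (x.tabCur cur) 14 S ∧ St S s) (by decide) (fun x => by omega)
      ?_ ?_ ?_)
  · rintro x s ⟨hx, S, h, hs⟩
    refine ⟨(hs.var 0 (by simp)).trans h.v0, hx, x.seed, _, ⟨fun _ _ h => h, ?_, ?_⟩,
      Known.setVar (h.congr (k' := 14) (by omega) ?_) (y := 20) (by omega) 0, hs.setVar 20 0⟩
    · rintro b hb u (e | e)
      · exact PEO.block_of_seed hb e.2
      · omega
    · intro b _ u v _ h1
      omega
    · intro a ha i hi j hj
      refine ⟨?_, rfl⟩
      by_contra ha'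
      obtain rfl : a = 13 := by omega
      exact absurd hi (by simp [OrderCtx.rows])
  · refine Spec.seq (Mid := fun (c : OrderCtx × ℕ) s => ∃ cur S, (c.1.Good ∧ c.2 < c.1.n ∧
      c.1.Ascending cur c.2 ∧ S.var 20 = c.2 ∧ S.var 21 = inverse c.1.pos c.1.n c.2 ∧
      Known c.1.n c.1.rows c.1.cols (c.1.tabCur cur) 14 S) ∧ St S s) (Spec.setVar ?_)
      (Spec.conseq Spec.sweepStep le_rfl ?_)
    · rintro ⟨x, k⟩ s ⟨hk, h1, h2, hx, cur, S, hc, h, hs⟩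
      refine ⟨cur, _, ⟨hx, hk, hc, ?_, ?_, h.setVar (y := 21) (by omega) _⟩, hs.setVar 21 _⟩
      · simpa [Store.setVar, ← hs.var 20 (by simp)] using h1
      · have h10 : ∀ i < 1, ∀ j < x.n, S.arr 10 i j = inverse x.pos x.n j := h.get 10 (by omega)
        simp only at h1 hk
        simp [Store.setVar, WExp.eval, hs.arr, h1, h10 0 (by omega) k hk]
    · rintro ⟨x, k⟩ s ⟨cur, S, ⟨hx, hk, hc, h20, h21, h⟩, hs⟩
      obtain ⟨h3, h4⟩ := hx.ordr hk
      refine ⟨⟨x, cur, _, S⟩, rfl, ⟨⟨h21, h3, h⟩, hs⟩, ?_⟩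
      rintro s' ⟨S', hv, h', hs'⟩
      exact ⟨(hs'.var 20 (by simp)).trans (by rw [hv]; exact h20),
        (hs'.var 0 (by simp)).trans h'.v0, hx, _, _, hc.step hx h3 h4,
        h'.setVar (y := 20) (by omega) (k + 1), hs'.setVar 20 _⟩
  · rintro x s ⟨hx, cur, S, hc, h, hs⟩
    refine ⟨hx, cur, _, hc.descending hx, ?_, h.setVar (y := 22) (by omega) _, hs.setVar 22 _⟩
    simp [Store.setVar, WExp.eval, hs.var, h.v0]
  · rintro x s ⟨hx, cur, S, hc, h22, h, hs⟩
    refine ⟨(hs.var 0 (by simp)).trans h.v0, hx, cur, _, hc, ?_,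
      h.setVar (y := 20) (by omega) 0, hs.setVar 20 0⟩
    simpa [Store.setVar] using h22
  · refine Spec.seq (Mid := fun (c : OrderCtx × ℕ) s => ∃ cur S, (c.1.Good ∧ c.2 < c.1.n ∧
      c.1.Descending cur c.2 ∧ S.var 20 = c.2 ∧ S.var 22 = c.1.n - c.2 - 1 ∧
      Known c.1.n c.1.rows c.1.cols (c.1.tabCur cur) 14 S) ∧ St S s) (Spec.setVar ?_) <|
      Spec.seq (Mid := fun (c : OrderCtx × ℕ) s => ∃ cur S, (c.1.Good ∧ c.2 < c.1.n ∧
      c.1.Descending cur c.2 ∧ S.var 20 = c.2 ∧ S.var 22 = c.1.n - c.2 - 1 ∧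
      S.var 21 = inverse c.1.pos c.1.n (c.1.n - c.2 - 1) ∧
      Known c.1.n c.1.rows c.1.cols (c.1.tabCur cur) 14 S) ∧ St S s) (Spec.setVar ?_)
      (Spec.conseq Spec.sweepStep le_rfl ?_)
    · rintro ⟨x, k⟩ s ⟨hk, h1, h2, hx, cur, S, hc, h22, h, hs⟩
      refine ⟨cur, _, ⟨hx, hk, hc, ?_, ?_, h.setVar (y := 22) (by omega) _⟩, hs.setVar 22 _⟩
      · simpa [Store.setVar, ← hs.var 20 (by simp)] using h1
      · simp [Store.setVar, WExp.eval, hs.var, h22]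
    · rintro ⟨x, k⟩ s ⟨cur, S, ⟨hx, hk, hc, h20, h22, h⟩, hs⟩
      refine ⟨cur, _, ⟨hx, hk, hc, ?_, ?_, ?_, h.setVar (y := 21) (by omega) _⟩, hs.setVar 21 _⟩
      · simpa [Store.setVar] using h20
      · simpa [Store.setVar] using h22
      · have h10 : ∀ i < 1, ∀ j < x.n, S.arr 10 i j = inverse x.pos x.n j := h.get 10 (by omega)
        simp only at h22 hk
        simp [Store.setVar, WExp.eval, hs.arr, hs.var, h22,
          h10 0 (by omega) (x.n - k - 1) (by omega)]
    · rintro ⟨x, k⟩ s ⟨cur, S, ⟨hx, hk, hc, h20, h22, h21, h⟩, hs⟩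
      change k < x.n at hk
      obtain ⟨h3, h4⟩ : inverse x.pos x.n (x.n - k - 1) < x.n ∧
        x.pos (inverse x.pos x.n (x.n - k - 1)) = x.n - k - 1 :=
            OrderCtx.Good.ordr (x := x) hx (by omega)
      have h5 := OrderCtx.Descending.step (x := x) (k := k) hx hc h3 (by omega)
      refine ⟨⟨x, cur, _, S⟩, rfl, ⟨⟨h21, h3, h⟩, hs⟩, ?_⟩
      rintro s' ⟨S', hv, h', hs'⟩
      refine ⟨(hs'.var 20 (by simp)).trans (by rw [hv]; exact h20),
        (hs'.var 0 (by simp)).trans h'.v0, hx, _, _, h5, ?_,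
        h'.setVar (y := 20) (by omega) (k + 1), hs'.setVar 20 _⟩
      simp only [Store.setVar, hv]
      simp only at h22
      simp [h22]
      omega
  · rintro x s ⟨hx, cur, S, hc, -, h, hs⟩
    refine ⟨hx, S, h.congr (by omega) ?_, hs⟩
    intro a ha i hi j hj
    refine ⟨?_, ?_⟩
    · by_contra ha'
      obtain rfl : a = 14 := by omega
      exact absurd hi (by simp [OrderCtx.rows])
    · unfold OrderCtx.tabCur
      split_ifs with h1
      · subst h1
        exact congrArg ind (propext (hc.eq hi hj).symm)
      · rfl

/-! ### Tables for the relations between blocks and cliques -/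

/-- Incrementing the accumulator twice where the test holds adds twice a cardinality. -/
theorem fillVal_count_two {s : Store} {t : Test} {i j K : ℕ} {init : WExp} {φ : ℕ → Prop}
    (h : ∀ k < K, ∀ r, t.holds (s.loc i j k r) ↔ φ k) :
    fillVal s init t (.succ (.succ acc)) i j K = init.eval (s.loc i j 0 0) + 2 * cnt K φ := by
  classical
  induction K with
  | zero => simp [fillVal, cnt]
  | succ K ih =>
    rw [fillVal, ih fun k hk => h k (by omega)]
    by_cases hK : φ K
    · rw [if_pos ((h K (by omega) _).2 hK), cnt_succ_of hK]
      simp [WExp.eval, Store.loc]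
      omega
    · rw [if_neg (fun h' => hK ((h K (by omega) _).1 h')), cnt_succ_of_not hK]

namespace OrderCtx

variable {x : OrderCtx} {k : ℕ} {S : Store}

theorem get_adj (h : Known x.n x.rows x.cols x.tab k S) (hk : 0 < k) :
    ∀ i < x.n, ∀ j < x.n, S.arr 0 i j = ind (x.adj i j) := h.get 0 hk

theorem get_clique (h : Known x.n x.rows x.cols x.tab k S) (hk : 7 < k) :
    ∀ i < x.n, ∀ j < x.n, S.arr 7 i j = ind (x.Q i j) := h.get 7 hk

theorem get_block (h : Known x.n x.rows x.cols x.tab k S) (hk : 12 < k) :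
    ∀ i < 2 * x.n + 1, ∀ j < x.n, S.arr 12 i j = ind (x.C i j) := h.get 12 hk

theorem get_boundary (h : Known x.n x.rows x.cols x.tab k S) (hk : 15 < k) :
    ∀ i < 2 * x.n + 1, ∀ j < x.n, S.arr 15 i j = ind (x.K i j) := h.get 15 hk

theorem get_mixed (h : Known x.n x.rows x.cols x.tab k S) (hk : 18 < k) :
    ∀ i < 2 * x.n + 1, ∀ j < 2 * x.n + 1, S.arr 18 i j = ind (Mixed x.adj x.C i j) := h.get 18 hk

theorem get_inter (h : Known x.n x.rows x.cols x.tab k S) (hk : 19 < k) :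
    ∀ i < 2 * x.n + 1, ∀ j < 2 * x.n + 1, S.arr 19 i j = ind (∃ u < x.n, x.C i u ∧ x.C j u) :=
  h.get 19 hk

theorem get_key (h : Known x.n x.rows x.cols x.tab k S) (hk : 21 < k) :
    ∀ i < 1, ∀ j < 2 * x.n + 1, S.arr 21 i j = blockKey x.n x.adj x.C j := h.get 21 hk

theorem get_splits (h : Known x.n x.rows x.cols x.tab k S) (hk : 22 < k) :
    ∀ i < x.n, ∀ j < 2 * x.n, S.arr 22 i j = ind (¬ Splits x.adj x.Q x.C i j) := h.get 22 hk

theorem get_comp (h : Known x.n x.rows x.cols x.tab k S) (hk : 23 < k) :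
    ∀ i < x.n, ∀ j < x.n, S.arr 23 i j = compOf x.n x.adj x.Q x.C i j := h.get 23 hk

theorem get_partner (h : Known x.n x.rows x.cols x.tab k S) (hk : 24 < k) :
    ∀ i < x.n, ∀ j < 2 * x.n, S.arr 24 i j = partner x.n x.adj x.Q x.C i j := h.get 24 hk

theorem get_dead (h : Known x.n x.rows x.cols x.tab k S) (hk : 25 < k) :
    ∀ i < x.n, ∀ j < 2 * x.n, S.arr 25 i j = ind (Dead x.n x.adj x.Q x.C i j) := h.get 25 hk

theorem get_sorted (h : Known x.n x.rows x.cols x.tab k S) (hk : 28 < k) :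
    ∀ i < 1, ∀ j < 2 * x.n + 1, S.arr 28 i j = inverse x.rank (2 * x.n + 1) j := h.get 28 hk

theorem Good.bd_lt (hx : x.Good) {b w : ℕ} (h : x.K b w) : w < x.n := by
  obtain ⟨_, u, _, h2⟩ := h
  exact hx.peo.lt h2

theorem Good.block_lt (hx : x.Good) {b u : ℕ} (h : x.C b u) : u < x.n := hx.peo.block_lt h

end OrderCtx

/-- The tables of the boundaries and of the relations between two blocks. -/
def blockProg₂ : Prog :=
  .seq (.fill 15 3 0 0 (.lit 0) (.and (.off 12 row col) (.and (.on 12 row idx) (.on 0 idx col)))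
    (.lit 1)) <|
  .seq (.fill 16 3 0 0 (.lit 0) (.and (.on 15 row idx) (.on 0 col idx)) (.lit 1)) <|
  .seq (.fill 17 3 0 0 (.lit 0) (.and (.on 15 row idx) (.off 0 col idx)) (.lit 1)) <|
  .seq (.fill 18 3 3 0 (.lit 0) (.and (.on 12 col idx) (.and (.on 16 row idx) (.on 17 row idx)))
    (.lit 1)) <|
  .seq (.fill 19 3 3 0 (.lit 0) (.and (.on 12 row idx) (.on 12 col idx)) (.lit 1)) <|
  .seq (.fill 20 3 3 0 (.lit 0) (.and (.on 15 row idx) (.off 15 col idx)) (.lit 1)) <|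
  .fill 21 1 3 0 (.arr 18 col col) (.off 15 col idx) (.succ (.succ acc))

theorem Spec.blockProg₂ : Spec OrderCtx.n 3 blockProg₂
    (fun x s => x.Good ∧ ∃ S, Known x.n x.rows x.cols x.tab 15 S ∧ St S s)
    (fun x s => x.Good ∧ ∃ S, Known x.n x.rows x.cols x.tab 22 S ∧ St S s) := by
  refine Spec.seq (Spec.table 15 3 0 0 _ _ _ OrderCtx.n (by decide) ?_ ?_) <|
    Spec.seq (Spec.table 16 3 0 0 _ _ _ OrderCtx.n (by decide) ?_ ?_) <|
    Spec.seq (Spec.table 17 3 0 0 _ _ _ OrderCtx.n (by decide) ?_ ?_) <|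
    Spec.seq (Spec.table 18 3 3 0 _ _ _ OrderCtx.n (by decide) ?_ ?_) <|
    Spec.seq (Spec.table 19 3 3 0 _ _ _ OrderCtx.n (by decide) ?_ ?_) <|
    Spec.seq (Spec.table 20 3 3 0 _ _ _ OrderCtx.n (by decide) ?_ ?_) <|
    Spec.table 21 1 3 0 _ _ _ OrderCtx.n (by decide) ?_ ?_
  · intro x S h
    simp [h.v0, h.v3, OrderCtx.rows, OrderCtx.cols]; omega
  · intro x S hx h i hi j hj
    have h0 := OrderCtx.get_adj h (by omega)
    have h12 := OrderCtx.get_block h (by omega)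
    change i < 2 * x.n + 1 at hi
    change j < x.n at hj
    refine (fillVal_ex (φ := fun k => ¬ x.C i j ∧ x.C i k ∧ x.adj k j) fun k hk r => ?_).trans ?_
    · simp [Test.holds, WExp.eval, Store.loc, h0 k hk j hj, h12 i hi k hk, h12 i hi j hj]
    · change _ = ind (Bd _ _ _)
      congr 1
      exact propext ⟨fun ⟨k, _, h1, h2, h3⟩ => ⟨h1, k, h2, h3⟩,
        fun ⟨h1, k, h2, h3⟩ => ⟨k, hx.block_lt h2, h1, h2, h3⟩⟩
  · intro x S h
    simp [h.v0, h.v3, OrderCtx.rows, OrderCtx.cols]; omega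
  · intro x S hx h i hi j hj
    have h0 := OrderCtx.get_adj h (by omega)
    have h15 := OrderCtx.get_boundary h (by omega)
    change i < 2 * x.n + 1 at hi
    change j < x.n at hj
    refine fillVal_ex fun k hk r => ?_
    simp [Test.holds, WExp.eval, Store.loc, h0 j hj k hk, h15 i hi k hk]
  · intro x S h
    simp [h.v0, h.v3, OrderCtx.rows, OrderCtx.cols]; omega
  · intro x S hx h i hi j hj
    have h0 := OrderCtx.get_adj h (by omega)
    have h15 := OrderCtx.get_boundary h (by omega)
    change i < 2 * x.n + 1 at hi
    change j < x.n at hj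
    refine fillVal_ex fun k hk r => ?_
    simp [Test.holds, WExp.eval, Store.loc, h0 j hj k hk, h15 i hi k hk]
  · intro x S h
    simp [h.v0, h.v3, OrderCtx.rows, OrderCtx.cols]; omega
  · intro x S hx h i hi j hj
    have h12 := OrderCtx.get_block h (by omega)
    have h16 : ∀ i < 2 * x.n + 1, ∀ j < x.n, S.arr 16 i j = ind (∃ w < x.n, x.K i w ∧ x.adj j w) :=
      h.get 16 (by omega)
    have h17 : ∀ i < 2 * x.n + 1, ∀ j < x.n,
        S.arr 17 i j = ind (∃ w < x.n, x.K i w ∧ ¬ x.adj j w) :=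
      h.get 17 (by omega)
    change i < 2 * x.n + 1 at hi
    change j < 2 * x.n + 1 at hj
    refine (fillVal_ex (φ := fun k => x.C j k ∧ (∃ w < x.n, x.K i w ∧ x.adj k w) ∧
      ∃ w < x.n, x.K i w ∧ ¬ x.adj k w) fun k hk r => ?_).trans ?_
    · simp [Test.holds, WExp.eval, Store.loc, h12 j hj k hk, h16 i hi k hk, h17 i hi k hk]
    · change _ = ind (Mixed _ _ _ _)
      congr 1
      exact propext ⟨fun ⟨k, _, h1, ⟨w, _, h2⟩, ⟨v, _, h3⟩⟩ => ⟨k, h1, ⟨w, h2⟩, ⟨v, h3⟩⟩,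
        fun ⟨k, h1, ⟨w, h2⟩, ⟨v, h3⟩⟩ => ⟨k, hx.block_lt h1, h1, ⟨w, hx.bd_lt h2.1, h2⟩,
          ⟨v, hx.bd_lt h3.1, h3⟩⟩⟩
  · intro x S h
    simp [h.v0, h.v3, OrderCtx.rows, OrderCtx.cols]; omega
  · intro x S hx h i hi j hj
    have h12 := OrderCtx.get_block h (by omega)
    change i < 2 * x.n + 1 at hi
    change j < 2 * x.n + 1 at hj
    refine fillVal_ex fun k hk r => ?_
    simp [Test.holds, WExp.eval, Store.loc, h12 j hj k hk, h12 i hi k hk]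
  · intro x S h
    simp [h.v0, h.v3, OrderCtx.rows, OrderCtx.cols]; omega
  · intro x S hx h i hi j hj
    have h15 := OrderCtx.get_boundary h (by omega)
    change i < 2 * x.n + 1 at hi
    change j < 2 * x.n + 1 at hj
    refine fillVal_ex fun k hk r => ?_
    simp [Test.holds, WExp.eval, Store.loc, h15 j hj k hk, h15 i hi k hk]
  · intro x S h
    simp [h.v0, h.v1, h.v3, OrderCtx.rows, OrderCtx.cols]; omega
  · intro x S hx h i hi j hj
    have h15 := OrderCtx.get_boundary h (by omega)
    have h18 := OrderCtx.get_mixed h (by omega)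
    change j < 2 * x.n + 1 at hj
    refine (fillVal_count_two (φ := fun k => ¬ x.K j k) fun k hk r => ?_).trans ?_
    · simp [Test.holds, WExp.eval, Store.loc, h15 j hj k hk]
    · simp [WExp.eval, Store.loc, h18 j hj j hj]
      rfl

/-- The tables of the components of the graph minus a clique, of the blocks sorted by size, and of
the candidates for the top node of a block. -/
def blockProg₃ : Prog :=
  .seq (.fill 22 0 2 0 (.lit 0) (.or (.and (.on 15 col idx) (.off 7 row idx))
    (.and (.on 12 col idx) (.on 7 row idx))) (.lit 1)) <|
  .seq (.fill 23 0 0 2 (.lit 0) (.and (.off 22 row idx) (.on 12 idx col)) (.succ idx)) <|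
  .seq (.fill 24 0 2 2 (.lit 0) (.and (.and (.off 22 row idx) (.and (.on 18 col idx)
    (.and (.on 18 idx col) (.off 19 idx col)))) (.or (.eq acc (.lit 0))
      (.lt (.arr 21 (.lit 0) idx) (.arr 21 (.lit 0) (.pred acc))))) (.succ idx)) <|
  .seq (.fill 25 0 2 2 (.lit 0) (.and (.and (.off 22 row idx) (.and (.on 18 col idx)
    (.and (.on 18 idx col) (.off 19 idx col)))) (.on 20 idx (.pred (.arr 24 row col)))) (.lit 1)) <|
  .seq (.fill 26 1 3 0 (.lit 0) (.on 12 col idx) (.succ acc)) <|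
  .seq (.fill 27 1 3 3 (.lit 0) (.or (.lt (.arr 26 (.lit 0) idx) (.arr 26 (.lit 0) col))
    (.and (.eq (.arr 26 (.lit 0) idx) (.arr 26 (.lit 0) col)) (.lt idx col))) (.succ acc)) <|
  .seq (.fill 28 1 3 3 (.lit 0) (.eq (.arr 27 (.lit 0) idx) col) idx) <|
  .seq (.fill 29 3 0 0 (.lit 0) (.or (.and (.on 15 row idx) (.off 7 col idx))
    (.and (.on 7 col idx) (.and (.off 15 row idx) (.off 12 row idx)))) (.lit 1)) <|
  .fill 30 3 0 0 (.lit 0) (.and (.on 7 col idx) (.on 12 row idx)) (.lit 1)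

theorem argMin_le (φ : ℕ → Prop) (key : ℕ → ℕ) (K : ℕ) : argMin φ key K ≤ K := by
  rcases argMin_spec φ key K with h | ⟨m, hm, h, -⟩ <;> omega

theorem partner_le {n : ℕ} {adj Q C : ℕ → ℕ → Prop} {R l : ℕ} : partner n adj Q C R l ≤ 2 * n :=
  argMin_le _ _ _

theorem Spec.blockProg₃ : Spec OrderCtx.n 3 blockProg₃
    (fun x s => x.Good ∧ ∃ S, Known x.n x.rows x.cols x.tab 22 S ∧ St S s)
    (fun x s => x.Good ∧ ∃ S, Known x.n x.rows x.cols x.tab 31 S ∧ St S s) := by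
  have conflict : ∀ (x : OrderCtx) (S : Store) (k : ℕ), x.Good → Known x.n x.rows x.cols x.tab k S →
      22 < k → ∀ i < x.n, ∀ j < 2 * x.n, ∀ l < 2 * x.n, (S.arr 22 i l = 0 ∧ S.arr 18 j l = 1 ∧
        S.arr 18 l j = 1 ∧ S.arr 19 l j = 0 ↔ Conflict x.adj x.Q x.C i j l) := by
    intro x S k hx h hk i hi j hj l hl
    rw [OrderCtx.get_splits h hk i hi l hl,
        OrderCtx.get_mixed h (by omega) j (by omega) l (by omega),
      OrderCtx.get_mixed h (by omega) l (by omega) j (by omega),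
      OrderCtx.get_inter h (by omega) l (by omega) j (by omega), ind_eq_zero, ind_eq_zero,
          ind_eq_one,
      ind_eq_one, not_not]
    have : (∃ u < x.n, x.C l u ∧ x.C j u) ↔ ∃ u, x.C l u ∧ x.C j u :=
      ⟨fun ⟨u, _, h⟩ => ⟨u, h⟩, fun ⟨u, h⟩ => ⟨u, hx.block_lt h.1, h⟩⟩
    rw [this]
    rfl
  refine Spec.seq (Spec.table 22 0 2 0 _ _ _ OrderCtx.n (by decide) ?_ ?_) <|
    Spec.seq (Spec.table 23 0 0 2 _ _ _ (fun x => 2 * x.n) (by decide) ?_ ?_) <|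
    Spec.seq (Spec.table 24 0 2 2 _ _ _ (fun x => 2 * x.n) (by decide) ?_ ?_) <|
    Spec.seq (Spec.table 25 0 2 2 _ _ _ (fun x => 2 * x.n) (by decide) ?_ ?_) <|
    Spec.seq (Spec.table 26 1 3 0 _ _ _ OrderCtx.n (by decide) ?_ ?_) <|
    Spec.seq (Spec.table 27 1 3 3 _ _ _ (fun x => 2 * x.n + 1) (by decide) ?_ ?_) <|
    Spec.seq (Spec.table 28 1 3 3 _ _ _ (fun x => 2 * x.n + 1) (by decide) ?_ ?_) <|
    Spec.seq (Spec.table 29 3 0 0 _ _ _ OrderCtx.n (by decide) ?_ ?_) <|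
    Spec.table 30 3 0 0 _ _ _ OrderCtx.n (by decide) ?_ ?_
  · intro x S h
    simp [h.v0, h.v2, OrderCtx.rows, OrderCtx.cols]; omega
  · intro x S hx h i hi j hj
    have h7 := OrderCtx.get_clique h (by omega)
    have h12 := OrderCtx.get_block h (by omega)
    have h15 := OrderCtx.get_boundary h (by omega)
    change i < x.n at hi
    change j < 2 * x.n at hj
    refine (fillVal_ex (φ := fun k => (x.K j k ∧ ¬ x.Q i k) ∨ (x.C j k ∧ x.Q i k))
      fun k hk r => ?_).trans ?_
    · simp [Test.holds, WExp.eval, Store.loc, h7 i hi k hk, h15 j (by omega) k hk,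
        h12 j (by omega) k hk]
    · change _ = ind (¬ Splits _ _ _ _ _)
      congr 1
      apply propext
      constructor
      · rintro ⟨k, hk, e | e⟩ ⟨h1, h2⟩
        · exact e.2 (h1 k e.1)
        · exact h2 k e.1 e.2
      · intro hno
        by_contra! h1
        exact hno ⟨fun w hw => (h1 w (hx.bd_lt hw)).1 hw,
          fun w hw => (h1 w (hx.block_lt hw)).2 hw⟩
  · intro x S h
    simp [h.v0, h.v2, OrderCtx.rows, OrderCtx.cols]; omega
  · intro x S hx h i hi j hj
    have h12 := OrderCtx.get_block h (by omega)
    have h22 := OrderCtx.get_splits h (by omega)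
    change i < x.n at hi
    change j < x.n at hj
    refine fillVal_last fun k hk r => ?_
    simp [Test.holds, WExp.eval, Store.loc, h22 i hi k hk, h12 k (by omega) j hj]
  · intro x S h
    simp [h.v0, h.v2, OrderCtx.rows, OrderCtx.cols]; omega
  · intro x S hx h i hi j hj
    have hc := conflict x S _ hx h (by omega)
    have h21 := OrderCtx.get_key h (by omega)
    change i < x.n at hi
    change j < 2 * x.n at hj
    refine fillVal_argMin fun k hk r hr => and_congr (Iff.trans ?_ (hc i hi j hj k hk)) ?_
    · simp [Test.holds, WExp.eval, Store.loc]
    · simp [Test.holds, WExp.eval, Store.loc, h21 0 (by omega) k (by omega),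
        h21 0 (by omega) (r - 1) (by omega)]
  · intro x S h
    simp [h.v0, h.v2, OrderCtx.rows, OrderCtx.cols]; omega
  · intro x S hx h i hi j hj
    have hc := conflict x S _ hx h (by omega)
    have h24 := OrderCtx.get_partner h (by omega)
    have h20 : ∀ i < 2 * x.n + 1, ∀ j < 2 * x.n + 1, S.arr 20 i j =
      ind (∃ w < x.n, x.K i w ∧ ¬ x.K j w) := h.get 20 (by omega)
    change i < x.n at hi
    change j < 2 * x.n at hj
    refine (fillVal_ex (φ := fun k => Conflict x.adj x.Q x.C i j k ∧
      ∃ w < x.n, x.K k w ∧ ¬ x.K (partner x.n x.adj x.Q x.C i j - 1) w) fun k hk r => ?_).trans ?_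
    · refine and_congr (Iff.trans ?_ (hc i hi j hj k hk)) ?_
      · simp [Test.holds, WExp.eval, Store.loc]
      have hp := partner_le (n := x.n) (adj := x.adj) (Q := x.Q) (C := x.C) (R := i) (l := j)
      simp [Test.holds, WExp.eval, Store.loc, h24 i hi j hj, h20 k (by omega)
        (partner x.n x.adj x.Q x.C i j - 1) (by omega)]
    · change _ = ind (Dead _ _ _ _ _ _)
      congr 1
      exact propext ⟨fun ⟨k, hk, h1, w, _, h2⟩ => ⟨k, hk, h1, w, h2⟩,
        fun ⟨k, hk, h1, w, h2⟩ => ⟨k, hk, h1, w, hx.bd_lt h2.1, h2⟩⟩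
  · intro x S h
    simp [h.v0, h.v1, h.v3, OrderCtx.rows, OrderCtx.cols]; omega
  · intro x S hx h i hi j hj
    have h12 := OrderCtx.get_block h (by omega)
    change j < 2 * x.n + 1 at hj
    refine (fillVal_count (φ := fun k => x.C j k) fun k hk r => ?_).trans ?_
    · simp [Test.holds, WExp.eval, Store.loc, h12 j hj k hk]
    · rw [WExp.eval, zero_add]
      rfl
  · intro x S h
    simp [h.v1, h.v3, OrderCtx.rows, OrderCtx.cols]
  · intro x S hx h i hi j hj
    have h26 : ∀ i < 1, ∀ j < 2 * x.n + 1, S.arr 26 i j = x.size j := h.get 26 (by omega)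
    change j < 2 * x.n + 1 at hj
    refine (fillVal_count (φ := fun k => x.size k < x.size j ∨ (x.size k = x.size j ∧ k < j))
      fun k hk r => ?_).trans ?_
    · simp [Test.holds, WExp.eval, Store.loc, h26 0 (by omega) k hk, h26 0 (by omega) j hj]
    · rw [WExp.eval, zero_add]
      rfl
  · intro x S h
    simp [h.v1, h.v3, OrderCtx.rows, OrderCtx.cols]
  · intro x S hx h i hi j hj
    have h27 : ∀ i < 1, ∀ j < 2 * x.n + 1, S.arr 27 i j = x.rank j := h.get 27 (by omega)
    refine fillVal_inverse fun k hk r => ?_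
    simp [Test.holds, WExp.eval, Store.loc, h27 0 (by omega) k hk]
  · intro x S h
    simp [h.v0, h.v3, OrderCtx.rows, OrderCtx.cols]; omega
  · intro x S hx h i hi j hj
    have h7 := OrderCtx.get_clique h (by omega)
    have h12 := OrderCtx.get_block h (by omega)
    have h15 := OrderCtx.get_boundary h (by omega)
    change i < 2 * x.n + 1 at hi
    change j < x.n at hj
    refine fillVal_ex fun k hk r => ?_
    simp [Test.holds, WExp.eval, Store.loc, h7 j hj k hk, h15 i hi k hk, h12 i hi k hk]
  · intro x S h
    simp [h.v0, h.v3, OrderCtx.rows, OrderCtx.cols]; omega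
  · intro x S hx h i hi j hj
    have h7 := OrderCtx.get_clique h (by omega)
    have h12 := OrderCtx.get_block h (by omega)
    change i < 2 * x.n + 1 at hi
    change j < x.n at hj
    refine fillVal_ex fun k hk r => ?_
    simp [Test.holds, WExp.eval, Store.loc, h7 j hj k hk, h12 i hi k hk]

/-! ### Finding the top nodes of the blocks -/

namespace OrderCtx

variable {x : OrderCtx}

theorem Good.blocks (hx : x.Good) : Blocks x.n x.adj x.Q x.C where
  symm := hx.peo.symm
  irrefl := hx.peo.irrefl
  adj_lt := hx.peo.lt
  lt := hx.block_lt
  conn hb := hx.peo.block_conn hb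
  univ hu := by
    unfold OrderCtx.C Block
    rwa [if_neg (by omega)]
  clique := hx.peo.clq_clique

/-- Every possible top node of a block in a rooted clique tree is accepted, as the components of
the graph minus a maximal clique are blocks. -/
theorem Good.exists_accept (hx : x.Good) {M : RootedModel x.n x.adj} {b : ℕ} {y : M.N}
    (hy : M.TopNode x.C y b) {top : ℕ → ℕ}
    (htop : ∀ l < 2 * x.n, ∀ y', M.TopNode x.C y' l → x.size l < x.size b → top l ≠ 0) :
    ∃ R < x.n, Accept x.n x.adj x.Q x.C top b R := by
  refine M.exists_accept hx.blocks (fun y => ?_) (fun y D hD hlt hne hd hK => ?_) hy htop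
  · obtain ⟨u, hu⟩ := hy.meets
    exact hx.peo.exists_clq ((Nat.zero_le _).trans_lt (M.mem_lt hu.2)) (M.isMaxClique y)
  · obtain ⟨b, hb, h⟩ := hx.peo.exists_block (M.isMaxClique y) hD hlt hne hd hK
    exact ⟨b, hb, funext fun u => propext (h u)⟩

/-- The root of a rooted clique tree is a top node of the block of all vertices. -/
theorem Good.root_topNode (hx : x.Good) (hn : 0 < x.n) (M : RootedModel x.n x.adj) :
    ∃ r, M.TopNode x.C r (2 * x.n) := by
  obtain ⟨r, hr⟩ := M.root
  have hu : ∀ {u}, x.C (2 * x.n) u ↔ u < x.n := ⟨hx.block_lt, hx.blocks.univ⟩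
  have hne : ∃ v, M.mem r v := by
    by_contra! h
    exact h 0 (M.maximal hn fun u hu => absurd hu (h u))
  obtain ⟨v, hv⟩ := hne
  refine ⟨r, le_rfl, ⟨v, hu.2 (M.mem_lt hv), hv⟩, fun _ y _ _ => hr y, ?_,
    fun w hw => .inr (hu.2 (M.mem_lt hw))⟩
  rintro w ⟨h1, u, -, h2⟩
  exact absurd (hu.2 (hx.peo.lt h2)) h1

theorem rank_lt {b : ℕ} (hb : b < 2 * x.n + 1) : x.rank b < 2 * x.n + 1 := by
  refine (cnt_lt (ψ := fun _ => True) (fun _ _ _ => trivial) hb trivial ?_).trans_le cnt_le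
  simp

/-- Smaller blocks have smaller ranks, hence are processed earlier. -/
theorem rank_lt_rank {b c : ℕ} (hb : b < 2 * x.n + 1)
    (h : x.size b < x.size c ∨ (x.size b = x.size c ∧ b < c)) : x.rank b < x.rank c := by
  refine cnt_lt (fun k _ hk => ?_) hb h (by simp)
  omega

theorem rank_inj {b c : ℕ} (hb : b < 2 * x.n + 1) (hc : c < 2 * x.n + 1)
    (h : x.rank b = x.rank c) : b = c := by
  by_contra hne
  rcases Nat.lt_trichotomy (x.size b) (x.size c) with h1 | h1 | h1
  · exact absurd (rank_lt_rank hb (.inl h1)) (by omega)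
  · rcases Nat.lt_or_gt_of_ne hne with h2 | h2
    · exact absurd (rank_lt_rank hb (.inr ⟨h1, h2⟩)) (by omega)
    · exact absurd (rank_lt_rank hc (.inr ⟨h1.symm, h2⟩)) (by omega)
  · exact absurd (rank_lt_rank hc (.inl h1)) (by omega)

/-- The table `28` lists the blocks by their ranks. -/
theorem sorted {p : ℕ} (hp : p < 2 * x.n + 1) :
    inverse x.rank (2 * x.n + 1) p < 2 * x.n + 1 ∧
      x.rank (inverse x.rank (2 * x.n + 1) p) = p := by
  obtain ⟨b, hb, rfl⟩ := exists_of_inj (f := x.rank) (fun i hi j hj => rank_inj hi hj)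
    (fun i hi => rank_lt hi) hp
  rw [inverse_eq (fun i hi j hj => rank_inj hi hj) hb]
  exact ⟨hb, rfl⟩

end OrderCtx

/-- Only the positions of the vertices in `C` matter. -/
theorem IsTreeOrder.congr {n : ℕ} {adj : ℕ → ℕ → Prop} {K C : ℕ → Prop} {ρ ρ' : ℕ → ℕ}
    (h : IsTreeOrder n adj K C ρ) (hρ : ∀ u, C u → ρ' u = ρ u) : IsTreeOrder n adj K C ρ' := by
  refine ⟨fun u hu => by rw [hρ u hu]; exact h.lt u hu,
    fun u v hu hv he => h.inj u v hu hv (by rwa [hρ u hu, hρ v hv] at he), ?_⟩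
  intro u x w l hu hx hux hw hl
  rw [hρ u hu, hρ x hx] at hux
  refine h.order u x w l hu hx hux (hw.imp id fun h' => ⟨h'.1, ?_⟩) (hl.imp id fun h' => ⟨h'.1, ?_⟩)
  · rw [← hρ w h'.1, ← hρ u hu]; exact h'.2
  · rw [← hρ l h'.1, ← hρ u hu]; exact h'.2

/-- The state after `k` blocks have been processed. The array `33` holds the top nodes, increased by
one, and row `b + 1` of the array `35` holds the order of block `b`. -/
structure OrderCtx.TopInv (x : OrderCtx) (k : ℕ) (S : Store) : Prop
    extends Known x.n x.rows x.cols x.tab 36 S where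
  pos : 0 < x.n
  good : x.Good
  row : ∀ u, S.arr 35 0 u = 0
  tree : ∀ l < 2 * x.n + 1,
      S.arr 33 0 l ≠ 0 → IsTreeOrder x.n x.adj (x.K l) (x.C l) (S.arr 35 (l + 1))
  done : ∀ b < 2 * x.n + 1, x.rank b < k → ∀ (M : RootedModel x.n x.adj) (y : M.N),
    M.TopNode x.C y b → S.arr 33 0 b ≠ 0

theorem OrderCtx.TopInv.setVar {x : OrderCtx} {k : ℕ} {S : Store} (h : x.TopInv k S) {y : ℕ}
    (hy : 5 ≤ y) (v : ℕ) : x.TopInv k (S.setVar y v) :=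
  { h with toKnown := h.toKnown.setVar hy v }

open Classical in
/-- The order of block `b` if the clique `R` is its top node. -/
noncomputable def OrderCtx.joined (x : OrderCtx) (S : Store) (b R u : ℕ) : ℕ :=
  S.arr 35 (compOf x.n x.adj x.Q x.C R u) u + cnt x.n (Precedes x.n x.adj x.Q x.C b R u)

/-- The clique, increased by one, that is chosen as the top node of block `b`. -/
noncomputable def OrderCtx.pick (x : OrderCtx) (S : Store) (b : ℕ) : ℕ :=
  lastOf (Accept x.n x.adj x.Q x.C (S.arr 33 0) b) x.n

/-- Soundness of the choice is `Blocks.isTreeOrder`: any accepted clique yields a tree order.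
Completeness is `OrderCtx.Good.exists_accept`: if the block has a top node in some clique tree,
then a clique is accepted. -/
theorem OrderCtx.TopInv.step {x : OrderCtx} {k : ℕ} {S S' : Store} (h : x.TopInv k S) {b : ℕ}
    (hb : b < 2 * x.n + 1) (hbk : x.rank b = k) (hK : Known x.n x.rows x.cols x.tab 36 S')
    (h33 : ∀ l, S'.arr 33 0 l = if l = b then x.pick S b else S.arr 33 0 l)
    (h35 : ∀ i u, S'.arr 35 i u = if i = b + 1 ∧ u < x.n then x.joined S b (x.pick S b - 1) u
      else S.arr 35 i u) : x.TopInv (k + 1) S' := by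
  refine ⟨hK, h.pos, h.good, fun u => ?_, fun l hl hl0 => ?_, fun c hc hck M y hy => ?_⟩
  · rw [h35, if_neg (by omega), h.row]
  · rw [h33] at hl0
    by_cases hlb : l = b
    · subst hlb
      rw [if_pos rfl] at hl0
      obtain ⟨R, hR⟩ : ∃ R, x.pick S l = R + 1 := ⟨x.pick S l - 1, by omega⟩
      have hA := lastOf_eq_succ hR
      refine (h.good.blocks.isTreeOrder (RP := S.arr 35) (by omega) hA.2 h.row fun i hi h0 =>
        h.tree i (by omega) h0).congr fun u hu => ?_
      rw [h35, if_pos ⟨rfl, h.good.block_lt hu⟩, hR]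
      rfl
    · rw [if_neg hlb] at hl0
      refine (h.tree l hl hl0).congr fun u _ => ?_
      rw [h35, if_neg (by omega)]
  · rw [h33]
    split_ifs with hcb
    · subst hcb
      obtain ⟨R, hR, hA⟩ := h.good.exists_accept hy (top := S.arr 33 0) fun l hl y' hy' hlt =>
        h.done l (by omega)
          (by rw [← hbk]; exact OrderCtx.rank_lt_rank (by omega) (.inl hlt)) M y' hy'
      have := le_lastOf hR hA
      unfold OrderCtx.pick
      omega
    · refine h.done c hc ?_ M y hy
      have : x.rank c ≠ x.rank b := fun e => hcb (OrderCtx.rank_inj hc hb e)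
      omega

/-- When all blocks have been processed, a tree order of the whole graph has been found. -/
theorem OrderCtx.TopInv.tree_root {x : OrderCtx} {S : Store} (h : x.TopInv (2 * x.n + 1) S) :
    IsTreeOrder x.n x.adj (x.K (2 * x.n)) (x.C (2 * x.n)) (S.arr 35 (2 * x.n + 1)) := by
  obtain ⟨M⟩ := h.good.model
  obtain ⟨r, hr⟩ := h.good.root_topNode h.pos M
  exact h.tree _ (by omega) (h.done _ (by omega) (OrderCtx.rank_lt (by omega)) M r hr)

/-- Find the top node of the block in variable `21` and the order of the block. -/
def topRound : Prog :=
  .seq (.fill 31 1 0 0 (.lit 0) (.and (.on 12 (.var 21) idx) (.and (.off 7 col idx)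
    (.or (.eq (.arr 23 col idx) (.lit 0))
        (.or (.eq (.arr 33 (.lit 0) (.pred (.arr 23 col idx))) (.lit 0))
      (.or (.on 25 col (.pred (.arr 23 col idx)))
        (.and (.not (.eq (.arr 24 col (.pred (.arr 23 col idx))) (.lit 0)))
          (.on 19 (.pred (.arr 24 col (.pred (.arr 23 col idx)))) (.var 21)))))))) (.lit 1)) <|
  .seq (.fill 32 1 1 0 (.lit 0) (.and (.off 29 (.var 21) idx) (.and (.on 30 (.var 21) idx)
    (.off 31 (.lit 0) idx))) (.succ idx)) <|
  .seq (.setVar 22 (.pred (.arr 32 (.lit 0) (.lit 0)))) <|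
  .seq (.setArr 33 (.lit 0) (.var 21) (.arr 32 (.lit 0) (.lit 0))) <|
  .seq (.fill 34 1 0 0 (.arr 35 (.arr 23 (.var 22) col) col) (.and (.on 12 (.var 21) idx)
    (.or (.and (.on 7 (.var 22) col) (.and (.on 7 (.var 22) idx) (.lt idx col)))
      (.and (.off 7 (.var 22) col) (.or (.on 7 (.var 22) idx)
        (.or (.lt (.arr 21 (.lit 0) (.pred (.arr 23 (.var 22) idx)))
            (.arr 21 (.lit 0) (.pred (.arr 23 (.var 22) col))))
          (.and (.eq (.arr 21 (.lit 0) (.pred (.arr 23 (.var 22) idx)))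
            (.arr 21 (.lit 0) (.pred (.arr 23 (.var 22) col))))
            (.lt (.pred (.arr 23 (.var 22) idx)) (.pred (.arr 23 (.var 22) col)))))))))
                (.succ acc)) <|
  .scatter 35 0 (.succ (.var 21)) (.var 10) (.arr 34 (.lit 0) (.var 10))

/-- The data of a round: the graph, the number of the round, the block and the state. -/
structure TopCtx where
  /-- the graph and the elimination order -/
  x : OrderCtx
  /-- the number of the round -/
  k : ℕ
  /-- the block -/
  b : ℕ
  /-- the state before the round -/
  S : Store

/-- The block is the one to be processed in this round. -/
structure TopCtx.Good (c : TopCtx) : Prop where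
  inv : c.x.TopInv c.k c.S
  b_lt : c.b < 2 * c.x.n + 1
  rank_b : c.x.rank c.b = c.k
  v21 : c.S.var 21 = c.b

theorem lastOf_le {φ : ℕ → Prop} {K : ℕ} : lastOf φ K ≤ K := by
  induction K with
  | zero => simp [lastOf]
  | succ K ih => rw [lastOf]; split_ifs <;> omega

theorem compOf_le {n : ℕ} {adj Q C : ℕ → ℕ → Prop} {R u : ℕ} : compOf n adj Q C R u ≤ 2 * n :=
  lastOf_le

/-- A round costs `O(n²)`, and there are `2n + 1` rounds. -/
theorem Spec.topRound : Spec (fun c : TopCtx => c.x.n) 2 topRound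
    (fun c s => c.Good ∧ St c.S s)
    (fun c s => ∃ S', S'.var 20 = c.S.var 20 ∧ c.x.TopInv (c.k + 1) S' ∧ St S' s) := by
  refine Spec.conseq (α := TopCtx) (sz := fun c => c.x.n) (Spec.seq
    (Spec.fillSt (good := TopCtx.Good) (S := TopCtx.S) 31 1 0 0 _ _ _ (fun _ => 1)
      (fun c => c.x.n) (fun c => c.x.n) (fun c _ R => ind (∃ u < c.x.n, c.x.C c.b u ∧ ¬ c.x.Q R u ∧
        Obstacle c.x.n c.x.adj c.x.Q c.x.C (c.S.arr 33 0) c.b R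
          (compOf c.x.n c.x.adj c.x.Q c.x.C R u))) (by decide) ?_ ?_ ?_) <|
    Spec.seq (Spec.fillSt 32 1 1 0 _ _ _ (fun _ => 1) (fun _ => 1) (fun c => c.x.n)
      (fun c _ _ => c.x.pick c.S c.b) (by decide) ?_ ?_ ?_) <|
    Spec.seq (Spec.setVarSt 22 _ (fun c => c.x.pick c.S c.b - 1) ?_) <|
    Spec.seq (Spec.setArrSt 33 _ _ _ (fun _ => 0) TopCtx.b (fun c => c.x.pick c.S c.b) ?_) <|
    Spec.seq (Spec.fillSt 34 1 0 0 _ _ _ (fun _ => 1) (fun c => c.x.n) (fun c => c.x.n)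
      (fun c _ u => c.x.joined c.S c.b (c.x.pick c.S c.b - 1) u) (by decide) ?_ ?_ ?_)
    ((Spec.scatterSt 35 0 _ _ _ (fun c => c.x.n) (fun c i u => open Classical in
      if i = c.b + 1 ∧ u < c.x.n then c.x.joined c.S c.b (c.x.pick c.S c.b - 1) u
      else c.S.arr 35 i u) (fun c _ => c.b + 1) (fun _ k => k) (by decide) ?_ ?_ ?_ ?_).conseq
      (d' := 2) (by omega) fun y s h => ⟨y, rfl, h, fun _ h => h⟩)) le_rfl ?_
  · intro c h
    simp [h.inv.v0, h.inv.v1]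
  · intro c h
    omega
  · intro c h i hi R hR
    have h7 := OrderCtx.get_clique h.inv.toKnown (by omega)
    have h12 := OrderCtx.get_block h.inv.toKnown (by omega)
    have h19 := OrderCtx.get_inter h.inv.toKnown (by omega)
    have h23 := OrderCtx.get_comp h.inv.toKnown (by omega)
    have h24 := OrderCtx.get_partner h.inv.toKnown (by omega)
    have h25 := OrderCtx.get_dead h.inv.toKnown (by omega)
    have hb := h.b_lt
    have hn := h.inv.pos
    refine fillVal_ex fun u hu r => ?_
    have h1 := h23 R hR u hu
    have h2 := compOf_le (n := c.x.n) (adj := c.x.adj) (Q := c.x.Q) (C := c.x.C) (R := R) (u := u)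
    have h3 := h24 R hR (compOf c.x.n c.x.adj c.x.Q c.x.C R u - 1) (by omega)
    have h4 := partner_le (n := c.x.n) (adj := c.x.adj) (Q := c.x.Q) (C := c.x.C) (R := R)
      (l := compOf c.x.n c.x.adj c.x.Q c.x.C R u - 1)
    have h5 := h25 R hR (compOf c.x.n c.x.adj c.x.Q c.x.C R u - 1) (by omega)
    have h6 := h19 (partner c.x.n c.x.adj c.x.Q c.x.C R
      (compOf c.x.n c.x.adj c.x.Q c.x.C R u - 1) - 1) (by omega) c.b hb
    have h8 : ∀ i, (∃ v < c.x.n, c.x.C i v ∧ c.x.C c.b v) ↔ ∃ v, c.x.C i v ∧ c.x.C c.b v := fun i =>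
      ⟨fun ⟨v, _, h⟩ => ⟨v, h⟩, fun ⟨v, h'⟩ => ⟨v, h.inv.good.block_lt h'.1, h'⟩⟩
    rw [h8] at h6
    simp [Test.holds, WExp.eval, Store.loc, h.v21, h12 _ hb u hu, h7 R hR u hu, h1, h3, h5, h6,
      Obstacle]
  · intro c h
    simp [h.inv.v0, h.inv.v1, Store.putTab]
  · intro c h
    omega
  · intro c h i hi j hj
    have h29 : ∀ i < 2 * c.x.n + 1, ∀ j < c.x.n, c.S.arr 29 i j =
      ind (∃ w < c.x.n, (c.x.K i w ∧ ¬ c.x.Q j w) ∨ (c.x.Q j w ∧ ¬ c.x.K i w ∧ ¬ c.x.C i w)) :=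
      h.inv.get 29 (by omega)
    have h30 : ∀ i < 2 * c.x.n + 1, ∀ j < c.x.n, c.S.arr 30 i j =
      ind (∃ w < c.x.n, c.x.Q j w ∧ c.x.C i w) := h.inv.get 30 (by omega)
    refine fillVal_last fun R hR r => ?_
    have h1 : Accept c.x.n c.x.adj c.x.Q c.x.C (c.S.arr 33 0) c.b R ↔
        (¬ ∃ w < c.x.n, (c.x.K c.b w ∧ ¬ c.x.Q R w) ∨ (c.x.Q R w ∧ ¬ c.x.K c.b w ∧ ¬ c.x.C c.b w)) ∧
        (∃ w < c.x.n, c.x.Q R w ∧ c.x.C c.b w) ∧ ¬ ∃ u < c.x.n, c.x.C c.b u ∧ ¬ c.x.Q R u ∧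
        Obstacle c.x.n c.x.adj c.x.Q c.x.C (c.S.arr 33 0) c.b R
          (compOf c.x.n c.x.adj c.x.Q c.x.C R u) := by
      have hg := h.inv.good
      have hQ : ∀ w, c.x.Q R w → w < c.x.n := by
        rintro w (rfl | h')
        · exact hR
        · exact hg.peo.lt h'.1
      constructor
      · rintro ⟨a1, a2, ⟨q, a3, a4⟩, a5⟩
        refine ⟨?_, ⟨q, hQ q a3, a3, a4⟩, fun ⟨u, _, b1, b2, b3⟩ => a5 u b1 b2 b3⟩
        rintro ⟨w, _, b1 | b1⟩
        · exact b1.2 (a1 w b1.1)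
        · rcases a2 w b1.1 with b2 | b2
          · exact b1.2.1 b2
          · exact b1.2.2 b2
      · rintro ⟨a1, ⟨q, -, a3⟩, a4⟩
        refine ⟨fun w hw => by_contra fun b1 => a1 ⟨w, hg.bd_lt hw, .inl ⟨hw, b1⟩⟩, fun w hw => ?_,
          ⟨q, a3⟩, fun u b1 b2 b3 => a4 ⟨u, hg.block_lt b1, b1, b2, b3⟩⟩
        by_contra b1
        push Not at b1
        exact a1 ⟨w, hQ w hw, .inr ⟨hw, b1⟩⟩
    rw [h1]
    refine and_congr ?_ (and_congr ?_ ?_)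
    · rw [← ind_eq_zero, ← h29 c.b h.b_lt R hR]
      simp [Test.holds, WExp.eval, Store.loc, Store.putTab, h.v21]
    · rw [← ind_eq_one (p := ∃ w < c.x.n, c.x.Q R w ∧ c.x.C c.b w), ← h30 c.b h.b_lt R hR]
      simp [Test.holds, WExp.eval, Store.loc, Store.putTab, h.v21]
    · rw [← ind_eq_zero]
      simp [Test.holds, WExp.eval, Store.loc, Store.putTab, hR]
  · intro c s h hs
    simp [WExp.eval, hs.arr, Store.putTab]
  · intro c s h hs
    simp [WExp.eval, hs.var, hs.arr, Store.setVar, Store.putTab, h.v21]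
  · intro c h
    simp [h.inv.v0, h.inv.v1, Store.putTab, Store.setVar, Store.setArr]
  · intro c h
    omega
  · intro c h i hi u hu
    have h7 := OrderCtx.get_clique h.inv.toKnown (by omega)
    have h12 := OrderCtx.get_block h.inv.toKnown (by omega)
    have h21 := OrderCtx.get_key h.inv.toKnown (by omega)
    have h23 := OrderCtx.get_comp h.inv.toKnown (by omega)
    have hR : c.x.pick c.S c.b - 1 < c.x.n := by
      have := lastOf_le (φ := Accept c.x.n c.x.adj c.x.Q c.x.C (c.S.arr 33 0) c.b) (K := c.x.n)
      have := h.inv.pos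
      unfold OrderCtx.pick
      omega
    generalize c.x.pick c.S c.b - 1 = R at hR ⊢
    have hle : ∀ v, compOf c.x.n c.x.adj c.x.Q c.x.C R v - 1 < 2 * c.x.n + 1 := fun v => by
      have := compOf_le (n := c.x.n) (adj := c.x.adj) (Q := c.x.Q) (C := c.x.C) (R := R) (u := v)
      omega
    refine (fillVal_count (φ := Precedes c.x.n c.x.adj c.x.Q c.x.C c.b R u) fun v hv r =>
        ?_).trans ?_
    · simp [Test.holds, WExp.eval, Store.loc, Store.putTab, Store.setVar, Store.setArr, h.v21,
        h12 _ h.b_lt v hv, h7 R hR u hu, h7 R hR v hv, h23 R hR u hu, h23 R hR v hv,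
        h21 0 (by omega) _ (hle u), h21 0 (by omega) _ (hle v), Precedes, Before]
    · simp [WExp.eval, Store.loc, Store.putTab, Store.setVar, Store.setArr, h23 R hR u hu,
        OrderCtx.joined, cnt]
  · intro c h
    simp [h.inv.v0, Store.putTab, Store.setVar, Store.setArr]
    omega
  · intro c s k h hs hk
    simp [WExp.eval, Store.at, Store.setVar, hs.var, hs.arr, Store.putTab, Store.setArr, h.v21, hk]
  · intro c i j h hi hj _ he
    exact he
  · intro c i j h hne
    rw [if_neg]
    · simp [Store.putTab, Store.setVar, Store.setArr]
    · rintro ⟨h1, h2⟩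
      exact hne j h2 ⟨h1.symm, rfl⟩
  · rintro c s ⟨h, hs⟩
    refine ⟨c, rfl, ⟨h, hs⟩, fun s' hs' => ⟨_, ?_, ?_, hs'.2⟩⟩
    · simp [Store.putTab, Store.setVar, Store.setArr]
    · refine h.inv.step h.b_lt h.rank_b ⟨?_, ?_, ?_, ?_⟩ ?_ ?_
      · have := h.inv.toSizes
        constructor <;> simp [Store.putTab, Store.setVar, Store.setArr, this.v0, this.v1, this.v2,
          this.v3, this.v4]
      · intro a ha i hi j hj
        have h1 : a < 31 := by
          by_contra h1
          obtain rfl | rfl | rfl | rfl | rfl : a = 31 ∨ a = 32 ∨ a = 33 ∨ a = 34 ∨ a =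
              35 := by omega
          all_goals exact absurd hi (by simp [OrderCtx.rows])
        have h2 : a ≠ 31 ∧ a ≠ 32 ∧ a ≠ 33 ∧ a ≠ 34 ∧ a ≠ 35 := by omega
        have := h.inv.get a ha i hi j hj
        simp [Store.putTab, Store.setVar, Store.setArr, h2, this]
      · intro a ha
        have h2 : a ≠ 31 ∧ a ≠ 32 ∧ a ≠ 33 ∧ a ≠ 34 ∧ a ≠ 35 := by omega
        have := h.inv.zero a ha
        funext i j
        simp [Store.putTab, Store.setVar, Store.setArr, h2, this]
      · simp [Store.putTab, Store.setVar, Store.setArr, h.inv.num]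
      · intro l
        simp [Store.putTab, Store.setVar, Store.setArr]
      · intro i u
        simp [Store.putTab, Store.setVar, Store.setArr]

/-- Process the blocks in the order of their sizes. -/
def topProg : Prog :=
  .for 20 3 (.seq (.setVar 21 (.arr 28 (.lit 0) (.var 20))) topRound)

theorem Spec.topProg : Spec OrderCtx.n 3 topProg
    (fun x s => (x.Good ∧ ∃ S, Known x.n x.rows x.cols x.tab 31 S ∧ St S s) ∧ 0 < x.n)
    (fun x s => ∃ S, x.TopInv (2 * x.n + 1) S ∧ St S s) := by
  refine Spec.for (d := 2) (fun x => 2 * x.n + 1) (fun x k s => ∃ S, x.TopInv k S ∧ St S s)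
    (by decide) (fun x => by omega) ?_ ?_ fun x s h => h
  · rintro x s ⟨⟨hx, S, h, hs⟩, hn⟩
    refine ⟨(hs.var 3 (by simp)).trans h.v3, S.setVar 20 0, ?_, hs.setVar 20 0⟩
    refine OrderCtx.TopInv.setVar ⟨h.congr (by omega) ?_, hn, hx, ?_, ?_, ?_⟩ (by omega) 0
    · intro a ha i hi j hj
      refine ⟨?_, rfl⟩
      by_contra h1
      obtain rfl | rfl | rfl | rfl | rfl : a = 31 ∨ a = 32 ∨ a = 33 ∨ a = 34 ∨ a = 35 := by omega
      all_goals exact absurd hi (by simp [OrderCtx.rows])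
    · simp [h.zero 35 (by omega)]
    · simp [h.zero 33 (by omega)]
    · omega
  · refine Spec.seq (Mid := fun (c : OrderCtx × ℕ) s => ∃ S,
        ((S.var 20 = c.2 ∧ c.2 < 2 * c.1.n + 1) ∧
      S.var 21 = inverse c.1.rank (2 * c.1.n + 1) c.2 ∧ c.1.TopInv c.2 S) ∧ St S s) (Spec.setVar ?_)
      (Spec.conseq Spec.topRound le_rfl ?_)
    · rintro ⟨x, k⟩ s ⟨hk, h1, h2, S, h, hs⟩
      refine ⟨_, ⟨⟨?_, hk⟩, ?_, h.setVar (y := 21) (by omega) _⟩, hs.setVar 21 _⟩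
      · simpa [Store.setVar, ← hs.var 20 (by simp)] using h1
      · have h28 := OrderCtx.get_sorted h.toKnown (by omega)
        change s.var 20 = k at h1
        simp [Store.setVar, WExp.eval, hs.arr, h1, h28 0 (by omega) k hk]
    · rintro ⟨x, k⟩ s ⟨S, ⟨⟨h20, hk⟩, h21, h⟩, hs⟩
      obtain ⟨h3, h4⟩ := OrderCtx.sorted (x := x) hk
      refine ⟨⟨x, k, _, S⟩, rfl, ⟨⟨h, h3, h4, h21⟩, hs⟩, ?_⟩
      rintro s' ⟨S', hv, h', hs'⟩
      exact ⟨(hs'.var 20 (by simp)).trans (hv.trans h20), (hs'.var 3 (by simp)).trans h'.v3, _,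
        h'.setVar (y := 20) (by omega) (k + 1), hs'.setVar 20 _⟩

/-! ### Relabelling the vertices by their positions in a tree order -/

/-- A graph together with orders of subsets of its vertices. -/
structure LabelCtx where
  /-- the number of vertices -/
  n : ℕ
  /-- the graph -/
  adj : ℕ → ℕ → Prop
  /-- the orders; row `2n + 1` is a tree order of the whole graph -/
  R : ℕ → ℕ → ℕ

namespace LabelCtx

/-- The position of a vertex. -/
def ρ (x : LabelCtx) (u : ℕ) : ℕ := x.R (2 * x.n + 1) u

/-- The vertex at a position. -/
noncomputable def vt (x : LabelCtx) (p : ℕ) : ℕ := inverse x.ρ x.n p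

/-- The graph on the positions. -/
def B (x : LabelCtx) (p q : ℕ) : Prop := p < x.n ∧ q < x.n ∧ x.adj (x.vt p) (x.vt q)

/-- The positions form a tree order. -/
structure Good (x : LabelCtx) : Prop where
  symm : ∀ {u v}, x.adj u v → x.adj v u
  irrefl : ∀ {u}, ¬ x.adj u u
  lt : ∀ u < x.n, x.ρ u < x.n
  inj : ∀ u < x.n, ∀ v < x.n, x.ρ u = x.ρ v → u = v
  order : ∀ u < x.n, ∀ y < x.n, ∀ w < x.n, ∀ l < x.n,
      x.ρ u < x.ρ y → x.ρ w ≤ x.ρ u → x.ρ l ≤ x.ρ u →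
    x.adj y w → x.adj y l → (w = u ∨ x.adj w u) → l = u ∨ x.adj l u

variable {x : LabelCtx}

theorem Good.vt_ρ (hx : x.Good) {u : ℕ} (hu : u < x.n) : x.vt (x.ρ u) = u := inverse_eq hx.inj hu

theorem Good.ρ_vt (hx : x.Good) {p : ℕ} (hp : p < x.n) : x.vt p < x.n ∧ x.ρ (x.vt p) = p := by
  obtain ⟨u, hu, rfl⟩ := exists_of_inj hx.inj hx.lt hp
  rw [hx.vt_ρ hu]
  exact ⟨hu, rfl⟩

/-- The graph on the positions, relabelled by `1, …, n`, with its parent function is an elimination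
forest. -/
theorem Good.elimForest (hx : x.Good) : ElimForest x.n (labelAdj x.B)
    (fun y => parentOf x.n x.B (y - 1)) (fun w => lastNbr x.n x.B (w - 1)) := by
  refine elimForest_of_order (fun h => ⟨h.2.1, h.1, hx.symm h.2.2⟩) (fun h => hx.irrefl h.2.2)
    (fun h => h.2.1) ?_
  rintro u y w l huy hwu hlu ⟨hy, hw, h1⟩ ⟨-, hl, h2⟩ h3
  have hu : u < x.n := by omega
  obtain ⟨u1, u2⟩ := hx.ρ_vt hu
  obtain ⟨w1, w2⟩ := hx.ρ_vt hw
  obtain ⟨l1, l2⟩ := hx.ρ_vt hl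
  obtain ⟨y1, y2⟩ := hx.ρ_vt hy
  rcases hx.order _ u1 _ y1 _ w1 _ l1 (by omega) (by omega) (by omega) h1 h2
    (h3.imp (fun h => by rw [h]) fun h => h.2.2) with h4 | h4
  · left
    rw [← l2, ← u2, h4]
  · exact .inr ⟨hl, hu, h4⟩

/-- The number of rows of the tables. -/
def rows (x : LabelCtx) : ℕ → ℕ
  | 0 | 37 | 38 => x.n
  | 35 => 2 * x.n + 2
  | 36 | 39 | 40 | 41 => 1
  | _ => 0

/-- The number of columns of the tables. -/
def cols (x : LabelCtx) : ℕ → ℕ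
  | 0 | 35 | 36 | 37 | 38 | 39 | 40 => x.n
  | 41 => x.n + 1
  | _ => 0

/-- The tables. -/
noncomputable def tab (x : LabelCtx) : ℕ → ℕ → ℕ → ℕ
  | 0, i, j => ind (x.adj i j)
  | 35, i, j => x.R i j
  | 36, _, p => x.vt p
  | 37, p, q => ind (x.B p q)
  | 38, p, q => ind (∃ w < x.n, w ≤ q ∧ x.B p w ∧ (w = q ∨ x.B w q))
  | 39, _, p => parentOf x.n x.B p
  | 40, _, p => lastNbr x.n x.B p
  | 41, _, v => 2 * x.n + 1 - v
  | _, _, _ => 0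

end LabelCtx

/-- Compute the tree structure on the positions. -/
def labelProg : Prog :=
  .seq (.fill 36 1 0 0 (.lit 0) (.eq (.arr 35 (.var 3) idx) col) idx) <|
  .seq (.fill 37 0 0 1 (.lit 0) (.on 0 (.arr 36 (.lit 0) row) (.arr 36 (.lit 0) col)) (.lit 1)) <|
  .seq (.fill 38 0 0 0 (.lit 0) (.and (.not (.lt col idx)) (.and (.on 37 row idx)
    (.or (.eq idx col) (.on 37 idx col)))) (.lit 1)) <|
  .seq (.fill 39 1 0 0 (.lit 0) (.and (.lt idx col) (.on 38 col idx)) (.succ idx)) <|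
  .seq (.fill 40 1 0 0 (.lit 0) (.or (.eq idx col) (.on 37 col idx)) (.succ idx)) <|
  .fill 41 1 4 0 (.var 3) (.lt idx col) (.pred acc)

theorem Spec.labelProg : Spec LabelCtx.n 3 labelProg
    (fun x s => x.Good ∧ ∃ S, Known x.n x.rows x.cols x.tab 36 S ∧ St S s)
    (fun x s => x.Good ∧ ∃ S, Known x.n x.rows x.cols x.tab 42 S ∧ St S s) := by
  have get37 : ∀ (x : LabelCtx) (S : Store) (k : ℕ), Known x.n x.rows x.cols x.tab k S → 37 < k →
      ∀ i < x.n, ∀ j < x.n, S.arr 37 i j = ind (x.B i j) := fun x S k h hk => h.get 37 hk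
  refine Spec.seq (Spec.table 36 1 0 0 _ _ _ LabelCtx.n (by decide) ?_ ?_) <|
    Spec.seq (Spec.table 37 0 0 1 _ _ _ (fun _ => 1) (by decide) ?_ ?_) <|
    Spec.seq (Spec.table 38 0 0 0 _ _ _ LabelCtx.n (by decide) ?_ ?_) <|
    Spec.seq (Spec.table 39 1 0 0 _ _ _ LabelCtx.n (by decide) ?_ ?_) <|
    Spec.seq (Spec.table 40 1 0 0 _ _ _ LabelCtx.n (by decide) ?_ ?_) <|
    Spec.table 41 1 4 0 _ _ _ LabelCtx.n (by decide) ?_ ?_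
  · intro x S h
    simp [h.v0, h.v1, LabelCtx.rows, LabelCtx.cols]; omega
  · intro x S hx h i hi j hj
    have h35 : ∀ i < 2 * x.n + 2, ∀ j < x.n, S.arr 35 i j = x.R i j := h.get 35 (by omega)
    refine fillVal_inverse fun k hk r => ?_
    simp [Test.holds, WExp.eval, Store.loc, h.v3, h35 _ _ k hk, LabelCtx.ρ]
  · intro x S h
    simp [h.v0, h.v1, LabelCtx.rows, LabelCtx.cols]; omega
  · intro x S hx h i hi j hj
    have h0 : ∀ i < x.n, ∀ j < x.n, S.arr 0 i j = ind (x.adj i j) := h.get 0 (by omega)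
    have h36 : ∀ i < 1, ∀ j < x.n, S.arr 36 i j = x.vt j := h.get 36 (by omega)
    change i < x.n at hi
    change j < x.n at hj
    refine fillVal_one fun r => ?_
    simp [Test.holds, WExp.eval, Store.loc, h36 0 (by omega) i hi, h36 0 (by omega) j hj,
      h0 _ (hx.ρ_vt hi).1 _ (hx.ρ_vt hj).1, LabelCtx.B, hi, hj]
  · intro x S h
    simp [h.v0, LabelCtx.rows, LabelCtx.cols]; omega
  · intro x S hx h i hi j hj
    have h37 := get37 x S _ h (by omega)
    change i < x.n at hi
    change j < x.n at hj
    refine fillVal_ex fun k hk r => ?_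
    simp [Test.holds, WExp.eval, Store.loc, h37 i hi k hk, h37 k hk j hj]
  · intro x S h
    simp [h.v0, h.v1, LabelCtx.rows, LabelCtx.cols]; omega
  · intro x S hx h i hi j hj
    have h38 : ∀ i < x.n, ∀ j < x.n, S.arr 38 i j =
      ind (∃ w < x.n, w ≤ j ∧ x.B i w ∧ (w = j ∨ x.B w j)) := h.get 38 (by omega)
    change j < x.n at hj
    refine fillVal_last fun k hk r => ?_
    simp [Test.holds, WExp.eval, Store.loc, h38 j hj k hk]
  · intro x S h
    simp [h.v0, h.v1, LabelCtx.rows, LabelCtx.cols]; omega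
  · intro x S hx h i hi j hj
    have h37 := get37 x S _ h (by omega)
    change j < x.n at hj
    refine fillVal_last fun k hk r => ?_
    simp [Test.holds, WExp.eval, Store.loc, h37 j hj k hk]
  · intro x S h
    simp [h.v0, h.v1, h.v4, LabelCtx.rows, LabelCtx.cols]; omega
  · intro x S hx h i hi j hj
    change j < x.n + 1 at hj
    refine (fillVal_pred (φ := fun k => k < j) fun k hk r => ?_).trans ?_
    · simp [Test.holds, WExp.eval, Store.loc]
    · have : cnt x.n (fun k => k < j) = j := by
        rw [cnt]
        refine Eq.trans (congrArg Finset.card ?_) (Finset.card_range j)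
        ext k
        simp only [Finset.mem_filter, Finset.mem_range]
        omega
      rw [this]
      simp [WExp.eval, Store.loc, h.v3]
      rfl

/-- The computed order of the whole graph is a tree order. -/
theorem OrderCtx.TopInv.label {x : OrderCtx} {S : Store} (h : x.TopInv (2 * x.n + 1) S) :
    (LabelCtx.mk x.n x.adj (S.arr 35)).Good ∧ Known x.n (LabelCtx.mk x.n x.adj (S.arr 35)).rows
      (LabelCtx.mk x.n x.adj (S.arr 35)).cols (LabelCtx.mk x.n x.adj (S.arr 35)).tab 36 S := by
  have hC : ∀ {u}, x.C (2 * x.n) u ↔ u < x.n := ⟨h.good.block_lt, h.good.blocks.univ⟩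
  have hT := h.tree_root
  refine ⟨⟨h.good.peo.symm, h.good.peo.irrefl, fun u hu => ?_, fun u hu v hv => ?_,
    fun u hu y hy w hw l hl h1 h2 h3 => ?_⟩, h.toSizes, ?_, h.zero, h.num⟩
  · exact (hT.lt u (hC.2 hu)).trans_le cnt_le
  · exact hT.inj u v (hC.2 hu) (hC.2 hv)
  · exact hT.order u y w l (hC.2 hu) (hC.2 hy) h1 (.inr ⟨hC.2 hw, h2⟩) (.inr ⟨hC.2 hl, h3⟩)
  · intro a ha i hi j hj
    rcases Nat.eq_zero_or_pos a with rfl | h0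
    · exact OrderCtx.get_adj h.toKnown (by omega) i hi j hj
    · by_cases h35 : a = 35
      · subst h35; rfl
      · exfalso
        unfold LabelCtx.rows at hi
        split at hi <;> omega

/-! ### The dynamic program -/

/-- Symbolic execution of an assignment: the state before it stays available. -/
theorem Spec.setNum_seq {α : Type*} {sz : α → ℕ} {d : ℕ} {a : ℕ} {i j : WExp} {e : NExp} {q : Prog}
    {Pre Post : α → Store → Prop} (hb : ∀ y s, Pre y s → e.eval s < 2 ^ (2 * sz y))
    (h : Spec sz d q
      (fun y s => ∃ s₀, Pre y s₀ ∧ s = s₀.setNum a (i.eval s₀) (j.eval s₀) (e.eval s₀)) Post) :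
    Spec sz d (.seq (.setNum a i j e) q) Pre Post :=
  Spec.seq (Spec.setNum hb fun _ s hs => ⟨s, hs, rfl⟩) h

/-- Symbolic execution of an assignment: the state before it stays available. -/
theorem Spec.setVar_seq {α : Type*} {sz : α → ℕ} {d : ℕ} {v : ℕ} {e : WExp} {q : Prog}
    {Pre Post : α → Store → Prop}
    (h : Spec sz d q (fun y s => ∃ s₀, Pre y s₀ ∧ s = s₀.setVar v (e.eval s₀)) Post) :
    Spec sz d (.seq (.setVar v e) q) Pre Post :=
  Spec.seq (Spec.setVar fun _ s hs => ⟨s, hs, rfl⟩) h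

/-- The distribution of the maximum of two independent values with the distributions `X` and `Y`. -/
def maxConv (X Y : ℕ → ℕ) (p : ℕ) : ℕ :=
  X p * ∑ q ∈ Finset.range (p + 1), Y q + (∑ q ∈ Finset.range p, X q) * Y p

/-- Replace the row in variable `22` of the table `1` by its `maxConv` with row `0` of the
table `3`. -/
def mergeProg : Prog :=
  .seq (.setNum 2 (.lit 0) (.lit 0) .zero) <|
  .seq (.setNum 2 (.lit 0) (.lit 1) .zero) <|
  .for 23 3 <|
    .seq (.setNum 2 (.lit 0) (.lit 1)
        (.add (.num 2 (.lit 0) (.lit 1)) (.num 1 (.var 22) (.var 23)))) <|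
    .seq (.setNum 1 (.var 22) (.var 23)
        (.add (.mul (.num 3 (.lit 0) (.var 23)) (.num 2 (.lit 0) (.lit 1)))
      (.mul (.num 2 (.lit 0) (.lit 0)) (.num 1 (.var 22) (.var 23))))) <|
    .setNum 2 (.lit 0) (.lit 0) (.add (.num 2 (.lit 0) (.lit 0)) (.num 3 (.lit 0) (.var 23)))

/-- The data of a merge: the size, the row, the two distributions and the state. -/
structure MergeCtx where
  /-- the number of vertices -/
  n : ℕ
  /-- the row -/
  y : ℕ
  /-- the first distribution -/
  X : ℕ → ℕ
  /-- the second distribution -/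
  Y : ℕ → ℕ
  /-- the state before the merge -/
  S : Store

/-- The state holds the two distributions, and all numbers are small. -/
structure MergeCtx.Good (c : MergeCtx) : Prop extends Sizes c.n c.S where
  pos : 0 < c.n
  v22 : c.S.var 22 = c.y
  hX : ∀ p < 2 * c.n + 1, c.S.num 3 0 p = c.X p
  hY : ∀ p < 2 * c.n + 1, c.S.num 1 c.y p = c.Y p
  sumX : ∀ p, ∑ q ∈ Finset.range p, c.X q ≤ 2 ^ c.n
  sumY : ∀ p, ∑ q ∈ Finset.range p, c.Y q ≤ 2 ^ c.n
  conv : ∀ p, maxConv c.X c.Y p ≤ 2 ^ c.n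

/-- The effect of a merge on the columns below `k`. -/
structure MergeCtx.Merged (c : MergeCtx) (k : ℕ) (s : Store) : Prop where
  arr : s.arr = c.S.arr
  var : ∀ z, z ≠ 23 → s.var z = c.S.var z
  num3 : s.num 3 = c.S.num 3
  num1 : ∀ i j, s.num 1 i j = if i = c.y ∧ j < k then maxConv c.X c.Y j else c.S.num 1 i j

theorem two_pow_lt {n m : ℕ} (hn : 0 < n) (h : m ≤ 2 ^ n) : m < 2 ^ (2 * n) :=
  h.trans_lt (Nat.pow_lt_pow_right (by omega) (by omega))

/-- A merge costs `O(n)`: the partial sums of both distributions are kept in the cells `(0, 0)` and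
`(0, 1)` of the array `2` of numbers. -/
theorem Spec.mergeProg : Spec MergeCtx.n 1 mergeProg (fun c s => c.Good ∧ s = c.S)
    (fun c s => c.Merged (2 * c.n + 1) s) := by
  refine Spec.setNum_seq ?_ <| Spec.setNum_seq ?_ <| Spec.for (d := 0) (fun c => 2 * c.n + 1)
    (fun c k s => c.Good ∧ s.num 2 0 0 = ∑ q ∈ Finset.range k, c.X q ∧
      s.num 2 0 1 = ∑ q ∈ Finset.range k, c.Y q ∧ c.Merged k s) (by decide) (fun c => le_rfl) ?_
      (Spec.setNum_seq ?_ <| Spec.setNum_seq ?_ <| Spec.setNum ?_ ?_) fun c s h => h.2.2.2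
  · intro c s _
    exact Nat.pow_pos (by omega)
  · intro c s _
    exact Nat.pow_pos (by omega)
  · rintro c s ⟨s₁, ⟨s₂, ⟨h, rfl⟩, rfl⟩, rfl⟩
    refine ⟨h.v3, h, ?_, ?_, rfl, ?_, ?_, ?_⟩
    · simp [Store.setVar, Store.setNum, WExp.eval, NExp.eval]
    · simp [Store.setVar, Store.setNum, WExp.eval, NExp.eval]
    · intro z hz
      simp [Store.setVar, Store.setNum, hz]
    · simp [Store.setVar, Store.setNum]
    · simp [Store.setVar, Store.setNum]
  · rintro ⟨c, k⟩ s ⟨hk, hv, -, h, -, h1, hm⟩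
    simp only at hk hv h1 hm
    have e : s.num 1 c.y k = c.Y k := by
      rw [hm.num1, if_neg (by omega), h.hY k hk]
    have e2 : s.var 22 = c.y := (hm.var 22 (by decide)).trans h.v22
    simp only [NExp.eval, WExp.eval, h1, hv, e2, e, ← Finset.sum_range_succ]
    exact two_pow_lt h.pos (h.sumY _)
  · rintro ⟨c, k⟩ s ⟨s₀, ⟨hk, hv, -, h, h0, h1, hm⟩, rfl⟩
    simp only at hk hv h0 h1 hm
    have e : s₀.num 1 c.y k = c.Y k := by
      rw [hm.num1, if_neg (by omega), h.hY k hk]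
    have e2 : s₀.var 22 = c.y := (hm.var 22 (by decide)).trans h.v22
    have e3 : s₀.num 3 0 k = c.X k := by rw [hm.num3, h.hX k hk]
    refine two_pow_lt h.pos (le_trans (le_of_eq ?_) (h.conv k))
    simp [NExp.eval, WExp.eval, Store.setNum, h0, h1, hv, e2, e, e3,
        ← Finset.sum_range_succ, maxConv]
  · rintro ⟨c, k⟩ s ⟨s₁, ⟨s₀, ⟨hk, hv, -, h, h0, h1, hm⟩, rfl⟩, rfl⟩
    simp only at hk hv h0 h1 hm
    have e3 : s₀.num 3 0 k = c.X k := by rw [hm.num3, h.hX k hk]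
    refine two_pow_lt h.pos (le_trans (le_of_eq ?_) (h.sumX (k + 1)))
    simp [NExp.eval, WExp.eval, Store.setNum, h0, hv, e3, ← Finset.sum_range_succ]
  · rintro ⟨c, k⟩ s ⟨s₁, ⟨s₀, ⟨hk, hv, h3, h, h0, h1, hm⟩, rfl⟩, rfl⟩
    simp only at hk hv h0 h1 hm h3
    have e : s₀.num 1 c.y k = c.Y k := by
      rw [hm.num1, if_neg (by omega), h.hY k hk]
    have e2 : s₀.var 22 = c.y := (hm.var 22 (by decide)).trans h.v22
    have e3 : s₀.num 3 0 k = c.X k := by rw [hm.num3, h.hX k hk]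
    refine ⟨hv, h3, h, ?_, ?_, hm.arr, ?_, ?_, ?_⟩
    · simp [NExp.eval, WExp.eval, Store.setNum, Store.setVar, h0, hv, e3, Finset.sum_range_succ]
    · simp [NExp.eval, WExp.eval, Store.setNum, Store.setVar, h1, hv, e2, e, Finset.sum_range_succ]
    · intro z hz
      simp [Store.setNum, Store.setVar, hz, hm.var z hz]
    · funext i j
      simp [Store.setNum, Store.setVar, hm.num3]
    · intro i j
      simp only [Store.setNum, Store.setVar, WExp.eval, NExp.eval, hv, e2, h0, h1, e, e3]
      simp only [hm.num1]
      by_cases hij : i = c.y ∧ j = k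
      · obtain ⟨rfl, rfl⟩ := hij
        simp [maxConv, Finset.sum_range_succ]
      · simp only [true_and, hij, if_false]
        split_ifs <;> first | rfl | omega

/-- An elimination forest. -/
structure DpCtx where
  /-- the number of vertices -/
  n : ℕ
  /-- the graph on the labels `1, …, n` -/
  a : ℕ → ℕ → Prop
  /-- the parents -/
  par : ℕ → ℕ
  /-- the last neighbours -/
  e : ℕ → ℕ

/-- The state holds the elimination forest. -/
structure DpCtx.Labelled (c : DpCtx) (S : Store) : Prop extends Sizes c.n S where
  pos : 0 < c.n
  forest : ElimForest c.n c.a c.par c.e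
  arr39 : ∀ p < c.n, S.arr 39 0 p = c.par (p + 1)
  arr40 : ∀ p < c.n, S.arr 40 0 p = c.e (p + 1)
  arr41 : ∀ v ≤ c.n, S.arr 41 0 v = 2 * c.n + 1 - v

theorem DpCtx.Labelled.congr {c : DpCtx} {S S' : Store} (h : c.Labelled S)
    (hv : ∀ y < 5, S'.var y = S.var y) (ha : S'.arr = S.arr) : c.Labelled S' :=
  { pos := h.pos, forest := h.forest
    v0 := (hv 0 (by omega)).trans h.v0
    v1 := (hv 1 (by omega)).trans h.v1
    v2 := (hv 2 (by omega)).trans h.v2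
    v3 := (hv 3 (by omega)).trans h.v3
    v4 := (hv 4 (by omega)).trans h.v4
    arr39 := by rw [ha]; exact h.arr39
    arr40 := by rw [ha]; exact h.arr40
    arr41 := by rw [ha]; exact h.arr41 }

/-- The vertices up to `k` in row `y` of the initial table. -/
def initRow (n : ℕ) (e : ℕ → ℕ) (k y : ℕ) : Finset ℕ :=
  (Finset.Icc 1 n).filter fun w => e w = y ∧ w ≤ k

/-- The entries of the initial table restricted to the vertices up to `k`. -/
noncomputable def initCount (n : ℕ) (a : ℕ → ℕ → Prop) (e : ℕ → ℕ) (k y p : ℕ) : ℕ :=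
  cntSets (initRow n e k y) (fun _ => True) (state n a (initRow n e k y) (n + 1)) p

theorem initCount_zero (n : ℕ) (a : ℕ → ℕ → Prop) (e : ℕ → ℕ) (y p : ℕ) :
    initCount n a e 0 y p = if p = 0 then 1 else 0 := by
  have h : initRow n e 0 y = ∅ := by
    ext w
    simp [initRow]
    omega
  rw [initCount, h]
  by_cases hp : p = 0
  · subst hp
    simp [cntSets, state]
  · simp [cntSets, state, hp, Ne.symm hp]

/-- The initial table is complete when all vertices have been added. -/
theorem initCount_last (n : ℕ) (a : ℕ → ℕ → Prop) (par e : ℕ → ℕ) (y p : ℕ) :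
    initCount n a e n y p = rowCount n a par e 0 y p := by
  rw [ElimForest.rowCount_zero, initCount]
  have : initRow n e n y = (Finset.Icc 1 n).filter fun w => e w = y := by
    ext w
    simp only [initRow, Finset.mem_filter, Finset.mem_Icc]
    tauto
  rw [this]

/-- The distribution of the state of a single vertex. -/
def single (n w p : ℕ) : ℕ := if p = w ∨ p = 2 * n + 1 - w then 1 else 0

theorem sum_single_le (n w N : ℕ) : ∑ q ∈ Finset.range N, single n w q ≤ 2 := by
  unfold single
  rw [← Finset.sum_filter, Finset.sum_const, smul_eq_mul, mul_one]
  refine (Finset.card_le_card (t := {w, 2 * n + 1 - w}) fun q hq => ?_).trans Finset.card_le_two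
  simpa using (Finset.mem_filter.1 hq).2

/-- Adding the vertex `k + 1` to its row is a merge with the distribution of a single vertex. -/
theorem initCount_succ {n : ℕ} {a : ℕ → ℕ → Prop} {e : ℕ → ℕ} {k : ℕ} (hk : k < n) (y p : ℕ) :
    initCount n a e (k + 1) y p = if y = e (k + 1) then
      maxConv (single n (k + 1)) (initCount n a e k y) p else initCount n a e k y p := by
  split_ifs with h
  · have h1 : initRow n e (k + 1) y = {k + 1} ∪ initRow n e k y := by
      ext w
      simp only [initRow, Finset.mem_filter, Finset.mem_Icc, Finset.mem_union, Finset.mem_singleton]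
      constructor
      · rintro ⟨h1, h2, h3⟩
        by_cases h4 : w = k + 1
        · exact .inl h4
        · exact .inr ⟨h1, h2, by omega⟩
      · rintro (rfl | ⟨h1, h2, h3⟩)
        · exact ⟨by omega, h.symm, le_rfl⟩
        · exact ⟨h1, h2, by omega⟩
    rw [initCount, h1]
    refine ElimForest.cntSets_insert (fun w hw => ?_) (fun hw => ?_) (by omega) (by omega)
      (fun p => rfl) p
    · simp only [initRow, Finset.mem_filter, Finset.mem_Icc] at hw
      omega
    · simp only [initRow, Finset.mem_filter] at hw
      omega
  · have h1 : initRow n e (k + 1) y = initRow n e k y := by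
      ext w
      simp only [initRow, Finset.mem_filter, Finset.mem_Icc]
      refine and_congr_right fun _ => and_congr_right fun h2 => ⟨fun h3 => ?_, fun h3 => by omega⟩
      by_contra h4
      obtain rfl : w = k + 1 := by omega
      exact h h2.symm
    rw [initCount, h1, initCount]

theorem card_row_le {n : ℕ} (φ : ℕ → Prop) [DecidablePred φ] :
    2 ^ ((Finset.Icc 1 n).filter φ).card ≤ 2 ^ n := by
  refine Nat.pow_le_pow_right (by omega) ((Finset.card_filter_le _ _).trans ?_)
  simp

theorem initCount_le (n : ℕ) (a : ℕ → ℕ → Prop) (e : ℕ → ℕ) (k y p : ℕ) :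
    initCount n a e k y p ≤ 2 ^ n :=
  (cntSets_le _ _ _ _).trans (card_row_le _)

theorem sum_initCount_le (n : ℕ) (a : ℕ → ℕ → Prop) (e : ℕ → ℕ) (k y N : ℕ) :
    ∑ q ∈ Finset.range N, initCount n a e k y q ≤ 2 ^ n :=
  (sum_cntSets_le _ _ _ _).trans (card_row_le _)

/-- The state after the vertices up to `k` have been added to the table. -/
structure DpCtx.InitInv (c : DpCtx) (k : ℕ) (S : Store) : Prop extends c.Labelled S where
  table : ∀ y ≤ c.n, ∀ p < 2 * c.n + 1, S.num 1 y p = initCount c.n c.a c.e k y p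
  zero : ∀ p, S.num 3 0 p = 0

/-- Add the vertex `k + 1` to its row, where `k` is the value of variable `20`. -/
def insertRound : Prog :=
  .seq (.setVar 21 (.succ (.var 20))) <|
  .seq (.setVar 22 (.arr 40 (.lit 0) (.var 20))) <|
  .seq (.setNum 3 (.lit 0) (.var 21) .one) <|
  .seq (.setNum 3 (.lit 0) (.arr 41 (.lit 0) (.var 21)) .one) <|
  .seq mergeProg <|
  .seq (.setNum 3 (.lit 0) (.var 21) .zero) <|
  .setNum 3 (.lit 0) (.arr 41 (.lit 0) (.var 21)) .zero

/-- The array `3` of numbers holds the distribution of the single vertex `k + 1` during the merge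
and is cleared afterwards. -/
theorem Spec.insertRound : Spec (α := DpCtx × ℕ) (fun c => c.1.n) 1 insertRound
    (fun c s => c.2 < c.1.n ∧ s.var 20 = c.2 ∧ c.1.InitInv c.2 s)
    (fun c s => s.var 20 = c.2 ∧ c.1.InitInv (c.2 + 1) s) := by
  refine Spec.setVar_seq <| Spec.setVar_seq <| Spec.setNum_seq ?_ <| Spec.setNum_seq ?_ <|
    Spec.seq (Mid := fun c s => c.2 < c.1.n ∧ s.var 20 = c.2 ∧ s.var 21 = c.2 + 1 ∧ c.1.Labelled s ∧
      (∀ y ≤ c.1.n, ∀ p < 2 * c.1.n + 1, s.num 1 y p = initCount c.1.n c.1.a c.1.e (c.2 + 1) y p) ∧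
      ∀ p, s.num 3 0 p = single c.1.n (c.2 + 1) p) (Spec.conseq Spec.mergeProg le_rfl ?_) <|
    Spec.setNum_seq ?_ <| Spec.setNum ?_ ?_
  · rintro c s ⟨s₁, ⟨s₀, ⟨hk, -⟩, rfl⟩, rfl⟩
    exact Nat.one_lt_two_pow (by omega)
  · rintro c s ⟨s₂, ⟨s₁, ⟨s₀, ⟨hk, -⟩, rfl⟩, rfl⟩, rfl⟩
    exact Nat.one_lt_two_pow (by omega)
  · rintro ⟨c, k⟩ s ⟨s₃, ⟨s₂, ⟨s₁, ⟨s₀, ⟨hk, hv, h⟩, rfl⟩, rfl⟩, rfl⟩, rfl⟩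
    change k < c.n at hk
    change s₀.var 20 = k at hv
    replace h : c.InitInv k s₀ := h
    have he : c.e (k + 1) ≤ c.n := h.forest.e_le (by omega) (by omega)
    have hX : ∀ p, (if p = 2 * c.n - k then 1 else if p = k + 1 then 1 else 0) =
        single c.n (k + 1) p := by
      intro p
      unfold single
      split_ifs <;> first | rfl | omega
    refine ⟨⟨c.n, c.e (k + 1), single c.n (k + 1), initCount c.n c.a c.e k (c.e (k + 1)), _⟩, rfl,
      ⟨⟨⟨?_, ?_, ?_, ?_, ?_⟩, h.pos, ?_, ?_, ?_, ?_, sum_initCount_le _ _ _ _ _, ?_⟩, rfl⟩, ?_⟩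
    · simp [Store.setVar, Store.setNum, h.v0]
    · simp [Store.setVar, Store.setNum, h.v1]
    · simp [Store.setVar, Store.setNum, h.v2]
    · simp [Store.setVar, Store.setNum, h.v3]
    · simp [Store.setVar, Store.setNum, h.v4]
    · simp [Store.setVar, Store.setNum, WExp.eval, hv, h.arr40 k hk]
    · intro p hp
      simp [Store.setVar, Store.setNum, WExp.eval, NExp.eval, hv, h.arr41 (k + 1) (by omega),
          h.zero, hX]
    · intro p hp
      simp [Store.setVar, Store.setNum, h.table _ he p hp]
    · intro N
      refine (sum_single_le _ _ _).trans ?_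
      calc 2 = 2 ^ 1 := rfl
        _ ≤ _ := Nat.pow_le_pow_right (by omega) h.pos
    · intro p
      have := initCount_succ (a := c.a) (e := c.e) hk (c.e (k + 1)) p
      rw [if_pos rfl] at this
      rw [← this]
      exact initCount_le _ _ _ _ _ _
    · intro s' hm
      refine ⟨hk, ?_, ?_, h.congr (fun y hy => ?_) hm.arr, fun y hy p hp => ?_, fun p => ?_⟩
      · rw [hm.var 20 (by decide)]; simp [Store.setVar, Store.setNum, hv]
      · rw [hm.var 21 (by decide)]; simp [Store.setVar, Store.setNum, hv, WExp.eval]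
      · rw [hm.var y (by omega)]
        have : y ≠ 21 ∧ y ≠ 22 := by omega
        simp [Store.setVar, Store.setNum, this]
      · change y ≤ c.n at hy
        change p < 2 * c.n + 1 at hp
        rw [hm.num1, initCount_succ hk]
        by_cases h1 : y = c.e (k + 1)
        · rw [if_pos ⟨h1, hp⟩, if_pos h1, h1]
        · rw [if_neg fun h' => h1 h'.1, if_neg h1]
          simp [Store.setVar, Store.setNum, h.table y hy p hp]
      · rw [hm.num3]
        simp [Store.setVar, Store.setNum, WExp.eval, NExp.eval, hv, h.arr41 (k + 1) (by omega),
            h.zero, hX]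
  · rintro c s -
    exact Nat.pow_pos (by omega)
  · rintro c s -
    exact Nat.pow_pos (by omega)
  · rintro ⟨c, k⟩ s ⟨s₀, ⟨hk, hv, hv1, h, ht, hs⟩, rfl⟩
    change k < c.n at hk
    change s₀.var 21 = k + 1 at hv1
    replace h : c.Labelled s₀ := h
    refine ⟨hv, h.congr (fun _ _ => rfl) rfl, fun y hy p hp => ?_, fun p => ?_⟩
    · simp [Store.setNum, ht y hy p hp]
    · simp [Store.setNum, WExp.eval, NExp.eval, hv1, h.arr41 (k + 1) (by omega), hs, single]
      omega

theorem rowCount_le (n : ℕ) (a : ℕ → ℕ → Prop) (par e : ℕ → ℕ) (k y p : ℕ) :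
    rowCount n a par e k y p ≤ 2 ^ n :=
  (cntSets_le _ _ _ _).trans (card_row_le _)

theorem sum_rowCount_le (n : ℕ) (a : ℕ → ℕ → Prop) (par e : ℕ → ℕ) (k y N : ℕ) :
    ∑ q ∈ Finset.range N, rowCount n a par e k y q ≤ 2 ^ n :=
  (sum_cntSets_le _ _ _ _).trans (card_row_le _)

/-- The state after the vertices from `n - k + 1` to `n` have been closed. -/
structure DpCtx.CloseInv (c : DpCtx) (k : ℕ) (S : Store) : Prop extends c.Labelled S where
  v21 : S.var 21 = c.n - k
  table : ∀ y ≤ c.n - k, ∀ p < 2 * c.n + 1, S.num 1 y p = rowCount c.n c.a c.par c.e k y p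

/-- Close the vertex in variable `21`: its row is restricted to the sets that dominate it and merged
into the row of its parent. -/
def closeRound : Prog :=
  .seq (.for 23 3 (.setNum 3 (.lit 0) (.var 23) (.num 1 (.var 21) (.var 23)))) <|
  .seq (.setNum 3 (.lit 0) (.lit 0) (.add (.num 1 (.var 21) (.lit 0))
    (.num 1 (.var 21) (.arr 41 (.lit 0) (.var 21))))) <|
  .seq (.setNum 3 (.lit 0) (.var 21) .zero) <|
  .seq (.setNum 3 (.lit 0) (.arr 41 (.lit 0) (.var 21)) .zero) <|
  .seq (.setVar 22 (.arr 39 (.lit 0) (.pred (.var 21)))) <|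
  .seq mergeProg <|
  .setVar 21 (.pred (.var 21))

theorem DpCtx.CloseInv.congr {c : DpCtx} {k : ℕ} {S S' : Store} (h : c.CloseInv k S)
    (hv : ∀ y, y < 5 ∨ y = 21 → S'.var y = S.var y) (ha : S'.arr = S.arr)
        (h1 : S'.num 1 = S.num 1) :
    c.CloseInv k S' :=
  { toLabelled := h.toLabelled.congr (fun y hy => hv y (.inl hy)) ha
    v21 := (hv 21 (.inr rfl)).trans h.v21
    table := by rw [h1]; exact h.table }

/-- The row of the vertex `n - k` after this vertex has been closed. -/
noncomputable def DpCtx.closed (c : DpCtx) (k p : ℕ) : ℕ :=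
  cntSets (rowSet c.n c.par c.e k (c.n - k))
    (fun S => RowValid c.n c.a c.par k (c.n - k) S ∧ Dominated c.a S (c.n - k))
    (state c.n c.a (rowSet c.n c.par c.e k (c.n - k)) (c.n - k)) p

/-- The closed row, as given by `ElimForest.cntSets_close`, is prepared in the array `3` of numbers
and then merged into the row of the parent by `ElimForest.rowCount_succ`. -/
theorem Spec.closeRound : Spec (α := DpCtx × ℕ) (fun c => c.1.n) 1 closeRound
    (fun c s => c.2 < c.1.n ∧ s.var 20 = c.2 ∧ c.1.CloseInv c.2 s)
    (fun c s => s.var 20 = c.2 ∧ c.1.CloseInv (c.2 + 1) s) := by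
  refine Spec.seq (Mid := fun c s => c.2 < c.1.n ∧ s.var 20 = c.2 ∧ c.1.CloseInv c.2 s ∧
      ∀ p < 2 * c.1.n + 1, s.num 3 0 p = s.num 1 (c.1.n - c.2) p)
    (Spec.for (d := 0) (fun c => 2 * c.1.n + 1) (fun c k s => c.2 < c.1.n ∧ s.var 20 = c.2 ∧
      c.1.CloseInv c.2 s ∧ ∀ p < k, s.num 3 0 p = s.num 1 (c.1.n - c.2) p) (by decide)
      (fun c => le_rfl) ?_ (Spec.setNum ?_ ?_) fun c s h => h) <|
    Spec.setNum_seq ?_ <| Spec.setNum_seq ?_ <| Spec.setNum_seq ?_ <| Spec.setVar_seq <|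
    Spec.seq (Mid := fun c s => c.2 < c.1.n ∧ s.var 20 = c.2 ∧ c.1.Labelled s ∧
      s.var 21 = c.1.n - c.2 ∧ ∀ y ≤ c.1.n - (c.2 + 1), ∀ p < 2 * c.1.n + 1,
        s.num 1 y p = rowCount c.1.n c.1.a c.1.par c.1.e (c.2 + 1) y p)
      (Spec.conseq Spec.mergeProg le_rfl ?_) <|
    Spec.setVar ?_
  · rintro ⟨c, k⟩ s ⟨hk, hv, h⟩
    refine ⟨h.v3, hk, by simpa [Store.setVar] using hv, h.congr (fun y hy => ?_) rfl rfl, by simp⟩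
    have : y ≠ 23 := by omega
    simp [Store.setVar, this]
  · rintro ⟨⟨c, k⟩, p⟩ s ⟨hp, hvp, hv3, hk, hv, h, hs⟩
    change p < 2 * c.n + 1 at hp
    change s.var 23 = p at hvp
    change k < c.n at hk
    replace h : c.CloseInv k s := h
    simp only [NExp.eval, WExp.eval, h.v21, hvp, h.table _ le_rfl p hp]
    exact two_pow_lt h.pos (rowCount_le _ _ _ _ _ _ _)
  · rintro ⟨⟨c, k⟩, p⟩ s ⟨hp, hvp, hv3, hk, hv, h, hs⟩
    change p < 2 * c.n + 1 at hp
    change s.var 23 = p at hvp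
    change k < c.n at hk
    change ∀ q < p, s.num 3 0 q = s.num 1 (c.n - k) q at hs
    replace h : c.CloseInv k s := h
    refine ⟨hvp, hv3, hk, by simpa [Store.setVar, Store.setNum] using hv,
        h.congr (fun y hy => ?_) rfl ?_,
      fun q hq => ?_⟩
    · have : y ≠ 23 := by omega
      simp [Store.setVar, Store.setNum, this]
    · funext i j
      simp [Store.setVar, Store.setNum]
    · rcases Nat.lt_succ_iff_lt_or_eq.1 hq with h1 | rfl
      · have : q ≠ p := by omega
        simp [Store.setVar, Store.setNum, WExp.eval, hvp, this, hs q h1]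
      · simp [Store.setVar, Store.setNum, WExp.eval, NExp.eval, hvp, h.v21]
  · rintro ⟨c, k⟩ s ⟨hk, hv, h, hs⟩
    change k < c.n at hk
    replace h : c.CloseInv k s := h
    refine two_pow_lt h.pos ?_
    have h1 := h.forest.cntSets_close hk 0
    rw [if_pos rfl, ← h.table _ le_rfl 0 (by omega), ← h.table _ le_rfl _ (by omega)] at h1
    simp only [NExp.eval, WExp.eval, h.v21, h.arr41 (c.n - k) (by omega)]
    rw [← h1]
    exact (cntSets_le _ _ _ _).trans (card_row_le _)
  · rintro c s -
    exact Nat.pow_pos (by omega)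
  · rintro c s -
    exact Nat.pow_pos (by omega)
  · rintro ⟨c, k⟩ s ⟨s₃, ⟨s₂, ⟨s₁, ⟨s₀, ⟨hk, hv, h, hs⟩, rfl⟩, rfl⟩, rfl⟩, rfl⟩
    change k < c.n at hk
    change s₀.var 20 = k at hv
    change ∀ p < 2 * c.n + 1, s₀.num 3 0 p = s₀.num 1 (c.n - k) p at hs
    replace h : c.CloseInv k s₀ := h
    have hpl := h.forest.par_lt (x := c.n - k) (by omega) (by omega)
    have hc : ∀ p, maxConv (c.closed k) (rowCount c.n c.a c.par c.e k (c.par (c.n - k))) p =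
        rowCount c.n c.a c.par c.e (k + 1) (c.par (c.n - k)) p := fun p =>
      (h.forest.rowCount_succ hk p fun q => rfl).symm
    refine ⟨⟨c.n, c.par (c.n - k), c.closed k,
        rowCount c.n c.a c.par c.e k (c.par (c.n - k)), _⟩, rfl,
      ⟨⟨⟨?_, ?_, ?_, ?_, ?_⟩, h.pos, ?_, ?_, ?_, fun N => ?_, fun N => ?_,
        fun p => ?_⟩, rfl⟩, ?_⟩
    · simp [Store.setVar, Store.setNum, h.v0]
    · simp [Store.setVar, Store.setNum, h.v1]
    · simp [Store.setVar, Store.setNum, h.v2]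
    · simp [Store.setVar, Store.setNum, h.v3]
    · simp [Store.setVar, Store.setNum, h.v4]
    · have := h.arr39 (c.n - k - 1) (by omega)
      rw [show c.n - k - 1 + 1 = c.n - k by omega] at this
      simp [Store.setVar, Store.setNum, WExp.eval, h.v21, this]
    · intro p hp
      have h1 := h.forest.cntSets_close hk p
      have h2 : c.n - k ≠ 0 := by omega
      have h3 : 2 * c.n + 1 - (c.n - k) ≠ 0 := by omega
      rw [← h.table _ le_rfl 0 (by omega), ← h.table _ le_rfl p hp,
        ← h.table _ le_rfl _ (show 2 * c.n + 1 - (c.n - k) < 2 * c.n + 1 by omega)] at h1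
      change _ = c.closed k p
      rw [DpCtx.closed, h1]
      simp only [Store.setVar, Store.setNum, WExp.eval, NExp.eval, h.v21,
          h.arr41 (c.n - k) (by omega),
        true_and, hs p hp]
      split_ifs <;> first | rfl | omega
    · intro p hp
      simp [Store.setVar, Store.setNum, h.table _ (show c.par (c.n - k) ≤ c.n - k by omega) p hp]
    · change ∑ q ∈ Finset.range N, c.closed k q ≤ 2 ^ c.n
      exact (sum_cntSets_le _ _ _ N).trans (card_row_le _)
    · change ∑ q ∈ Finset.range N, rowCount c.n c.a c.par c.e k (c.par (c.n - k)) q ≤ 2 ^ c.n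
      exact sum_rowCount_le _ _ _ _ _ _ N
    · exact (hc p).trans_le (rowCount_le _ _ _ _ _ _ _)
    · intro s' hm
      refine ⟨hk, ?_, h.toLabelled.congr (fun y hy => ?_) hm.arr, ?_, fun y hy p hp => ?_⟩
      · rw [hm.var 20 (by decide)]; simp [Store.setVar, Store.setNum, hv]
      · rw [hm.var y (by omega)]
        have : y ≠ 22 := by omega
        simp [Store.setVar, Store.setNum, this]
      · rw [hm.var 21 (by decide)]; simp [Store.setVar, Store.setNum, h.v21]
      · change y ≤ c.n - (k + 1) at hy
        change p < 2 * c.n + 1 at hp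
        rw [hm.num1]
        by_cases h1 : y = c.par (c.n - k)
        · rw [if_pos ⟨h1, hp⟩, h1, hc]
        · rw [if_neg fun h' => h1 h'.1, h.forest.rowCount_succ_of_ne hk (by omega) h1,
            ← h.table y (by omega) p hp]
          simp [Store.setVar, Store.setNum]
  · rintro ⟨c, k⟩ s ⟨hk, hv, h, h21, ht⟩
    change s.var 21 = c.n - k at h21
    replace h : c.Labelled s := h
    refine ⟨by simpa [Store.setVar] using hv, h.congr (fun y hy => ?_) rfl, ?_, ht⟩
    · have : y ≠ 21 := by omega
      simp [Store.setVar, this]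
    · simp [Store.setVar, WExp.eval, h21]
      omega

/-- Count the dominating sets by dynamic programming over the elimination forest. -/
def dpProg : Prog :=
  .seq (.for 20 4 (.setNum 1 (.var 20) (.lit 0) .one)) <|
  .seq (.for 20 0 insertRound) <|
  .seq (.setVar 21 (.var 0)) <|
  .seq (.for 20 0 closeRound) <|
  .setNum 0 (.lit 0) (.lit 0) (.num 1 (.lit 0) (.lit 0))

/-- The dynamic program takes only `O(n²)` steps. -/
theorem Spec.dpProg : Spec DpCtx.n 2 dpProg (fun c s => c.Labelled s ∧ s.num = fun _ _ _ => 0)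
    (fun c s => s.num 0 0 0 = cntSets (Finset.Icc 1 c.n)
      (fun S => ∀ v ∈ Finset.Icc 1 c.n, Dominated c.a S v) (fun _ => 0) 0) := by
  refine Spec.seq (Mid := fun c s => c.InitInv 0 s) ((Spec.for (d := 0) (fun c : DpCtx => c.n + 1)
      (fun c k s => c.Labelled s ∧ (∀ y p, s.num 1 y p = if y < k ∧ p = 0 then 1 else 0) ∧
        ∀ p, s.num 3 0 p = 0) (by decide) (fun c => by omega) ?_ (Spec.setNum ?_ ?_) ?_).conseq
      (by omega) fun c s h => ⟨c, rfl, h, fun _ h => h⟩) <|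
    Spec.seq (Mid := fun c s => c.InitInv c.n s) (Spec.for (d := 1) DpCtx.n
      (fun c k s => c.InitInv k s) (by decide) (fun c => by omega) ?_ ?_ fun c s h => h) <|
    Spec.seq (Mid := fun c s => c.CloseInv 0 s) (Spec.setVar ?_) <|
    Spec.seq (Mid := fun c s => c.CloseInv c.n s) (Spec.for (d := 1) DpCtx.n
      (fun c k s => c.CloseInv k s) (by decide) (fun c => by omega) ?_ ?_ fun c s h => h) <|
    Spec.setNum ?_ ?_
  · rintro c s ⟨h, h0⟩
    refine ⟨h.v4, h.congr (fun y hy => ?_) rfl, ?_, ?_⟩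
    · have : y ≠ 20 := by omega
      simp [Store.setVar, this]
    · simp [Store.setVar, h0]
    · simp [Store.setVar, h0]
  · rintro ⟨c, k⟩ s ⟨-, -, -, h, -⟩
    exact Nat.one_lt_two_pow (by have := h.pos; omega)
  · rintro ⟨c, k⟩ s ⟨hk, hv, hv4, h, h1, h3⟩
    change s.var 20 = k at hv
    change ∀ y p, s.num 1 y p = if y < k ∧ p = 0 then 1 else 0 at h1
    replace h : c.Labelled s := h
    refine ⟨hv, hv4, h.congr (fun y hy => ?_) rfl, fun y p => ?_, fun p => ?_⟩
    · have : y ≠ 20 := by omega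
      simp [Store.setVar, Store.setNum, this]
    · simp only [Store.setVar, Store.setNum, WExp.eval, NExp.eval, hv, h1, true_and]
      split_ifs <;> first | rfl | omega
    · simp [Store.setVar, Store.setNum, h3 p]
  · rintro c s ⟨h, h1, h3⟩
    refine ⟨h, fun y hy p hp => ?_, h3⟩
    rw [h1, initCount_zero]
    split_ifs <;> first | rfl | omega
  · intro c s h
    refine ⟨h.v0, h.toLabelled.congr (fun y hy => ?_) rfl, h.table, h.zero⟩
    have : y ≠ 20 := by omega
    simp [Store.setVar, this]
  · refine Spec.conseq Spec.insertRound le_rfl ?_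
    rintro ⟨c, k⟩ s ⟨hk, hv, -, h⟩
    refine ⟨(c, k), rfl, ⟨hk, hv, h⟩, ?_⟩
    rintro s' ⟨hv', h'⟩
    refine ⟨hv', h'.v0, h'.toLabelled.congr (fun y hy => ?_) rfl, h'.table, h'.zero⟩
    have : y ≠ 20 := by omega
    simp [Store.setVar, this]
  · intro c s h
    refine ⟨h.toLabelled.congr (fun y hy => ?_) rfl, ?_, fun y hy p hp => ?_⟩
    · have : y ≠ 21 := by omega
      simp [Store.setVar, this]
    · simp [Store.setVar, WExp.eval, h.v0]
    · rw [← initCount_last]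
      exact h.table y hy p hp
  · intro c s h
    refine ⟨h.v0, h.congr (fun y hy => ?_) rfl rfl⟩
    have : y ≠ 20 := by omega
    simp [Store.setVar, this]
  · refine Spec.conseq Spec.closeRound le_rfl ?_
    rintro ⟨c, k⟩ s ⟨hk, hv, -, h⟩
    refine ⟨(c, k), rfl, ⟨hk, hv, h⟩, ?_⟩
    rintro s' ⟨hv', h'⟩
    refine ⟨hv', h'.v0, h'.congr (fun y hy => ?_) rfl rfl⟩
    have : y ≠ 20 := by omega
    simp [Store.setVar, this]
  · intro c s h
    simp only [NExp.eval, WExp.eval, h.table 0 (by omega) 0 (by omega)]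
    exact two_pow_lt h.pos (rowCount_le _ _ _ _ _ _ _)
  · intro c s h
    simp only [Store.setNum, NExp.eval, WExp.eval, h.table 0 (by omega) 0 (by omega),
        and_self, if_true]
    exact h.forest.rowCount_final

/-! ### The complete program -/

/-- Facts about the parameter can be added to the precondition and the postcondition. -/
theorem Spec.frame {α : Type*} {sz : α → ℕ} {d : ℕ} {p : Prog} {Pre Post : α → Store → Prop}
    (h : Spec sz d p Pre Post) (φ : α → Prop) :
    Spec sz d p (fun x s => φ x ∧ Pre x s) (fun x s => φ x ∧ Post x s) :=
  h.conseq le_rfl fun x _ ⟨hx, hs⟩ => ⟨x, rfl, hs, fun _ h' => ⟨hx, h'⟩⟩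

/-- Compute a tree order from a perfect elimination order. -/
def orderProg : Prog :=
  .seq blockProg₁ (.seq seedProg (.seq sweepProg (.seq blockProg₂ (.seq blockProg₃ topProg))))

theorem Spec.orderProg : Spec OrderCtx.n 3 orderProg
    (fun x s => 0 < x.n ∧ x.Good ∧ ∃ S, Known x.n x.rows x.cols x.tab 7 S ∧ St S s)
    (fun x s => ∃ S, x.TopInv (2 * x.n + 1) S ∧ St S s) :=
  Spec.seq (Spec.blockProg₁.frame fun x => 0 < x.n) <|
    Spec.seq (Spec.seedProg.frame fun x => 0 < x.n) <|
    Spec.seq (Spec.sweepProg.frame fun x => 0 < x.n) <|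
    Spec.seq (Spec.blockProg₂.frame fun x => 0 < x.n) <|
    Spec.seq (Spec.blockProg₃.frame fun x => 0 < x.n) <|
    Spec.topProg.conseq le_rfl fun x _ h => ⟨x, rfl, ⟨h.2, h.1⟩, fun _ h' => h'⟩

theorem IsOrdered.known {n : ℕ} {adj : ℕ → ℕ → Prop} {S : Store} (h : IsOrdered n adj S) :
    (OrderCtx.mk n adj (S.arr 1 0)).Good ∧ Known n (OrderCtx.mk n adj (S.arr 1 0)).rows
      (OrderCtx.mk n adj (S.arr 1 0)).cols (OrderCtx.mk n adj (S.arr 1 0)).tab 7 S := by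
  refine ⟨⟨h.model, h.peo⟩, h.toSizes, ?_, h.zero, h.num⟩
  intro a ha i hi j hj
  obtain rfl | rfl | h2 : a = 0 ∨ a = 1 ∨ 2 ≤ a := by omega
  · exact h.adj_eq i j
  · obtain rfl : i = 0 := Nat.lt_one_iff.1 hi
    rfl
  · exfalso
    unfold OrderCtx.rows at hi
    split at hi <;> omega

/-- The data for the dynamic program. -/
noncomputable def LabelCtx.dp (x : LabelCtx) : DpCtx :=
  ⟨x.n, labelAdj x.B, fun y => parentOf x.n x.B (y - 1), fun w => lastNbr x.n x.B (w - 1)⟩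

theorem LabelCtx.Good.labelled {x : LabelCtx} (hx : x.Good) (hn : 0 < x.n) {S s : Store}
    (h : Known x.n x.rows x.cols x.tab 42 S) (hs : St S s) : x.dp.Labelled s := by
  have : x.dp.Labelled S :=
    { h.toSizes with
      pos := hn
      forest := hx.elimForest
      arr39 := fun p hp => h.get 39 (by omega) 0 Nat.one_pos p hp
      arr40 := fun p hp => h.get 40 (by omega) 0 Nat.one_pos p hp
      arr41 := fun v hv => h.get 41 (by omega) 0 Nat.one_pos v (Nat.lt_succ_of_le hv) }
  refine this.congr (fun y hy => hs.var y ?_) hs.arr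
  simp
  omega

/-- The program for counting dominating sets. -/
def countProg : Prog :=
  .seq peoProg (.seq orderProg (.seq labelProg dpProg))

/-- The number found is the number of dominating sets of a relabelled copy of the graph. -/
theorem Spec.countProg : Spec (α := ℕ × (ℕ → ℕ → Prop)) (fun x => x.1) 3 countProg
    (fun x s => 0 < x.1 ∧ IsInput x.1 x.2 s)
    (fun x s => ∃ y : LabelCtx, y.Good ∧ y.n = x.1 ∧ y.adj = x.2 ∧
      s.num 0 0 0 = cntSets (Finset.Icc 1 y.n)
        (fun S => ∀ v ∈ Finset.Icc 1 y.n, Dominated (labelAdj y.B) S v) (fun _ => 0) 0) := by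
  refine Spec.seq (Spec.peoProg.frame fun x => 0 < x.1) <|
    Spec.seq (Mid := fun x s => 0 < x.1 ∧ ∃ y : LabelCtx, (y.n = x.1 ∧ y.adj = x.2) ∧ y.Good ∧
      ∃ S, Known y.n y.rows y.cols y.tab 36 S ∧ St S s) (Spec.conseq Spec.orderProg le_rfl ?_) <|
    Spec.seq (Mid := fun x s => 0 < x.1 ∧ ∃ y : LabelCtx, (y.n = x.1 ∧ y.adj = x.2) ∧ y.Good ∧
      ∃ S, Known y.n y.rows y.cols y.tab 42 S ∧ St S s) (Spec.conseq Spec.labelProg le_rfl ?_) <|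
    Spec.conseq Spec.dpProg (by omega) ?_
  · rintro ⟨n, adj⟩ s ⟨hn, S, h, hs⟩
    refine ⟨⟨n, adj, S.arr 1 0⟩, rfl, ⟨hn, h.known.1, S, h.known.2, hs⟩, ?_⟩
    rintro s' ⟨S', h', hs'⟩
    exact ⟨hn, _, ⟨rfl, rfl⟩, h'.label.1, S', h'.label.2, hs'⟩
  · rintro ⟨n, adj⟩ s ⟨hn, y, hy, h⟩
    exact ⟨y, hy.1, h, fun s' h' => ⟨hn, y, hy, h'⟩⟩
  · rintro ⟨n, adj⟩ s ⟨hn, y, hy, hg, S, h, hs⟩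
    exact ⟨y.dp, hy.1, ⟨hg.labelled (by rw [hy.1]; exact hn) h hs, hs.num.trans h.num⟩,
      fun s' h' => ⟨y, hg, hy.1, hy.2, h'⟩⟩

theorem isInput_graphInput {n : ℕ} {G : SimpleGraph (Fin n)} (hG : IsRootedDirectedPathGraph G) :
    IsInput n (natAdj G) (graphInput G) where
  model := hG.nonempty_model
  v0 := rfl
  var y hy := if_neg hy
  adj_eq _ _ := by
    classical exact if_congr (and_iff_right rfl) rfl rfl
  zero a ha := by
    funext i j
    simp [graphInput, ha]
  num := rfl

/-- The relabelling of the vertices preserves the number of dominating sets. -/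
theorem LabelCtx.Good.numDominatingSets_eq {x : LabelCtx} (hx : x.Good) {n : ℕ}
    {G : SimpleGraph (Fin n)} (hn : x.n = n) (ha : x.adj = natAdj G) :
    numDominatingSets G = cntSets (Finset.Icc 1 x.n)
      (fun S => ∀ v ∈ Finset.Icc 1 x.n, Dominated (labelAdj x.B) S v) (fun _ => 0) 0 := by
  subst hn
  refine _root_.numDominatingSets_eq G (f := fun u => x.ρ u + 1) (fun u hu => ?_)
    (fun u hu v hv h => hx.inj u hu v hv (by omega)) fun u hu v hv => ?_
  · have := hx.lt u hu
    omega
  · simp [labelAdj, LabelCtx.B, hx.vt_ρ hu, hx.vt_ρ hv, hx.lt u hu, hx.lt v hv, ha]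

theorem theorem2 :
    ∃ (p : Prog) (C : ℕ), ∀ (n : ℕ), 0 < n → ∀ G : SimpleGraph (Fin n),
      IsRootedDirectedPathGraph G →
        ∃ (s : Store) (t : ℕ), Run (C * n) p (graphInput G) s t ∧ t ≤ C * n ^ 3 ∧
          s.num 0 0 0 = numDominatingSets G := by
  obtain ⟨C, hC⟩ := Spec.countProg
  refine ⟨countProg, 8 * C + 2, fun n hn G hG => ?_⟩
  obtain ⟨s, t, h1, h2, y, hy, hyn, hya, h3⟩ := hC (n, natAdj G) ((8 * C + 2) * n) (graphInput G)
    (Nat.mul_le_mul_right n (by omega)) ⟨hn, isInput_graphInput hG⟩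
  refine ⟨s, t, h1, h2.trans ?_, h3.trans (hy.numDominatingSets_eq hyn hya).symm⟩
  calc C * (n + 1) ^ 3 ≤ C * (2 * n) ^ 3 :=
        Nat.mul_le_mul_left _ (Nat.pow_le_pow_left (by omega) _)
    _ = 8 * C * n ^ 3 := by ring
    _ ≤ (8 * C + 2) * n ^ 3 := Nat.mul_le_mul_right _ (by omega)
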